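/- Let $d>8$ be an integer and fix a norm $\|\cdot\|$ on $\mathbb{R}^d$. For $L\in\mathbb{N}$ let $\Lambda=\{x\in\mathbb{Z}^d: 0<\|x\|\le L\}$, let $D(x)=|\Lambda|^{-1}\mathbf{1}\{x\in\Lambda\}$ be the uniform distribution on $\Lambda$, and let $D^{*n}$ be its $n$-fold convolution on $\mathbb{Z}^d$. A lattice tree is a finite tree $T=(V_T,E_T)$ (connected and without cycles, with $V_T\ne\varnothing$; a single vertex without edges is allowed) whose vertices are points of $\mathbb{Z}^d$ and whose edges are pairs $\{x,y\}$ with $0<\|x-y\|\le L$. For $p>0$ the 1-point function is $$g_p=\sum_{T:\,o\in V_T}\Big(\frac{p}{|\Lambda|}\Big)^{|E_T|}\in[0,\infty],$$ the sum being over all lattice trees containing the origin $o$. Then there are constants $C<\infty$ and $L_0\ge1$, depending only on $d$ and the norm, such that for every integer $L\ge L_0$: the series $\sum_{n\ge2}\frac{n+1}{2}D^{*n}(o)$ converges; there is exactly one $p_1>0$ with $g_{p_1}<\infty$ and $p_1g_{p_1}=1$; and $$\Big|\,g_{p_1}-e\Big(1-\sum_{n=2}^\infty\frac{n+1}{2}D^{*n}(o)\Big)\Big|\le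 C L^{-2d},\qquad \Big|\,p_1-\Big(\frac1e+\sum_{n=2}^\infty\frac{n+1}{2e}D^{*n}(o)\Big)\Big|\le C L^{-2d}.$$ That is, as $L\to\infty$, $g_{p_1}=e\big(1-\sum_{n\ge2}\frac{n+1}{2}D^{*n}(o)\big)+O(L^{-2d})$ and $p_1=\frac1e+\sum_{n\ge2}\frac{n+1}{2e}D^{*n}(o)+O(L^{-2d})$. -/

import Mathlib

noncomputable section

namespace LatticeTree

/-- `N x` for an integer point `x`, where `N` is a seminorm on `ℝ ^ d`. -/
def latticeNorm {d : ℕ} (N : Seminorm ℝ (Fin d → ℝ)) (x : Fin d → ℤ) : ℝ :=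
  N (fun i => (x i : ℝ))

theorem latticeNorm_sub_comm {d : ℕ} (N : Seminorm ℝ (Fin d → ℝ)) (x y : Fin d → ℤ) :
    latticeNorm N (x - y) = latticeNorm N (y - x) := by
  unfold latticeNorm
  rw [← map_neg_eq_map N]
  congr 1
  funext i
  simp

/-- The set `Λ = {x ∈ ℤ ^ d : 0 < ‖x‖ ≤ L}` of steps of range at most `L`. -/
def steps {d : ℕ} (N : Seminorm ℝ (Fin d → ℝ)) (L : ℕ) : Set (Fin d → ℤ) :=
  {x | 0 < latticeNorm N x ∧ latticeNorm N x ≤ L}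

/-- The cardinality `|Λ|`, i.e. the degree of every vertex of the spread-out lattice. -/
def numSteps {d : ℕ} (N : Seminorm ℝ (Fin d → ℝ)) (L : ℕ) : ℕ :=
  (steps N L).ncard

/-- For an honest norm `Λ` is a finite set, so that `numSteps` is its true cardinality. -/
theorem steps_finite {d : ℕ} (N : Seminorm ℝ (Fin d → ℝ)) (hN : ∀ x, N x = 0 → x = 0)
    (L : ℕ) : (steps N L).Finite := by
  have hcont : Continuous N := by
    have hb : ∀ x : Fin d → ℝ, N x ≤ (∑ i, N (Pi.single i 1)) * ‖x‖ := by
      intro x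
      calc N x = N (∑ i, x i • (Pi.single i (1 : ℝ) : Fin d → ℝ)) := by
            congr 1
            exact pi_eq_sum_univ' x
        _ ≤ ∑ i, N (x i • (Pi.single i (1 : ℝ) : Fin d → ℝ)) :=
            Finset.le_sum_of_subadditive N (map_zero N).le (map_add_le_add N) _ _
        _ ≤ ∑ i, N (Pi.single i 1) * ‖x‖ := by
            refine Finset.sum_le_sum fun i _ => ?_
            rw [map_smul_eq_mul, mul_comm]
            exact mul_le_mul_of_nonneg_left (norm_le_pi_norm x i) (apply_nonneg N _)
        _ = _ := by rw [Finset.sum_mul]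
    have hC : 0 ≤ ∑ i, N (Pi.single i (1 : ℝ) : Fin d → ℝ) :=
      Finset.sum_nonneg fun i _ => apply_nonneg N _
    refine (LipschitzWith.of_dist_le_mul (K := ⟨_, hC⟩) fun x y => ?_).continuous
    rw [Real.dist_eq, dist_eq_norm]
    exact (abs_sub_map_le_sub N x y).trans (hb _)
  obtain ⟨c, hc, hcN⟩ : ∃ c : ℝ, 0 < c ∧ ∀ x : Fin d → ℝ, c * ‖x‖ ≤ N x := by
    rcases (Metric.sphere (0 : Fin d → ℝ) 1).eq_empty_or_nonempty with he | hne
    · refine ⟨1, one_pos, fun x => ?_⟩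
      by_cases hx : x = 0
      · simp [hx]
      · exfalso
        have : ‖x‖⁻¹ • x ∈ Metric.sphere (0 : Fin d → ℝ) 1 := by
          simp [norm_smul, hx]
        simp [he] at this
    · obtain ⟨z, hz, hmin⟩ := (isCompact_sphere (0 : Fin d → ℝ) 1).exists_isMinOn hne
        hcont.continuousOn
      have hz0 : z ≠ 0 := by
        rintro rfl
        simp at hz
      refine ⟨N z, lt_of_le_of_ne (apply_nonneg N z) fun h => hz0 (hN z h.symm), fun x => ?_⟩
      by_cases hx : x = 0
      · simp [hx]
      · have hm : N z ≤ N (‖x‖⁻¹ • x) := hmin (by simp [norm_smul, hx])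
        rw [map_smul_eq_mul, norm_inv, norm_norm] at hm
        have hx' : 0 < ‖x‖ := norm_pos_iff.mpr hx
        rw [inv_mul_eq_div, le_div_iff₀ hx'] at hm
        exact hm
  refine (Set.finite_Icc (fun _ : Fin d => -⌈(L : ℝ) / c⌉) (fun _ => ⌈(L : ℝ) / c⌉)).subset ?_
  intro x hx
  have h1 : ‖(fun i => (x i : ℝ))‖ ≤ (L : ℝ) / c := by
    rw [le_div_iff₀ hc, mul_comm]
    exact (hcN _).trans hx.2
  have h2 : ∀ i, |(x i : ℝ)| ≤ ⌈(L : ℝ) / c⌉ := fun i =>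
    ((norm_le_pi_norm (fun i => (x i : ℝ)) i).trans h1).trans (Int.le_ceil _)
  refine ⟨fun i => ?_, fun i => ?_⟩
  · have := (abs_le.mp (h2 i)).1
    exact_mod_cast this
  · have := (abs_le.mp (h2 i)).2
    exact_mod_cast this

/-- The uniform distribution `D` on `Λ`. -/
def stepDist {d : ℕ} (N : Seminorm ℝ (Fin d → ℝ)) (L : ℕ) : (Fin d → ℤ) → ℝ :=
  (steps N L).indicator fun _ => 1 / (numSteps N L : ℝ)

/-- The `n`-fold convolution `f^{*n}` on `ℤ ^ d`, where `f^{*0}` is the unit mass at the origin. -/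
def convPow {d : ℕ} (f : (Fin d → ℤ) → ℝ) : ℕ → (Fin d → ℤ) → ℝ
  | 0 => Pi.single 0 1
  | n + 1 => fun x => ∑' y, convPow f n y * f (x - y)

/-- The spread-out lattice: `ℤ ^ d` with all edges `{x, y}` such that `0 < ‖x - y‖ ≤ L`. -/
def spreadOutGraph {d : ℕ} (N : Seminorm ℝ (Fin d → ℝ)) (L : ℕ) :
    SimpleGraph (Fin d → ℤ) where
  Adj x y := x - y ∈ steps N L
  symm := ⟨fun x y h => by
    
    change 0 < latticeNorm N (y - x) ∧ latticeNorm N (y - x) ≤ L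
    rw [latticeNorm_sub_comm N y x]
    exact h⟩
  loopless := ⟨fun x h => by
    have h0 : latticeNorm N (0 : Fin d → ℤ) = 0 := by
      unfold latticeNorm
      exact (congrArg N (by funext i; simp)).trans (map_zero N)
    have h1 := h.1
    rw [sub_self, h0] at h1
    exact lt_irrefl _ h1⟩

/-- The lattice trees `T = (V_T, E_T)` containing the origin: finite subgraphs of the spread-out
lattice which are trees and have the origin among their vertices (a single vertex is a tree). -/
def rootedTrees {d : ℕ} (N : Seminorm ℝ (Fin d → ℝ)) (L : ℕ) :
    Set (spreadOutGraph N L).Subgraph :=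
  {T | T.verts.Finite ∧ T.coe.IsTree ∧ 0 ∈ T.verts}

/-- The weight `W_p(T) = (p / |Λ|) ^ |E_T|`. -/
def weight {d : ℕ} (N : Seminorm ℝ (Fin d → ℝ)) (L : ℕ) (p : ℝ)
    (T : (spreadOutGraph N L).Subgraph) : ℝ :=
  (p / (numSteps N L : ℝ)) ^ T.edgeSet.ncard

/-- The 1-point function `g_p`, the sum of `W_p(T)` over the lattice trees containing the origin. -/
def onePoint {d : ℕ} (N : Seminorm ℝ (Fin d → ℝ)) (L : ℕ) (p : ℝ) : ℝ :=
  ∑' T : rootedTrees N L, weight N L p T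

/-- `p` is a base point: `p > 0`, the series defining `g_p` converges, and `p g_p = 1`. -/
def IsBasePoint {d : ℕ} (N : Seminorm ℝ (Fin d → ℝ)) (L : ℕ) (p : ℝ) : Prop :=
  0 < p ∧ Summable (fun T : rootedTrees N L => weight N L p T) ∧ p * onePoint N L p = 1

end LatticeTree

end

/-!
The edge weight at the base point is `c = p / |Λ|` with `c * g * |Λ| = 1`, where `g` is the 1-point
function. Let `D` be the step distribution, let `S = ∑ n, D ^ n` be its Green function, where the
product is the convolution, and let `ε` be an upper bound on the four-fold bubble `D * S ^ 4`. The
expansion is obtained with an error `O(ε ^ 2)` on every translation invariant graph, and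
`ε = O(L ^ (-d))` on the spread-out lattice in dimension `d > 8`. All sums take values in `[0, ∞]`,
so that no summability has to be discussed before the end.

*Random walk bounds.* A tree that contains `0` and `x ≠ 0` splits uniquely at the first edge of its
path from `0` to `x` (`FinTree.tsum_mem`). If the two parts were independent, the 2-point function
`G` would satisfy `G = g + D * G`, hence be equal to `g • S`. In fact the parts are disjoint, so
that `G ≤ g • S` (`FinTree.twoPoint_le`), and the correction is bounded by a diagram with a loop
(`FinTree.green_le`, `FinTree.meetTwo_le`), by means of the tree diagram bound on the 3-point
function (`FinTree.threePoint_le`).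

*The 1-point function.* Let `a Y` be the sum over the trees at `0` in which the neighbours of `0`
belong to `Y`. Passing from `Y` to `Y ∪ {y}` multiplies `a Y` by `1 + c * g`, up to a term in which
the tree attached at `y` meets the tree at `0` (`FinTree.rootTwo_insert`). To first order they meet
at `0`, or on the branch through another neighbour `y'`, and both contributions are expressed by
`G`. As `a ∅ = 1` and `a Λ = g`, iteration over `Λ` (`expansion_of_recursion`) gives
`g ≈ (1 + 1 / |Λ|) ^ |Λ| * (1 - A)`, where `A` is the sum of `c * G y` over `y ∈ Λ` and of half of
`c ^ 2 * (G * G) (y - y')` over `y ≠ y'`. The first sum is `(D * S) 0` to leading order, and the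
second would be `(D * D * S ^ 2) 0 / 2` if it included the diagonal. The missing diagonal is
`1 / (2 * |Λ|)`, which compensates for `(1 + 1 / n) ^ n ≈ e * (1 - 1 / (2 * n))`. Thus
`g = e * (1 - (D * S) 0 - (D * D * S ^ 2) 0 / 2) + O(ε ^ 2)` (`FinTree.onePoint_expansion`). The
two terms together are the series of the theorem (`LatticeTree.hasSum_convPow`), and `p = 1 / g`.

*The base point.* The map `c ↦ c * g_c * |Λ|` is strictly increasing where it is finite, and it is
lower semicontinuous. If its value were less than one at the largest `c` where it is at most one,
then the susceptibility, which bounds its derivative, would be finite in a neighbourhood, and `c`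
could be increased (`FinTree.exists_gt_of_lt`).

*The bubble.* `D` dominates `κ • U`, where `U` is a product of one-dimensional distributions on the
box `[h, 3h) ^ d` with `h` of the order of `L`, and `κ` does not depend on `L`. The Green function
of the remaining steps has the finite mass `κ⁻¹`, so that `D * S ^ 4` is controlled by the powers of
`U` (`Conv.mul_green_pow_four_le`). The marginals of `U` are convolutions of a uniform distribution
on `h` points with a Bernoulli distribution, so that `U ^ k` is bounded by
`h ^ (-d) * (k + 1) ^ (-d / 2)` through the central binomial coefficient
(`Conv.wideInterval_pow_le`), and `(k + 1) ^ (-9 / 2)` can be summed over the lengths of four walks.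
-/


/-! ### The convolution semiring -/

noncomputable section

open scoped ENNReal

/-- Functions `V → [0, ∞]` on an additive group, as a type of its own: the multiplication is the
convolution, so that `f ^ n` is the `n`-fold convolution of `f` with itself. -/
structure Conv (V : Type*) where
  /-- The underlying function. -/
  toFun : V → ℝ≥0∞

namespace Conv

section Additive

variable {V : Type*}

instance : CoeFun (Conv V) fun _ => V → ℝ≥0∞ := ⟨toFun⟩

@[ext] theorem ext {f g : Conv V} (h : ∀ x, f x = g x) : f = g := by
  cases f
  cases g
  congr
  exact funext h

instance : LE (Conv V) := ⟨fun f g => ∀ x, f x ≤ g x⟩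

instance : PartialOrder (Conv V) where
  le_refl _ _ := le_rfl
  le_trans _ _ _ h h' x := (h x).trans (h' x)
  le_antisymm _ _ h h' := ext fun x => le_antisymm (h x) (h' x)

instance : Zero (Conv V) := ⟨⟨fun _ => 0⟩⟩

instance : Add (Conv V) := ⟨fun f g => ⟨fun x => f x + g x⟩⟩

instance : SMul ℝ≥0∞ (Conv V) := ⟨fun c f => ⟨fun x => c * f x⟩⟩

@[simp] theorem add_apply (f g : Conv V) (x : V) : (f + g) x = f x + g x := rfl

@[simp] theorem zero_apply (x : V) : (0 : Conv V) x = 0 := rfl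

@[simp] theorem smul_apply (c : ℝ≥0∞) (f : Conv V) (x : V) : (c • f) x = c * f x := rfl

open Classical in
/-- The unit mass at `a`. -/
def single (a : V) : Conv V := ⟨fun x => if x = a then 1 else 0⟩

open Classical in
theorem single_apply (a x : V) : single a x = if x = a then 1 else 0 := rfl

theorem add_le {f f' g g' : Conv V} (h : f ≤ f') (h' : g ≤ g') : f + g ≤ f' + g' :=
  fun x => add_le_add (h x) (h' x)

theorem le_add_right' (f g : Conv V) : f ≤ f + g := fun _ => le_self_add

theorem zero_le' (f : Conv V) : 0 ≤ f := fun x => zero_le (a := f x)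

/-- The total mass of a function. -/
def mass (f : Conv V) : ℝ≥0∞ := ∑' x, f x

theorem mass_single (a : V) : mass (single a) = 1 := by
  rw [mass, tsum_eq_single a]
  · simp [single_apply]
  · intro y hy
    simp [single_apply, hy]

theorem mass_add (f g : Conv V) : mass (f + g) = mass f + mass g := ENNReal.tsum_add

theorem mass_smul (c : ℝ≥0∞) (f : Conv V) : mass (c • f) = c * mass f := ENNReal.tsum_mul_left

/-- The pointwise sum of a family of functions. -/
def sum {ι : Type*} (F : ι → Conv V) : Conv V := ⟨fun x => ∑' i, F i x⟩

theorem sum_apply {ι : Type*} (F : ι → Conv V) (x : V) : sum F x = ∑' i, F i x := rfl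

theorem mass_sum {ι : Type*} (F : ι → Conv V) : mass (sum F) = ∑' i, mass (F i) :=
  ENNReal.tsum_comm

end Additive

variable {V : Type*} [AddCommGroup V]

instance : Mul (Conv V) := ⟨fun f g => ⟨fun x => ∑' y, f y * g (x - y)⟩⟩

instance : One (Conv V) := ⟨single 0⟩

theorem mul_apply (f g : Conv V) (x : V) : (f * g) x = ∑' y, f y * g (x - y) := rfl

theorem one_def : (1 : Conv V) = single 0 := rfl

theorem single_mul_apply (a : V) (f : Conv V) (x : V) : (single a * f) x = f (x - a) := by
  rw [mul_apply, tsum_eq_single a]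
  · simp [single_apply]
  · intro y hy
    simp [single_apply, hy]

theorem mul_comm' (f g : Conv V) : f * g = g * f := by
  ext x
  rw [mul_apply, mul_apply, ← (Equiv.subLeft x).tsum_eq]
  refine tsum_congr fun y => ?_
  simp [mul_comm]

theorem mul_assoc' (f g h : Conv V) : f * g * h = f * (g * h) := by
  ext x
  simp only [mul_apply, ← ENNReal.tsum_mul_right, ← ENNReal.tsum_mul_left]
  rw [ENNReal.tsum_comm]
  refine tsum_congr fun z => ?_
  rw [← (Equiv.addLeft z).tsum_eq]
  refine tsum_congr fun y => ?_
  simp [mul_assoc, sub_add_eq_sub_sub]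

theorem mul_add' (f g h : Conv V) : f * (g + h) = f * g + f * h := by
  ext x
  simp only [mul_apply, add_apply, mul_add, ENNReal.tsum_add]

instance : CommSemiring (Conv V) :=
  { add_assoc := fun f g h => by ext x; simp [add_assoc]
    zero_add := fun f => by ext x; simp
    add_zero := fun f => by ext x; simp
    add_comm := fun f g => by ext x; simp [add_comm]
    nsmul := nsmulRec
    mul_assoc := mul_assoc'
    mul_comm := mul_comm'
    one_mul := fun f => by
      ext x
      rw [one_def, single_mul_apply, sub_zero]
    mul_one := fun f => by
      rw [mul_comm']
      ext x
      rw [one_def, single_mul_apply, sub_zero]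
    left_distrib := mul_add'
    right_distrib := fun f g h => by rw [mul_comm', mul_add', mul_comm' h, mul_comm' h]
    zero_mul := fun f => by ext x; simp [mul_apply]
    mul_zero := fun f => by ext x; simp [mul_apply]
    npow := npowRec }

theorem smul_mul (c : ℝ≥0∞) (f g : Conv V) : (c • f) * g = c • (f * g) := by
  ext x
  simp only [mul_apply, smul_apply, ← ENNReal.tsum_mul_left, mul_assoc]

theorem mul_smul' (c : ℝ≥0∞) (f g : Conv V) : f * (c • g) = c • (f * g) := by
  rw [mul_comm, smul_mul, mul_comm]

theorem one_apply_zero : (1 : Conv V) 0 = 1 := by simp [one_def, single_apply]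

theorem one_apply_of_ne {x : V} (hx : x ≠ 0) : (1 : Conv V) x = 0 := by
  simp [one_def, single_apply, hx]

theorem mul_le {f f' g g' : Conv V} (h : f ≤ f') (h' : g ≤ g') : f * g ≤ f' * g' :=
  fun _ => ENNReal.tsum_le_tsum fun y => mul_le_mul' (h y) (h' _)

theorem mass_mul (f g : Conv V) : mass (f * g) = mass f * mass g := by
  simp only [mass, mul_apply]
  rw [ENNReal.tsum_comm, ← ENNReal.tsum_mul_right]
  refine tsum_congr fun y => ?_
  rw [ENNReal.tsum_mul_left]
  exact congrArg _ ((Equiv.subRight y).tsum_eq fun x => g x)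

theorem mass_one : mass (1 : Conv V) = 1 := mass_single 0

theorem mass_pow (f : Conv V) (n : ℕ) : mass (f ^ n) = mass f ^ n := by
  induction n with
  | zero => simp [mass_one]
  | succ n ih => rw [pow_succ, mass_mul, ih, pow_succ]

/-- Convolution with a function of mass `m` enlarges upper bounds by the factor `m` at most. -/
theorem mul_apply_le_mass_mul {f g : Conv V} {b : ℝ≥0∞} (hg : ∀ x, g x ≤ b) (x : V) :
    (f * g) x ≤ mass f * b := by
  rw [mul_apply, mass, ← ENNReal.tsum_mul_right]
  exact ENNReal.tsum_le_tsum fun y => mul_le_mul' le_rfl (hg _)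

theorem mul_sum {ι : Type*} (f : Conv V) (F : ι → Conv V) :
    f * sum F = sum fun i => f * F i := by
  ext x
  simp only [mul_apply, sum_apply, ← ENNReal.tsum_mul_left]
  rw [ENNReal.tsum_comm]

theorem sum_mul {ι : Type*} (f : Conv V) (F : ι → Conv V) :
    sum F * f = sum fun i => F i * f := by
  simp only [mul_comm _ f, mul_sum]

/-- The Green function `∑ n, f ^ n`. -/
def green (f : Conv V) : Conv V := sum fun n : ℕ => f ^ n

theorem green_eq (f : Conv V) : green f = 1 + f * green f := by
  rw [green, mul_sum]
  ext x
  rw [sum_apply, tsum_eq_zero_add' ENNReal.summable]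
  simp [sum_apply, pow_succ']

theorem one_le_green (f : Conv V) : 1 ≤ green f := by
  rw [green_eq]
  exact le_add_right' _ _

theorem mul_green_le (f : Conv V) : f * green f ≤ green f := by
  conv_rhs => rw [green_eq, add_comm]
  exact le_add_right' _ _

/-- The Green function is the least solution of `f * h + u ≤ h`. -/
theorem green_mul_le {f u h : Conv V} (H : u + f * h ≤ h) : green f * u ≤ h := by
  have key : ∀ n : ℕ, (∑ i ∈ Finset.range n, f ^ i) * u ≤ h := by
    intro n
    induction n with
    | zero => simpa using zero_le' h
    | succ n ih =>
      refine le_trans (le_of_eq ?_) ((add_le le_rfl (mul_le (le_refl f) ih)).trans H)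
      rw [Finset.sum_range_succ', ← mul_assoc, Finset.mul_sum]
      simp only [pow_succ', pow_zero]
      ring
  intro x
  rw [green, sum_mul, sum_apply]
  refine ENNReal.tsum_le_of_sum_range_le fun n => ?_
  refine le_trans (le_of_eq ?_) (key n x)
  rw [Finset.sum_mul]
  induction n with
  | zero => simp
  | succ n ih => simp [Finset.sum_range_succ, ih]

/-- Functions that are invariant under `x ↦ -x`. -/
def IsSymm (f : Conv V) : Prop := ∀ x, f (-x) = f x

theorem isSymm_one : IsSymm (1 : Conv V) := fun x => by
  by_cases hx : x = 0 <;> simp [one_def, single_apply, hx]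

theorem IsSymm.mul {f g : Conv V} (hf : IsSymm f) (hg : IsSymm g) : IsSymm (f * g) := fun x => by
  rw [mul_apply, mul_apply, ← (Equiv.neg V).tsum_eq]
  refine tsum_congr fun y => ?_
  rw [Equiv.neg_apply, hf, ← hg]
  congr 2
  abel

theorem IsSymm.pow {f : Conv V} (hf : IsSymm f) (n : ℕ) : IsSymm (f ^ n) := by
  induction n with
  | zero => exact isSymm_one
  | succ n ih => exact ih.mul hf

theorem IsSymm.green {f : Conv V} (hf : IsSymm f) : IsSymm (green f) := fun x =>
  tsum_congr fun n => hf.pow n x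

theorem IsSymm.mul_apply_zero {f : Conv V} (hf : IsSymm f) (g : Conv V) :
    (g * f) 0 = ∑' x, g x * f x := by
  rw [mul_apply]
  refine tsum_congr fun y => ?_
  rw [zero_sub, hf]

end Conv

end


/-! ### Joining finite trees by an edge -/

noncomputable section

open scoped ENNReal

/-- The finite trees contained in the graph `Γ`. -/
abbrev FinTree {V : Type*} (Γ : SimpleGraph V) : Type _ :=
  {T : Γ.Subgraph // T.verts.Finite ∧ T.coe.IsTree}

namespace SimpleGraph.Subgraph

variable {V : Type*} {Γ : SimpleGraph V}

theorem natCard_edgeSet_coe (T : Γ.Subgraph) : Nat.card T.coe.edgeSet = T.edgeSet.ncard := by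
  rw [Nat.card_coe_set_eq, ← image_coe_edgeSet_coe,
    Set.ncard_image_of_injective _ (Sym2.map.injective Subtype.val_injective)]

/-- Trees are recognized by counting their edges, so that joining trees requires no discussion of
cycles. -/
theorem isTree_coe_iff {T : Γ.Subgraph} (hT : T.verts.Finite) :
    T.coe.IsTree ↔ T.Connected ∧ T.edgeSet.ncard + 1 = T.verts.ncard := by
  have : Finite T.verts := hT
  rw [SimpleGraph.isTree_iff_connected_and_card, natCard_edgeSet_coe, Nat.card_coe_set_eq,
    Subgraph.connected_iff']

theorem edgeSet_finite {T : Γ.Subgraph} (hT : T.verts.Finite) : T.edgeSet.Finite := by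
  have : Finite T.verts := hT
  rw [← image_coe_edgeSet_coe]
  exact (Set.toFinite _).image _

/-- A connected subgraph that meets a set which is closed under its adjacency lies in that set. -/
theorem Connected.verts_subset {K : Γ.Subgraph} (hK : K.Connected) {A : Set V}
    (hA : ∀ u v, K.Adj u v → u ∈ A → v ∈ A) {u : V} (hu : u ∈ K.verts) (huA : u ∈ A) :
    K.verts ⊆ A := by
  intro v hv
  obtain ⟨w⟩ := hK.coe.preconnected ⟨u, hu⟩ ⟨v, hv⟩
  have key : ∀ (a b : K.verts) (_ : K.coe.Walk a b), a.1 ∈ A → b.1 ∈ A := by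
    intro a b w
    induction w with
    | nil => exact id
    | cons h _ ih => exact fun ha => ih (hA _ _ h ha)
  exact key _ _ w huA

/-- The union of two subgraphs and the edge `ab`. -/
def join {a b : V} (h : Γ.Adj a b) (T R : Γ.Subgraph) : Γ.Subgraph := T ⊔ R ⊔ Γ.subgraphOfAdj h

variable {a b : V} (h : Γ.Adj a b) {T R : Γ.Subgraph}

theorem verts_join (ha : a ∈ T.verts) (hb : b ∈ R.verts) :
    (join h T R).verts = T.verts ∪ R.verts := by
  ext v
  simp only [join, verts_sup, subgraphOfAdj_verts, Set.mem_union, Set.mem_insert_iff,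
    Set.mem_singleton_iff]
  constructor
  · rintro (h | rfl | rfl)
    exacts [h, .inl ha, .inr hb]
  · exact Or.inl

theorem join_adj {u v : V} :
    (join h T R).Adj u v ↔ T.Adj u v ∨ R.Adj u v ∨ (a = u ∧ b = v ∨ a = v ∧ b = u) := by
  simp [join, or_assoc]

/-- A connected subgraph of `join h T R` that does not contain both ends of the connecting edge
lies on one side of it. -/
theorem Connected.subset_of_le_join {K : Γ.Subgraph} (hK : K.Connected) (hle : K ≤ join h T R)
    (hd : Disjoint T.verts R.verts) (hab : ¬ (a ∈ K.verts ∧ b ∈ K.verts)) {u : V}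
    (hu : u ∈ K.verts) (huT : u ∈ T.verts) : K.verts ⊆ T.verts := by
  refine hK.verts_subset (fun x y hxy hx => ?_) hu huT
  rcases (join_adj h).1 (hle.2 hxy) with h1 | h1 | ⟨rfl, rfl⟩ | ⟨rfl, rfl⟩
  · exact h1.snd_mem
  · exact absurd h1.fst_mem (Set.disjoint_left.1 hd hx)
  · exact absurd ⟨hxy.fst_mem, hxy.snd_mem⟩ hab
  · exact absurd ⟨hxy.snd_mem, hxy.fst_mem⟩ hab

theorem join_symm : join h.symm R T = join h T R := by
  rw [join, join, sup_comm R, subgraphOfAdj_symm]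

theorem Connected.subset_of_le_join' {K : Γ.Subgraph} (hK : K.Connected) (hle : K ≤ join h T R)
    (hd : Disjoint T.verts R.verts) (hab : ¬ (a ∈ K.verts ∧ b ∈ K.verts)) {u : V}
    (hu : u ∈ K.verts) (huR : u ∈ R.verts) : K.verts ⊆ R.verts :=
  hK.subset_of_le_join h.symm (by rwa [join_symm]) hd.symm (fun h' => hab h'.symm) hu huR

theorem le_join_left : T ≤ join h T R := le_sup_left.trans le_sup_left

theorem le_join_right : R ≤ join h T R := le_sup_right.trans le_sup_left

theorem ncard_edgeSet_join (hT : T.verts.Finite) (hR : R.verts.Finite) (ha : a ∈ T.verts)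
    (hb : b ∈ R.verts) (hd : Disjoint T.verts R.verts) :
    (join h T R).edgeSet.ncard = T.edgeSet.ncard + R.edgeSet.ncard + 1 := by
  rw [join, edgeSet_sup, edgeSet_sup, edgeSet_subgraphOfAdj, Set.ncard_union_eq _
    ((edgeSet_finite hT).union (edgeSet_finite hR)) (Set.finite_singleton _), Set.ncard_union_eq _
    (edgeSet_finite hT) (edgeSet_finite hR), Set.ncard_singleton]
  · rw [Set.disjoint_left]
    intro e
    induction e with
    | _ x y =>
      exact fun h1 h2 => Set.disjoint_left.1 hd (Adj.fst_mem h1) (Adj.fst_mem h2)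
  · rw [Set.disjoint_singleton_right]
    rintro (h1 | h1)
    · exact Set.disjoint_left.1 hd (Adj.snd_mem h1) hb
    · exact Set.disjoint_left.1 hd ha (Adj.fst_mem h1)

theorem ncard_verts_join (hT : T.verts.Finite) (hR : R.verts.Finite) (ha : a ∈ T.verts)
    (hb : b ∈ R.verts) (hd : Disjoint T.verts R.verts) :
    (join h T R).verts.ncard = T.verts.ncard + R.verts.ncard := by
  rw [verts_join h ha hb, Set.ncard_union_eq hd hT hR]

theorem connected_join (hT : T.Connected) (hR : R.Connected) (ha : a ∈ T.verts)
    (hb : b ∈ R.verts) : (join h T R).Connected := by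
  have h1 : (T ⊔ Γ.subgraphOfAdj h).Connected :=
    connected_sup hT.preconnected (subgraphOfAdj_connected h).preconnected
      ⟨a, ha, by simp⟩
  have h2 := connected_sup h1.preconnected hR.preconnected ⟨b, by simp, hb⟩
  rwa [join, sup_right_comm]

theorem isTree_join (hT : T.verts.Finite ∧ T.coe.IsTree) (hR : R.verts.Finite ∧ R.coe.IsTree)
    (ha : a ∈ T.verts) (hb : b ∈ R.verts) (hd : Disjoint T.verts R.verts) :
    (join h T R).verts.Finite ∧ (join h T R).coe.IsTree := by
  have hf : (join h T R).verts.Finite := by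
    rw [verts_join h ha hb]
    exact hT.1.union hR.1
  obtain ⟨hTc, hTn⟩ := (isTree_coe_iff hT.1).1 hT.2
  obtain ⟨hRc, hRn⟩ := (isTree_coe_iff hR.1).1 hR.2
  refine ⟨hf, (isTree_coe_iff hf).2 ⟨connected_join h hTc hRc ha hb, ?_⟩⟩
  rw [ncard_edgeSet_join h hT.1 hR.1 ha hb hd, ncard_verts_join h hT.1 hR.1 ha hb hd]
  omega

/-- The two sides of the connecting edge are determined by their union. -/
theorem join_injective {T' R' : Γ.Subgraph} (hT : T.Connected) (hR : R.Connected)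
    (hT' : T'.Connected) (hR' : R'.Connected) (ha : a ∈ T.verts) (hb : b ∈ R.verts)
    (hd : Disjoint T.verts R.verts) (ha' : a ∈ T'.verts) (hb' : b ∈ R'.verts)
    (hd' : Disjoint T'.verts R'.verts) (he : join h T R = join h T' R') : T = T' ∧ R = R' := by
  have key : ∀ {a b : V} (h : Γ.Adj a b) {T R T' R' : Γ.Subgraph}, T.Connected → a ∈ T.verts →
      b ∈ R.verts → Disjoint T.verts R.verts → a ∈ T'.verts → b ∈ R'.verts →
      Disjoint T'.verts R'.verts → join h T R = join h T' R' → T ≤ T' := by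
    intro a b h T R T' R' hT ha hb hd ha' hb' hd' he
    have hsub : T.verts ⊆ T'.verts :=
      hT.subset_of_le_join h (he ▸ le_join_left h) hd'
        (fun h' => Set.disjoint_left.1 hd h'.2 hb) ha ha'
    refine ⟨hsub, fun u v huv => ?_⟩
    rcases (join_adj h).1 (he ▸ (le_join_left h).2 huv) with h1 | h1 | ⟨rfl, rfl⟩ | ⟨rfl, rfl⟩
    · exact h1
    · exact absurd h1.fst_mem (Set.disjoint_left.1 hd' (hsub huv.fst_mem))
    · exact absurd hb (Set.disjoint_left.1 hd huv.snd_mem)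
    · exact absurd hb (Set.disjoint_left.1 hd huv.fst_mem)
  have he' : join h.symm R T = join h.symm R' T' := by rw [join_symm h, join_symm h, he]
  exact ⟨le_antisymm (key h hT ha hb hd ha' hb' hd' he) (key h hT' ha' hb' hd' ha hb hd he.symm),
    le_antisymm (key h.symm hR hb ha hd.symm hb' ha' hd'.symm he')
      (key h.symm hR' hb' ha' hd'.symm hb ha hd.symm he'.symm)⟩

/-- Every edge of a tree splits it into two trees. -/
theorem exists_eq_join {T : Γ.Subgraph} (hT : T.verts.Finite ∧ T.coe.IsTree) (hab : T.Adj a b) :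
    ∃ T₀ R : Γ.Subgraph, (T₀.verts.Finite ∧ T₀.coe.IsTree) ∧ (R.verts.Finite ∧ R.coe.IsTree) ∧
      a ∈ T₀.verts ∧ b ∈ R.verts ∧ Disjoint T₀.verts R.verts ∧ T = join h T₀ R := by
  set a' : T.verts := ⟨a, hab.fst_mem⟩ with ha'
  set b' : T.verts := ⟨b, hab.snd_mem⟩ with hb'
  set H : SimpleGraph T.verts := T.coe.deleteEdges {s(a', b')} with hH
  have hHadj : ∀ u v, H.Adj u v ↔ T.Adj u.1 v.1 ∧ ¬ s(u, v) = s(a', b') := by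
    intro u v
    simp [hH]
  have hbr : ¬ H.Reachable a' b' :=
    isBridge_iff.1 (isAcyclic_iff_forall_adj_isBridge.1 hT.2.isAcyclic (v := a') (w := b') hab)
  -- the component of `c` in the tree without the edge `ab`
  set side : T.verts → Set V := fun c => {v | ∃ hv : v ∈ T.verts, H.Reachable c ⟨v, hv⟩} with hside
  have hsub : ∀ c, side c ⊆ T.verts := fun c v hv => hv.1
  have hself : ∀ c : T.verts, c.1 ∈ side c := fun c => ⟨c.2, Reachable.refl _⟩
  have hle : ∀ c, T.induce (side c) ≤ T := by
    intro c
    refine ⟨hsub c, fun u v huv => ?_⟩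
    exact huv.2.2
  have htree : ∀ c, (T.induce (side c)).verts.Finite ∧ (T.induce (side c)).coe.IsTree := by
    intro c
    refine ⟨hT.1.subset (hsub c), ?_, ?_⟩
    · have key : ∀ v, H.Reachable c v → ∃ hv : v.1 ∈ side c,
          (T.induce (side c)).coe.Reachable ⟨c.1, hself c⟩ ⟨v.1, hv⟩ := by
        intro v hv
        rw [reachable_iff_reflTransGen] at hv
        induction hv with
        | refl => exact ⟨hself c, Reachable.refl _⟩
        | @tail x y hx hxy ih =>
          obtain ⟨hxs, hxr⟩ := ih
          have hy : y.1 ∈ side c :=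
            ⟨y.2, ((reachable_iff_reflTransGen _ _).2 hx).trans hxy.reachable⟩
          refine ⟨hy, hxr.trans (Adj.reachable ?_)⟩
          exact ⟨hxs, hy, ((hHadj x y).1 hxy).1⟩
      rw [connected_iff_exists_forall_reachable]
      exact ⟨⟨c.1, hself c⟩, fun ⟨v, hv⟩ => (key ⟨v, hv.1⟩ hv.2).2⟩
    · exact hT.2.isAcyclic.comap (Subgraph.inclusion (hle c)) (Subgraph.inclusion.injective _)
  have hcover : ∀ v : T.verts, v.1 ∈ side a' ∨ v.1 ∈ side b' := by
    intro v
    have hv := hT.2.connected.preconnected a' v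
    rw [reachable_iff_reflTransGen] at hv
    induction hv with
    | refl => exact .inl (hself a')
    | @tail x y hx hxy ih =>
      by_cases he : s(x, y) = s(a', b')
      · rcases Sym2.eq_iff.1 he with ⟨-, rfl⟩ | ⟨-, rfl⟩
        exacts [.inr (hself b'), .inl (hself a')]
      · have hH' : H.Adj x y := (hHadj x y).2 ⟨hxy, he⟩
        exact ih.imp (fun h1 => ⟨y.2, h1.2.trans hH'.reachable⟩)
          (fun h1 => ⟨y.2, h1.2.trans hH'.reachable⟩)
  refine ⟨T.induce (side a'), T.induce (side b'), htree a', htree b', hself a', hself b', ?_, ?_⟩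
  · exact Set.disjoint_left.2 fun v hv hv' => hbr (hv.2.trans hv'.2.symm)
  · have hva : a ∈ (T.induce (side a')).verts := hself a'
    have hvb : b ∈ (T.induce (side b')).verts := hself b'
    refine Subgraph.ext ?_ ?_
    · rw [verts_join h hva hvb]
      ext v
      exact ⟨fun hv => hcover ⟨v, hv⟩, fun hv => hv.elim (fun h => hsub _ h) (fun h => hsub _ h)⟩
    · ext u v
      rw [join_adj]
      constructor
      · intro huv
        by_cases he : s((⟨u, huv.fst_mem⟩ : T.verts), ⟨v, huv.snd_mem⟩) = s(a', b')
        · rcases Sym2.eq_iff.1 he with ⟨h1, h2⟩ | ⟨h1, h2⟩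
          · exact .inr (.inr (.inl ⟨congrArg Subtype.val h1.symm, congrArg Subtype.val h2.symm⟩))
          · exact .inr (.inr (.inr ⟨congrArg Subtype.val h2.symm, congrArg Subtype.val h1.symm⟩))
        · have hH' : H.Adj ⟨u, huv.fst_mem⟩ ⟨v, huv.snd_mem⟩ := (hHadj _ _).2 ⟨huv, he⟩
          have hstep : ∀ c, u ∈ side c → (T.induce (side c)).Adj u v := fun c hc =>
            ⟨hc, ⟨huv.snd_mem, hc.2.trans hH'.reachable⟩, huv⟩
          exact (hcover ⟨u, huv.fst_mem⟩).elim (fun h1 => .inl (hstep _ h1))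
            (fun h1 => .inr (.inl (hstep _ h1)))
      · rintro (h1 | h1 | ⟨rfl, rfl⟩ | ⟨rfl, rfl⟩)
        exacts [h1.2.2, h1.2.2, hab, hab.symm]

end SimpleGraph.Subgraph

end


/-! ### Sums over trees that contain an edge or a point -/

noncomputable section

open scoped ENNReal

open Classical in
/-- The indicator of a proposition, as an extended nonnegative real number. -/
def ind (P : Prop) : ℝ≥0∞ := if P then 1 else 0

section Indicator

variable {P Q : Prop}

theorem ind_of_true (h : P) : ind P = 1 := if_pos h

theorem ind_of_false (h : ¬ P) : ind P = 0 := if_neg h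

theorem ind_le_one : ind P ≤ 1 := by
  unfold ind
  split_ifs <;> simp

theorem ind_mono (h : P → Q) : ind P ≤ ind Q := by
  by_cases hP : P
  · rw [ind_of_true hP, ind_of_true (h hP)]
  · rw [ind_of_false hP]
    exact zero_le

theorem ind_congr (h : P ↔ Q) : ind P = ind Q := by rw [propext h]

theorem ind_and : ind (P ∧ Q) = ind P * ind Q := by
  by_cases hP : P <;> by_cases hQ : Q <;> simp [ind, hP, hQ]

theorem ind_or_le : ind (P ∨ Q) ≤ ind P + ind Q := by
  by_cases hP : P <;> by_cases hQ : Q <;> simp [ind, hP, hQ]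

theorem ind_add_ind_not : ind P + ind (¬ P) = 1 := by
  by_cases hP : P <;> simp [ind, hP]

end Indicator

/-- Change of variables along a partially defined bijection. -/
theorem tsum_dite_eq_tsum_ind {α β : Type*} {p : α → Prop} [DecidablePred p]
    {q : β → Prop} (j : ∀ a, p a → β)
    (hj : ∀ a a' h h', j a h = j a' h' → a = a') (hq : ∀ b, q b ↔ ∃ a h, j a h = b)
    (F : β → ℝ≥0∞) :
    ∑' a, (if h : p a then F (j a h) else 0) = ∑' b, ind (q b) * F b := by
  have hinj : Function.Injective (fun a : {a // p a} => j a.1 a.2) :=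
    fun a a' h => Subtype.ext (hj _ _ _ _ h)
  calc ∑' a, (if h : p a then F (j a h) else 0)
      = ∑' a : {a // p a}, (if h : p a.1 then F (j a.1 h) else 0) := by
        refine (Subtype.val_injective.tsum_eq fun a ha => ?_).symm
        by_contra hcon
        refine ha (dif_neg fun h => hcon ⟨⟨a, h⟩, rfl⟩)
    _ = ∑' a : {a // p a}, ind (q (j a.1 a.2)) * F (j a.1 a.2) := by
        refine tsum_congr fun a => ?_
        rw [dif_pos a.2, ind_of_true ((hq _).2 ⟨a.1, a.2, rfl⟩), one_mul]
    _ = _ := by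
        refine hinj.tsum_eq (f := fun b => ind (q b) * F b) fun b hb => ?_
        by_contra hcon
        refine hb ?_
        change ind (q b) * F b = 0
        rw [ind_of_false, zero_mul]
        intro h
        obtain ⟨a, ha, rfl⟩ := (hq b).1 h
        exact hcon ⟨⟨a, ha⟩, rfl⟩

namespace FinTree

open SimpleGraph

variable {V : Type*} {Γ : SimpleGraph V}

theorem connected (T : FinTree Γ) : T.1.Connected := ⟨T.2.2.connected⟩

/-- The conditions under which a tree `T` containing `a` and a tree `R` containing `b` can be joined
by the edge `ab`. -/
def Joinable (a b : V) (T R : FinTree Γ) : Prop :=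
  a ∈ T.1.verts ∧ b ∈ R.1.verts ∧ Disjoint T.1.verts R.1.verts

/-- The tree obtained by joining two disjoint trees by an edge. -/
def join {a b : V} (h : Γ.Adj a b) (T R : FinTree Γ) (H : Joinable a b T R) : FinTree Γ :=
  ⟨Subgraph.join h T.1 R.1, Subgraph.isTree_join h T.2 R.2 H.1 H.2.1 H.2.2⟩

open Classical in
/-- The trees that contain a given edge arise exactly once by joining two trees. -/
theorem tsum_adj {a b : V} (h : Γ.Adj a b) (F : FinTree Γ → ℝ≥0∞) :
    ∑' T, ind (T.1.Adj a b) * F T =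
      ∑' T, ∑' R, if H : Joinable a b T R then F (join h T R H) else 0 := by
  rw [← ENNReal.tsum_prod (f := fun T R => if H : Joinable a b T R then F (join h T R H) else 0)]
  refine (tsum_dite_eq_tsum_ind (p := fun X : FinTree Γ × FinTree Γ => Joinable a b X.1 X.2)
    (fun X H => join h X.1 X.2 H) ?_ ?_ F).symm
  · rintro ⟨T, R⟩ ⟨T', R'⟩ H H' he
    have := Subgraph.join_injective h T.connected R.connected T'.connected R'.connected
      H.1 H.2.1 H.2.2 H'.1 H'.2.1 H'.2.2 (congrArg Subtype.val he)
    exact Prod.ext (Subtype.ext this.1) (Subtype.ext this.2)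
  · intro T
    constructor
    · intro hab
      obtain ⟨T₀, R, hT₀, hR, ha, hb, hd, he⟩ := Subgraph.exists_eq_join h T.2 hab
      exact ⟨(⟨T₀, hT₀⟩, ⟨R, hR⟩), ⟨ha, hb, hd⟩, Subtype.ext he.symm⟩
    · rintro ⟨X, H, rfl⟩
      exact (Subgraph.join_adj h).2 (.inr (.inr (.inl ⟨rfl, rfl⟩)))

open Classical in
/-- A tree that contains `a` and `x ≠ a` splits uniquely at the first edge of its path from `a`
to `x`. -/
theorem tsum_mem {a x : V} (hx : x ≠ a) (F : FinTree Γ → ℝ≥0∞) :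
    ∑' T : FinTree Γ, ind (a ∈ T.1.verts ∧ x ∈ T.1.verts) * F T =
      ∑' y, ∑' T, ∑' R, if H : Γ.Adj a y ∧ Joinable a y T R ∧ x ∈ R.1.verts
        then F (join H.1 T R H.2.1) else 0 := by
  have h3 : ∀ K : V → FinTree Γ → FinTree Γ → ℝ≥0∞, ∑' y, ∑' T, ∑' R, K y T R =
      ∑' X : V × FinTree Γ × FinTree Γ, K X.1 X.2.1 X.2.2 := by
    intro K
    rw [ENNReal.tsum_prod (f := fun y (X : FinTree Γ × FinTree Γ) => K y X.1 X.2)]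
    exact tsum_congr fun y => (ENNReal.tsum_prod (f := fun T R => K y T R)).symm
  rw [h3]
  refine (tsum_dite_eq_tsum_ind (p := fun X : V × FinTree Γ × FinTree Γ =>
    Γ.Adj a X.1 ∧ Joinable a X.1 X.2.1 X.2.2 ∧ x ∈ X.2.2.1.verts)
    (fun X H => join H.1 X.2.1 X.2.2 H.2.1) ?_ ?_ F).symm
  · rintro ⟨y, T, R⟩ ⟨y', T', R'⟩ ⟨h, H, hxR⟩ ⟨h', H', hxR'⟩ he
    simp only at h H hxR h' H' hxR' he
    have he' : Subgraph.join h T.1 R.1 = Subgraph.join h' T'.1 R'.1 := congrArg Subtype.val he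
    -- `R'` is a connected part of the tree that contains `x` but not `a`, so it lies in `R`; hence
    -- the neighbour `y'` of `a` in `R'` can only be `y`
    have hsub : R'.1.verts ⊆ R.1.verts :=
      R'.connected.subset_of_le_join' h (he' ▸ Subgraph.le_join_right h') H.2.2
        (fun hab => Set.disjoint_left.1 H'.2.2 H'.1 hab.1) hxR' hxR
    have hadj : (Subgraph.join h T.1 R.1).Adj a y' :=
      he' ▸ (Subgraph.join_adj h').2 (.inr (.inr (.inl ⟨rfl, rfl⟩)))
    have hy : y = y' := by
      rcases (Subgraph.join_adj h).1 hadj with h1 | h1 | h1 | h1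
      · exact absurd (hsub H'.2.1) (Set.disjoint_left.1 H.2.2 h1.snd_mem)
      · exact absurd h1.fst_mem (Set.disjoint_left.1 H.2.2 H.1)
      · exact h1.2
      · exact absurd h1.2.symm h.ne
    subst hy
    have := Subgraph.join_injective h T.connected R.connected T'.connected R'.connected
      H.1 H.2.1 H.2.2 H'.1 H'.2.1 H'.2.2 he'
    exact Prod.ext rfl (Prod.ext (Subtype.ext this.1) (Subtype.ext this.2))
  · intro T
    constructor
    · rintro ⟨ha, hxT⟩
      obtain ⟨p, hp⟩ := (T.2.2.connected.preconnected ⟨a, ha⟩ ⟨x, hxT⟩).exists_isPath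
      cases p with
      | nil => exact absurd rfl hx
      | @cons _ y _ hay q =>
        have haq : (⟨a, ha⟩ : T.1.verts) ∉ q.support := (Walk.cons_isPath_iff _ _).1 hp |>.2
        have hay' : T.1.Adj a y.1 := hay
        obtain ⟨T₀, R, hT₀, hR, ha', hb, hd, he⟩ := Subgraph.exists_eq_join hay'.adj_sub T.2 hay'
        -- the path avoids `a` after its first step, so it never crosses the edge `ay` again
        have key : ∀ (u v : T.1.verts) (q : T.1.coe.Walk u v), (⟨a, ha⟩ : T.1.verts) ∉ q.support →
            u.1 ∈ R.verts → v.1 ∈ R.verts := by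
          intro u v q
          induction q with
          | nil => exact fun _ h => h
          | @cons u u' v huu' q ih =>
            intro hq hu
            rw [Walk.support_cons, List.mem_cons, not_or] at hq
            refine ih hq.2 ?_
            have h1 : (Subgraph.join hay'.adj_sub T₀ R).Adj u.1 u'.1 := he ▸ huu'
            rcases (Subgraph.join_adj hay'.adj_sub).1 h1 with h1 | h1 | h1 | h1
            · exact absurd hu (Set.disjoint_left.1 hd h1.fst_mem)
            · exact h1.snd_mem
            · exact absurd (Subtype.ext h1.1) hq.1
            · exact absurd (Subtype.ext h1.1 : (⟨a, ha⟩ : T.1.verts) = u')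
                fun h => hq.2 (h ▸ q.start_mem_support)
        exact ⟨(y.1, ⟨T₀, hT₀⟩, ⟨R, hR⟩), ⟨hay'.adj_sub, ⟨ha', hb, hd⟩, key _ _ q haq hb⟩,
          Subtype.ext he.symm⟩
    · rintro ⟨⟨y, T₀, R⟩, ⟨h, H, hxR⟩, rfl⟩
      exact ⟨(Subgraph.le_join_left h).1 H.1, (Subgraph.le_join_right h).1 hxR⟩

theorem ncard_edgeSet_join {a b : V} (h : Γ.Adj a b) {T R : FinTree Γ} (H : Joinable a b T R) :
    (join h T R H).1.edgeSet.ncard = T.1.edgeSet.ncard + R.1.edgeSet.ncard + 1 :=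
  Subgraph.ncard_edgeSet_join h T.2.1 R.2.1 H.1 H.2.1 H.2.2

theorem ncard_verts_join {a b : V} (h : Γ.Adj a b) {T R : FinTree Γ} (H : Joinable a b T R) :
    (join h T R H).1.verts.ncard = T.1.verts.ncard + R.1.verts.ncard :=
  Subgraph.ncard_verts_join h T.2.1 R.2.1 H.1 H.2.1 H.2.2

theorem verts_join {a b : V} (h : Γ.Adj a b) {T R : FinTree Γ} (H : Joinable a b T R) :
    (join h T R H).1.verts = T.1.verts ∪ R.1.verts :=
  Subgraph.verts_join h H.1 H.2.1

theorem ncard_verts (T : FinTree Γ) : T.1.verts.ncard = T.1.edgeSet.ncard + 1 :=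
  ((Subgraph.isTree_coe_iff T.2.1).1 T.2.2).2.symm

theorem adj_join_iff {a b : V} (h : Γ.Adj a b) {T R : FinTree Γ} (H : Joinable a b T R) {z : V} :
    (join h T R H).1.Adj a z ↔ T.1.Adj a z ∨ z = b := by
  refine (Subgraph.join_adj h).trans ⟨?_, ?_⟩
  · rintro (h1 | h1 | h1 | h1)
    · exact .inl h1
    · exact absurd h1.fst_mem (Set.disjoint_left.1 H.2.2 H.1)
    · exact .inr h1.2.symm
    · exact absurd h1.2.symm h.ne
  · rintro (h1 | rfl)
    exacts [.inl h1, .inr (.inr (.inl ⟨rfl, rfl⟩))]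

/-- A tree in which `a` has no neighbour is the single vertex `a`. -/
theorem verts_eq_singleton (T : FinTree Γ) {a : V} (ha : a ∈ T.1.verts)
    (h : ∀ z, ¬ T.1.Adj a z) : T.1 = Γ.singletonSubgraph a := by
  have hv : T.1.verts = {a} := by
    refine Set.Subset.antisymm ?_ (Set.singleton_subset_iff.2 ha)
    refine T.connected.verts_subset (fun u v huv hu => ?_) ha rfl
    rw [Set.mem_singleton_iff.1 hu] at huv
    exact absurd huv (h v)
  refine Subgraph.ext hv ?_
  ext u v
  refine ⟨fun huv => ?_, fun huv => huv.elim⟩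
  have hu : u ∈ T.1.verts := huv.fst_mem
  rw [hv] at hu
  rw [Set.mem_singleton_iff.1 hu] at huv
  exact absurd huv (h v)

/-- The image of a tree under an automorphism of the graph. -/
def map (f : Γ ≃g Γ) (T : FinTree Γ) : FinTree Γ :=
  ⟨T.1.map f.toHom, T.2.1.image _, by
    refine (Iso.isTree_iff (G := T.1.coe) ⟨Equiv.Set.image f T.1.verts f.injective, ?_⟩).1 T.2.2
    intro u v
    constructor
    · rintro ⟨u', v', h, hu, hv⟩
      have hu' : u' = u.1 := f.injective hu
      have hv' : v' = v.1 := f.injective hv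
      subst hu' hv'
      exact h
    · exact fun h => ⟨u.1, v.1, h, rfl, rfl⟩⟩

theorem verts_map (f : Γ ≃g Γ) (T : FinTree Γ) : (T.map f).1.verts = f '' T.1.verts := rfl

theorem map_map_symm (f : Γ ≃g Γ) (T : FinTree Γ) : (T.map f).map f.symm = T := by
  refine Subtype.ext ?_
  change (T.1.map f.toHom).map f.symm.toHom = T.1
  rw [← Subgraph.map_comp]
  have : f.symm.toHom.comp f.toHom = Hom.id := by
    ext x
    exact f.symm_apply_apply x
  rw [this, Subgraph.map_id]

/-- The permutation of the trees induced by an automorphism of the graph. -/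
def mapEquiv (f : Γ ≃g Γ) : FinTree Γ ≃ FinTree Γ where
  toFun := map f
  invFun := map f.symm
  left_inv := map_map_symm f
  right_inv := map_map_symm f.symm

theorem ncard_edgeSet_map (f : Γ ≃g Γ) (T : FinTree Γ) :
    (T.map f).1.edgeSet.ncard = T.1.edgeSet.ncard := by
  have h1 := (T.map f).ncard_verts
  rw [verts_map, Set.ncard_image_of_injective _ f.injective, T.ncard_verts] at h1
  omega

end FinTree

end


/-! ### Sums over pairs of trees -/

noncomputable section

open scoped ENNReal

theorem ENNReal.tsum_mul_tsum {α β : Type*} (f : α → ℝ≥0∞) (g : β → ℝ≥0∞) :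
    (∑' a, f a) * ∑' b, g b = ∑' a, ∑' b, f a * g b := by
  rw [← ENNReal.tsum_mul_right]
  exact tsum_congr fun a => ENNReal.tsum_mul_left.symm

namespace FinTree

open SimpleGraph

section Sums

variable {V : Type*} {Γ : SimpleGraph V}

/-- The sum of the weights `ω T` over the trees `T` that contain the set `S`. -/
def treeSum (ω : FinTree Γ → ℝ≥0∞) (S : Set V) : ℝ≥0∞ :=
  ∑' T : FinTree Γ, ind (S ⊆ T.1.verts) * ω T

/-- The sum of `ω T * ω' R` over the pairs of disjoint trees with `S ⊆ T` and `S' ⊆ R`. -/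
def apartSum (ω : FinTree Γ → ℝ≥0∞) (S : Set V) (ω' : FinTree Γ → ℝ≥0∞) (S' : Set V) : ℝ≥0∞ :=
  ∑' T : FinTree Γ, ∑' R : FinTree Γ, ind (Disjoint T.1.verts R.1.verts) *
    ((ind (S ⊆ T.1.verts) * ω T) * (ind (S' ⊆ R.1.verts) * ω' R))

/-- The sum of `ω T * ω' R` over the pairs of intersecting trees with `S ⊆ T` and `S' ⊆ R`. -/
def meetSum (ω : FinTree Γ → ℝ≥0∞) (S : Set V) (ω' : FinTree Γ → ℝ≥0∞) (S' : Set V) : ℝ≥0∞ :=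
  ∑' T : FinTree Γ, ∑' R : FinTree Γ, ind (¬ Disjoint T.1.verts R.1.verts) *
    ((ind (S ⊆ T.1.verts) * ω T) * (ind (S' ⊆ R.1.verts) * ω' R))

variable {ω ω' : FinTree Γ → ℝ≥0∞} {S S' : Set V}

theorem treeSum_mono (h : ∀ T, ω T ≤ ω' T) : treeSum ω S ≤ treeSum ω' S :=
  ENNReal.tsum_le_tsum fun _ => mul_le_mul' le_rfl (h _)

theorem treeSum_anti (h : S ⊆ S') : treeSum ω S' ≤ treeSum ω S :=
  ENNReal.tsum_le_tsum fun _ => mul_le_mul' (ind_mono h.trans) le_rfl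

theorem apartSum_add_meetSum :
    apartSum ω S ω' S' + meetSum ω S ω' S' = treeSum ω S * treeSum ω' S' := by
  simp only [apartSum, meetSum, ← ENNReal.tsum_add, ← add_mul, ind_add_ind_not, one_mul]
  simp only [treeSum, ENNReal.tsum_mul_tsum]

theorem apartSum_le : apartSum ω S ω' S' ≤ treeSum ω S * treeSum ω' S' :=
  apartSum_add_meetSum ▸ le_self_add

/-- A product of two tree sums, written as a sum over pairs of trees in which the constraints `A`
and `B` are separated from `S` and `S'`. -/
theorem sum_pair_eq (S S' : Set V) (A B : Set V) :
    treeSum ω (A ∪ S) * treeSum ω' (B ∪ S') = ∑' T : FinTree Γ, ∑' R : FinTree Γ,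
      (ind (A ⊆ T.1.verts) * ind (B ⊆ R.1.verts)) *
        ((ind (S ⊆ T.1.verts) * ω T) * (ind (S' ⊆ R.1.verts) * ω' R)) := by
  simp only [treeSum, ENNReal.tsum_mul_tsum, Set.union_subset_iff, ind_and]
  refine tsum_congr fun T => tsum_congr fun R => ?_
  ring

/-- Two trees that meet share at least one point. -/
theorem meetSum_le :
    meetSum ω S ω' S' ≤ ∑' v, treeSum ω (insert v S) * treeSum ω' (insert v S') := by
  simp only [Set.insert_eq, sum_pair_eq]
  rw [ENNReal.tsum_comm]
  refine ENNReal.tsum_le_tsum fun T => ?_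
  rw [ENNReal.tsum_comm]
  refine ENNReal.tsum_le_tsum fun R => ?_
  rw [ENNReal.tsum_mul_right]
  refine mul_le_mul' ?_ le_rfl
  by_cases h : Disjoint T.1.verts R.1.verts
  · rw [ind_of_false (not_not.2 h)]
    exact zero_le
  · obtain ⟨v, hv, hv'⟩ := Set.not_disjoint_iff.1 h
    refine le_trans ?_ (ENNReal.le_tsum v)
    rw [ind_of_true (Set.singleton_subset_iff.2 hv), ind_of_true (Set.singleton_subset_iff.2 hv'),
      one_mul]
    exact ind_le_one

/-- Counting two intersecting trees once for every common point overcounts them only if they share a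
pair of distinct points. -/
theorem le_meetSum_add :
    ∑' v, treeSum ω (insert v S) * treeSum ω' (insert v S') ≤ meetSum ω S ω' S' +
      ∑' v, ∑' v', ind (v ≠ v') *
        (treeSum ω ({v, v'} ∪ S) * treeSum ω' ({v, v'} ∪ S')) := by
  simp only [Set.insert_eq _ S, Set.insert_eq _ S', sum_pair_eq]
  rw [ENNReal.tsum_comm]
  have h2 : ∀ F : V → V → FinTree Γ → FinTree Γ → ℝ≥0∞,
      ∑' v, ∑' v', ind (v ≠ v') * ∑' T, ∑' R, F v v' T R =
        ∑' T, ∑' R, ∑' v, ∑' v', ind (v ≠ v') * F v v' T R := by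
    intro F
    simp only [← ENNReal.tsum_mul_left]
    calc _ = ∑' v, ∑' T, ∑' v', ∑' R, ind (v ≠ v') * F v v' T R :=
          tsum_congr fun v => ENNReal.tsum_comm
      _ = ∑' T, ∑' v, ∑' v', ∑' R, ind (v ≠ v') * F v v' T R := ENNReal.tsum_comm
      _ = ∑' T, ∑' v, ∑' R, ∑' v', ind (v ≠ v') * F v v' T R :=
          tsum_congr fun T => tsum_congr fun v => ENNReal.tsum_comm
      _ = _ := tsum_congr fun T => ENNReal.tsum_comm
  rw [h2, meetSum, ← ENNReal.tsum_add]
  refine ENNReal.tsum_le_tsum fun T => ?_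
  rw [ENNReal.tsum_comm, ← ENNReal.tsum_add]
  refine ENNReal.tsum_le_tsum fun R => ?_
  simp only [← mul_assoc, ENNReal.tsum_mul_right, ← add_mul]
  gcongr
  simp only [Set.singleton_subset_iff, ← ind_and]
  by_cases h : Disjoint T.1.verts R.1.verts
  · refine le_trans (le_of_eq ?_) zero_le
    rw [ENNReal.tsum_eq_zero]
    exact fun v => ind_of_false fun hv => Set.disjoint_left.1 h hv.1 hv.2
  · obtain ⟨u, hu, hu'⟩ := Set.not_disjoint_iff.1 h
    rw [ind_of_true h]
    -- the number of common points is at most one plus the number of those different from `u`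
    have key : ∑' v, ind (v ∈ T.1.verts ∧ v ∈ R.1.verts) ≤
        ∑' v, (Conv.single u v + ind (u ≠ v ∧ ({u, v} : Set V) ⊆ T.1.verts ∧
          ({u, v} : Set V) ⊆ R.1.verts)) := by
      refine ENNReal.tsum_le_tsum fun v => ?_
      by_cases hv : v = u
      · rw [Conv.single_apply, if_pos hv]
        exact ind_le_one.trans le_self_add
      · refine le_trans (ind_mono fun h => ?_) le_add_self
        exact ⟨Ne.symm hv, Set.insert_subset hu (Set.singleton_subset_iff.2 h.1),
          Set.insert_subset hu' (Set.singleton_subset_iff.2 h.2)⟩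
    refine key.trans ?_
    rw [ENNReal.tsum_add]
    refine add_le_add (Conv.mass_single u).le ?_
    refine le_trans (le_of_eq ?_) (ENNReal.le_tsum u)
    exact tsum_congr fun v => by simp only [ind_and]; ring

theorem treeSum_map_image (hω : ∀ (f : Γ ≃g Γ) T, ω (T.map f) = ω T) (f : Γ ≃g Γ) (S : Set V) :
    treeSum ω (f '' S) = treeSum ω S := by
  rw [treeSum, ← (mapEquiv f).tsum_eq]
  refine tsum_congr fun T => ?_
  change ind (f '' S ⊆ f '' T.1.verts) * ω (T.map f) = _
  rw [hω, Set.image_subset_image_iff f.injective]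

/-- The weight `c ^ |E_T|` of the trees with at most `m` vertices; all other trees have weight `0`.
The bounds on tree sums are proved by induction on `m`, and passed on to `m = ⊤`, where every tree
counts. -/
def wt (c : ℝ≥0∞) (m : ℕ∞) (T : FinTree Γ) : ℝ≥0∞ :=
  ind ((T.1.verts.ncard : ℕ∞) ≤ m) * c ^ T.1.edgeSet.ncard

theorem wt_top (c : ℝ≥0∞) (T : FinTree Γ) : wt c ⊤ T = c ^ T.1.edgeSet.ncard := by
  rw [wt, ind_of_true le_top, one_mul]

theorem wt_mono (c : ℝ≥0∞) {m m' : ℕ∞} (h : m ≤ m') (T : FinTree Γ) : wt c m T ≤ wt c m' T :=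
  mul_le_mul' (ind_mono fun h' => h'.trans h) le_rfl

theorem wt_map (c : ℝ≥0∞) (m : ℕ∞) (f : Γ ≃g Γ) (T : FinTree Γ) :
    wt c m (T.map f) = wt c m T := by
  rw [wt, wt, ncard_verts, ncard_verts, ncard_edgeSet_map]

theorem wt_join_top (c : ℝ≥0∞) {a b : V} (h : Γ.Adj a b) {T R : FinTree Γ}
    (H : Joinable a b T R) : wt c ⊤ (join h T R H) = c * (wt c ⊤ T * wt c ⊤ R) := by
  simp only [wt_top, ncard_edgeSet_join]
  ring

/-- Each of two trees that are joined has fewer vertices than their union. -/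
theorem wt_join_le (c : ℝ≥0∞) (m : ℕ) {a b : V} (h : Γ.Adj a b) {T R : FinTree Γ}
    (H : Joinable a b T R) :
    wt c (m + 1 : ℕ) (join h T R H) ≤ c * (wt c m T * wt c m R) := by
  have hle : ind (((join h T R H).1.verts.ncard : ℕ∞) ≤ (m + 1 : ℕ)) ≤
      ind ((T.1.verts.ncard : ℕ∞) ≤ m) * ind ((R.1.verts.ncard : ℕ∞) ≤ m) := by
    rw [← ind_and]
    refine ind_mono fun h' => ?_
    rw [ncard_verts_join, Nat.cast_le] at h'
    have h1 := T.ncard_verts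
    have h2 := R.ncard_verts
    rw [Nat.cast_le, Nat.cast_le]
    omega
  refine (mul_le_mul' hle le_rfl).trans (le_of_eq ?_)
  rw [wt, wt, ncard_edgeSet_join]
  ring

/-- Bounds on truncated sums that are uniform in the truncation hold for the full sum. -/
theorem treeSum_top_le {c b : ℝ≥0∞} (h : ∀ m : ℕ, treeSum (Γ := Γ) (wt c m) S ≤ b) :
    treeSum (Γ := Γ) (wt c ⊤) S ≤ b := by
  rw [treeSum, ENNReal.tsum_eq_iSup_sum]
  refine iSup_le fun s => ?_
  refine le_trans ?_ (h (s.sup fun T => T.1.verts.ncard))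
  refine le_trans (Finset.sum_le_sum fun T hT => ?_) (ENNReal.sum_le_tsum s)
  refine mul_le_mul' le_rfl ?_
  rw [wt, wt, ind_of_true (P := _ ≤ ((_ : ℕ) : ℕ∞))]
  · exact mul_le_mul' ind_le_one le_rfl
  · exact_mod_cast Finset.le_sup (f := fun T : FinTree Γ => T.1.verts.ncard) hT

end Sums

end FinTree

end


/-! ### Cutting trees at the origin of a homogeneous graph -/

noncomputable section

open scoped ENNReal

namespace FinTree

open SimpleGraph

variable {V : Type*} [AddCommGroup V]

/-- The graph in which the neighbours of every point `x` are the points `x + y` with `y ∈ Λ`. -/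
structure _root_.SimpleGraph.IsHomogeneous (Γ : SimpleGraph V) (Λ : Finset V) : Prop where
  adj_iff : ∀ x y, Γ.Adj x y ↔ y - x ∈ Λ

variable {Γ : SimpleGraph V} {Λ : Finset V}

theorem _root_.SimpleGraph.IsHomogeneous.adj_zero (hΓ : Γ.IsHomogeneous Λ) {y : V} :
    Γ.Adj 0 y ↔ y ∈ Λ := by
  rw [hΓ.adj_iff, sub_zero]

theorem _root_.SimpleGraph.IsHomogeneous.neg_mem (hΓ : Γ.IsHomogeneous Λ) {y : V} :
    -y ∈ Λ ↔ y ∈ Λ := by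
  rw [← hΓ.adj_zero (y := y), Γ.adj_comm, hΓ.adj_iff, zero_sub]

/-- The translation by `z`, as an automorphism of a homogeneous graph. -/
def _root_.SimpleGraph.IsHomogeneous.shift (hΓ : Γ.IsHomogeneous Λ) (z : V) : Γ ≃g Γ where
  toEquiv := Equiv.addRight z
  map_rel_iff' := by
    intro x y
    simp [hΓ.adj_iff]

theorem treeSum_shift (hΓ : Γ.IsHomogeneous Λ) (c : ℝ≥0∞) (m : ℕ∞) (S : Set V) (z : V) :
    treeSum (Γ := Γ) (wt c m) ((fun x => x + z) '' S) = treeSum (Γ := Γ) (wt c m) S :=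
  treeSum_map_image (wt_map c m) (hΓ.shift z) S

theorem treeSum_single (hΓ : Γ.IsHomogeneous Λ) (c : ℝ≥0∞) (m : ℕ∞) (y : V) :
    treeSum (Γ := Γ) (wt c m) {y} = treeSum (Γ := Γ) (wt c m) {0} := by
  rw [← treeSum_shift hΓ c m {0} y, Set.image_singleton, zero_add]

theorem treeSum_pair (hΓ : Γ.IsHomogeneous Λ) (c : ℝ≥0∞) (m : ℕ∞) (y x : V) :
    treeSum (Γ := Γ) (wt c m) {y, x} = treeSum (Γ := Γ) (wt c m) {0, x - y} := by
  rw [← treeSum_shift hΓ c m {0, x - y} y, Set.image_pair, zero_add, sub_add_cancel]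

theorem treeSum_triple (hΓ : Γ.IsHomogeneous Λ) (c : ℝ≥0∞) (m : ℕ∞) (y x v : V) :
    treeSum (Γ := Γ) (wt c m) {y, x, v} = treeSum (Γ := Γ) (wt c m) {0, x - y, v - y} := by
  rw [← treeSum_shift hΓ c m {0, x - y, v - y} y, Set.image_insert_eq, Set.image_pair, zero_add,
    sub_add_cancel, sub_add_cancel]

open Classical in
/-- Splitting a tree at the first edge of its path from `0` to `x`: the edge leads to some `y ∈ Λ`.
-/
theorem sum_mem_aux (hΓ : Γ.IsHomogeneous Λ) {x : V} (hx : x ≠ 0) (F : FinTree Γ → ℝ≥0∞) :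
    ∑' T : FinTree Γ, ind ({0, x} ⊆ T.1.verts) * F T = ∑ y ∈ Λ, ∑' T, ∑' R,
      if H : Γ.Adj 0 y ∧ Joinable 0 y T R ∧ x ∈ R.1.verts then F (join H.1 T R H.2.1) else 0 := by
  simp only [Set.insert_subset_iff, Set.singleton_subset_iff]
  rw [tsum_mem hx, tsum_eq_sum (s := Λ)]
  intro y hy
  rw [ENNReal.tsum_eq_zero]
  intro T
  rw [ENNReal.tsum_eq_zero]
  intro R
  exact dif_neg fun H => hy (hΓ.adj_zero.1 H.1)

theorem ind_joinable {y x : V} {T R : FinTree Γ} :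
    ind (Disjoint T.1.verts R.1.verts) * (ind (({0} : Set V) ⊆ T.1.verts) *
      ind ({y, x} ⊆ R.1.verts)) = ind (Joinable 0 y T R ∧ x ∈ R.1.verts) := by
  rw [← ind_and, ← ind_and]
  refine ind_congr ?_
  simp only [Set.insert_subset_iff, Set.singleton_subset_iff, Joinable]
  tauto

/-- Splitting a tree at the first edge of its path from `0` to `x`. -/
theorem sum_mem_eq (hΓ : Γ.IsHomogeneous Λ) {x : V} (hx : x ≠ 0) (F : FinTree Γ → ℝ≥0∞)
    (K : V → FinTree Γ → FinTree Γ → ℝ≥0∞)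
    (hK : ∀ y (h : Γ.Adj 0 y) T R (H : Joinable 0 y T R), F (join h T R H) = K y T R) :
    ∑' T : FinTree Γ, ind ({0, x} ⊆ T.1.verts) * F T = ∑ y ∈ Λ, ∑' T : FinTree Γ,
      ∑' R : FinTree Γ, ind (Disjoint T.1.verts R.1.verts) * (ind (({0} : Set V) ⊆ T.1.verts) *
        ind ({y, x} ⊆ R.1.verts)) * K y T R := by
  rw [sum_mem_aux hΓ hx]
  refine Finset.sum_congr rfl fun y hy => tsum_congr fun T => tsum_congr fun R => ?_
  rw [ind_joinable]
  have hy' := hΓ.adj_zero.2 hy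
  by_cases H : Joinable 0 y T R ∧ x ∈ R.1.verts
  · rw [dif_pos ⟨hy', H⟩, ind_of_true H, one_mul, hK]
  · rw [dif_neg fun h => H h.2, ind_of_false H, zero_mul]

/-- Splitting a tree at the first edge of its path from `0` to `x`, without keeping track of the
disjointness of the two parts. -/
theorem sum_mem_le (hΓ : Γ.IsHomogeneous Λ) {x : V} (hx : x ≠ 0) (F : FinTree Γ → ℝ≥0∞)
    (K : V → FinTree Γ → FinTree Γ → ℝ≥0∞)
    (hK : ∀ y (h : Γ.Adj 0 y) T R (H : Joinable 0 y T R), F (join h T R H) ≤ K y T R) :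
    ∑' T : FinTree Γ, ind ({0, x} ⊆ T.1.verts) * F T ≤ ∑ y ∈ Λ, ∑' T : FinTree Γ,
      ∑' R : FinTree Γ, (ind (({0} : Set V) ⊆ T.1.verts) *
        ind ({y, x} ⊆ R.1.verts)) * K y T R := by
  rw [sum_mem_aux hΓ hx]
  refine Finset.sum_le_sum fun y hy => ENNReal.tsum_le_tsum fun T =>
    ENNReal.tsum_le_tsum fun R => ?_
  split_ifs with H
  · refine (hK _ _ _ _ _).trans (le_of_eq ?_)
    rw [ind_of_true (Set.singleton_subset_iff.2 H.2.1.1), ind_of_true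
      (Set.insert_subset H.2.1.2.1 (Set.singleton_subset_iff.2 H.2.2)), one_mul, one_mul]
  · exact zero_le

/-- The weight `ω`, restricted to the trees in which all neighbours of `0` belong to `Y`. -/
def rootWt (ω : FinTree Γ → ℝ≥0∞) (Y : Finset V) (T : FinTree Γ) : ℝ≥0∞ :=
  ind (∀ z, T.1.Adj 0 z → z ∈ Y) * ω T

theorem rootWt_le (ω : FinTree Γ → ℝ≥0∞) (Y : Finset V) (T : FinTree Γ) : rootWt ω Y T ≤ ω T :=
  (mul_le_mul' ind_le_one le_rfl).trans (one_mul _).le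

theorem rootWt_univ (hΓ : Γ.IsHomogeneous Λ) (ω : FinTree Γ → ℝ≥0∞) : rootWt ω Λ = ω := by
  funext T
  rw [rootWt, ind_of_true fun z hz => hΓ.adj_zero.1 hz.adj_sub, one_mul]

/-- The only tree at `0` in which `0` has no neighbours is the single vertex. -/
theorem treeSum_rootWt_empty (c : ℝ≥0∞) :
    treeSum (Γ := Γ) (rootWt (wt c ⊤) ∅) {0} = 1 := by
  let T₀ : FinTree Γ := ⟨Γ.singletonSubgraph 0, Set.finite_singleton _,
    IsTree.coe_singletonSubgraph Γ 0⟩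
  rw [treeSum, tsum_eq_single T₀]
  · have h0 : ({0} : Set V) ⊆ T₀.1.verts := Set.Subset.refl _
    rw [ind_of_true h0, rootWt, ind_of_true, wt_top]
    · simp [T₀]
    · intro z hz
      exact hz.elim
  · intro T hT
    by_contra hne
    refine hT (Subtype.ext ?_)
    have h1 : 0 ∈ T.1.verts := by
      by_contra h
      exact hne (by rw [ind_of_false fun h' => h (Set.singleton_subset_iff.1 h'), zero_mul])
    refine T.verts_eq_singleton h1 fun z hz => ?_
    have h2 : ¬ ∀ z, T.1.Adj 0 z → z ∈ (∅ : Finset V) := fun h => by simpa using h z hz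
    exact hne (by rw [rootWt, ind_of_false h2, zero_mul, mul_zero])

/-- Cutting the first edge of the path from `0` to `x`. -/
theorem treeSum_wt_pair_le (hΓ : Γ.IsHomogeneous Λ) (c : ℝ≥0∞) (m : ℕ) {x : V} (hx : x ≠ 0) :
    treeSum (Γ := Γ) (wt c (m + 1 : ℕ)) {0, x} ≤
      ∑ y ∈ Λ, c * (treeSum (Γ := Γ) (wt c m) {0} * treeSum (Γ := Γ) (wt c m) {y, x}) := by
  rw [treeSum]
  refine (sum_mem_le hΓ hx _ (fun y T R => c * (wt c m T * wt c m R))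
    fun y h T R H => wt_join_le c m h H).trans (le_of_eq ?_)
  refine Finset.sum_congr rfl fun y _ => ?_
  rw [treeSum, treeSum, ENNReal.tsum_mul_tsum]
  simp only [← ENNReal.tsum_mul_left]
  refine tsum_congr fun T => tsum_congr fun R => ?_
  ring

/-- Cutting the first edge of the path from `0` to `x`, the point `v` may lie on either side. -/
theorem treeSum_wt_triple_le (hΓ : Γ.IsHomogeneous Λ) (c : ℝ≥0∞) (m : ℕ) {x : V} (hx : x ≠ 0)
    (v : V) :
    treeSum (Γ := Γ) (wt c (m + 1 : ℕ)) {0, x, v} ≤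
      ∑ y ∈ Λ, c * (treeSum (Γ := Γ) (wt c m) {0, v} * treeSum (Γ := Γ) (wt c m) {y, x} +
        treeSum (Γ := Γ) (wt c m) {0} * treeSum (Γ := Γ) (wt c m) {y, x, v}) := by
  have h1 : ∀ (a : V) (T : FinTree Γ), ind ({a, x, v} ⊆ T.1.verts) =
      ind ({a, x} ⊆ T.1.verts) * ind (v ∈ T.1.verts) := by
    intro a T
    rw [← ind_and]
    refine ind_congr ?_
    simp only [Set.insert_subset_iff, Set.singleton_subset_iff, and_assoc]
  have h2 : ∀ (T : FinTree Γ), ind ({0, v} ⊆ T.1.verts) =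
      ind (({0} : Set V) ⊆ T.1.verts) * ind (v ∈ T.1.verts) := by
    intro T
    rw [← ind_and]
    refine ind_congr ?_
    simp only [Set.insert_subset_iff, Set.singleton_subset_iff]
  rw [treeSum]
  simp only [h1, mul_assoc]
  refine (sum_mem_le hΓ hx _ (fun y T R => (ind (v ∈ T.1.verts) + ind (v ∈ R.1.verts)) *
    (c * (wt c m T * wt c m R))) fun y h T R H => ?_).trans (le_of_eq ?_)
  · refine mul_le_mul' (le_trans (ind_mono ?_) ind_or_le) (wt_join_le c m h H)
    rw [verts_join]
    exact id
  · refine Finset.sum_congr rfl fun y _ => ?_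
    simp only [treeSum]
    rw [ENNReal.tsum_mul_tsum, ENNReal.tsum_mul_tsum, ← ENNReal.tsum_add, ← ENNReal.tsum_mul_left]
    refine tsum_congr fun T => ?_
    rw [← ENNReal.tsum_add, ← ENNReal.tsum_mul_left]
    refine tsum_congr fun R => ?_
    rw [h1, h2]
    ring

variable [DecidableEq V]

theorem ind_neighbours_join {y : V} (h : Γ.Adj 0 y) {T R : FinTree Γ} (H : Joinable 0 y T R)
    (Y : Finset V) :
    ind (∀ z, (join h T R H).1.Adj 0 z → z ∈ Y) =
      ind (y ∈ Y) * ind (∀ z, T.1.Adj 0 z → z ∈ Y.erase y) := by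
  rw [← ind_and]
  refine ind_congr ?_
  simp only [adj_join_iff, Finset.mem_erase]
  constructor
  · refine fun h1 => ⟨h1 y (.inr rfl), fun z hz => ⟨?_, h1 z (.inl hz)⟩⟩
    rintro rfl
    exact Set.disjoint_left.1 H.2.2 hz.snd_mem H.2.1
  · rintro ⟨h1, h2⟩ z (hz | rfl)
    exacts [(h2 z hz).2, h1]

/-- Cutting the first edge of the path from `0` to `x` removes the neighbour `y` of `0`. -/
theorem treeSum_rootWt_pair (hΓ : Γ.IsHomogeneous Λ) (c : ℝ≥0∞) {Y : Finset V} (hY : Y ⊆ Λ) {x : V}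
    (hx : x ≠ 0) :
    treeSum (Γ := Γ) (rootWt (wt c ⊤) Y) {0, x} =
      ∑ y ∈ Y, c * apartSum (Γ := Γ) (rootWt (wt c ⊤) (Y.erase y)) {0} (wt c ⊤) {y, x} := by
  rw [treeSum, sum_mem_eq hΓ hx _ (fun y T R => ind (y ∈ Y) * (c * (rootWt (wt c ⊤) (Y.erase y) T *
    wt c ⊤ R)))]
  · rw [← Finset.sum_subset hY]
    · refine Finset.sum_congr rfl fun y hy => ?_
      simp only [ind_of_true hy, one_mul, apartSum, ← ENNReal.tsum_mul_left]
      refine tsum_congr fun T => tsum_congr fun R => ?_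
      ring
    · intro y _ hy
      simp [ind_of_false hy]
  · intro y h T R H
    rw [rootWt, ind_neighbours_join, wt_join_top, rootWt]
    ring

theorem treeSum_rootWt_insert_aux {ω : FinTree Γ → ℝ≥0∞} {Y : Finset V} {y : V} (hy : y ∉ Y) :
    treeSum (rootWt ω (insert y Y)) {0} = treeSum (rootWt ω Y) {0} +
      ∑' T, ind (T.1.Adj 0 y) * rootWt ω (insert y Y) T := by
  rw [treeSum, treeSum, ← ENNReal.tsum_add]
  refine tsum_congr fun T => ?_
  by_cases h : T.1.Adj 0 y
  · have h' : ¬ ∀ z, T.1.Adj 0 z → z ∈ Y := fun h' => hy (h' y h)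
    rw [ind_of_true h, ind_of_true (Set.singleton_subset_iff.2 h.fst_mem), rootWt, rootWt,
      ind_of_false h']
    simp
  · rw [ind_of_false h, zero_mul, add_zero, rootWt, rootWt]
    congr 2
    refine ind_congr ⟨fun h' z hz => ?_, fun h' z hz => Finset.mem_insert_of_mem (h' z hz)⟩
    exact (Finset.mem_insert.1 (h' z hz)).resolve_left fun he => h (he ▸ hz)

/-- The trees in which `0` is joined to `y` arise by attaching a tree that contains `y`. -/
theorem treeSum_rootWt_insert (hΓ : Γ.IsHomogeneous Λ) (c : ℝ≥0∞) {Y : Finset V} {y : V}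
    (hyΛ : y ∈ Λ) (hy : y ∉ Y) :
    treeSum (Γ := Γ) (rootWt (wt c ⊤) (insert y Y)) {0} =
      treeSum (Γ := Γ) (rootWt (wt c ⊤) Y) {0} +
        c * apartSum (Γ := Γ) (rootWt (wt c ⊤) Y) {0} (wt c ⊤) {y} := by
  rw [treeSum_rootWt_insert_aux hy, tsum_adj (hΓ.adj_zero.2 hyΛ)]
  congr 1
  simp only [apartSum, ← ENNReal.tsum_mul_left]
  refine tsum_congr fun T => tsum_congr fun R => ?_
  split_ifs with H
  · rw [rootWt, ind_neighbours_join, wt_join_top, Finset.erase_insert hy, rootWt,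
      ind_of_true (Finset.mem_insert_self _ _), ind_of_true H.2.2,
      ind_of_true (Set.singleton_subset_iff.2 H.1), ind_of_true (Set.singleton_subset_iff.2 H.2.1)]
    ring
  · have h0 : ind (Disjoint T.1.verts R.1.verts) * (ind (({0} : Set V) ⊆ T.1.verts) *
        ind (({y} : Set V) ⊆ R.1.verts)) = 0 := by
      rw [← ind_and, ← ind_and, ind_of_false]
      simp only [Set.singleton_subset_iff]
      exact fun h => H ⟨h.2.1, h.2.2, h.1⟩
    rw [mul_mul_mul_comm, ← mul_assoc (ind _), h0, zero_mul, mul_zero]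

/-- Attaching a tree at the neighbour `y` of `0`, with the disjointness of the two trees dropped. -/
theorem treeSum_rootWt_insert_le (hΓ : Γ.IsHomogeneous Λ) (c : ℝ≥0∞) (m : ℕ) {Y : Finset V} {y : V}
    (hyΛ : y ∈ Λ) (hy : y ∉ Y) :
    treeSum (Γ := Γ) (rootWt (wt c (m + 1 : ℕ)) (insert y Y)) {0} ≤
      treeSum (Γ := Γ) (rootWt (wt c (m + 1 : ℕ)) Y) {0} *
        (1 + c * treeSum (Γ := Γ) (wt c m) {y}) := by
  rw [treeSum_rootWt_insert_aux hy, tsum_adj (hΓ.adj_zero.2 hyΛ), mul_add, mul_one]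
  refine add_le_add le_rfl ?_
  rw [mul_left_comm, treeSum, treeSum, ENNReal.tsum_mul_tsum, ← ENNReal.tsum_mul_left]
  refine ENNReal.tsum_le_tsum fun T => ?_
  rw [← ENNReal.tsum_mul_left]
  refine ENNReal.tsum_le_tsum fun R => ?_
  split_ifs with H
  · rw [rootWt, ind_neighbours_join, Finset.erase_insert hy, rootWt,
      ind_of_true (Finset.mem_insert_self _ _),
      ind_of_true (Set.singleton_subset_iff.2 H.1), ind_of_true (Set.singleton_subset_iff.2 H.2.1),
      one_mul, one_mul, one_mul, mul_assoc, mul_left_comm c]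
    refine mul_le_mul' le_rfl ((wt_join_le c m _ H).trans ?_)
    refine mul_le_mul' le_rfl (mul_le_mul' (wt_mono c ?_ T) le_rfl)
    exact_mod_cast Nat.le_succ m
  · exact zero_le

end FinTree

end


/-! ### Random walk bounds on the 2-point and 3-point functions -/

noncomputable section

open scoped ENNReal

namespace Conv

variable {V : Type*}

/-- The uniform distribution on the finite set `Λ`. -/
def unif (Λ : Finset V) : Conv V := ⟨fun x => ind (x ∈ Λ) * (Λ.card : ℝ≥0∞)⁻¹⟩

theorem unif_apply (Λ : Finset V) (x : V) : unif Λ x = ind (x ∈ Λ) * (Λ.card : ℝ≥0∞)⁻¹ := rfl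

theorem tsum_ind_mul (Λ : Finset V) (f : V → ℝ≥0∞) : ∑' y, ind (y ∈ Λ) * f y = ∑ y ∈ Λ, f y := by
  rw [tsum_eq_sum (s := Λ)]
  · exact Finset.sum_congr rfl fun y hy => by rw [ind_of_true hy, one_mul]
  · intro y hy
    rw [ind_of_false hy, zero_mul]

theorem card_mul_unif_mul [AddCommGroup V] {Λ : Finset V} (hΛ : Λ.card ≠ 0) (f : Conv V) (x : V) :
    (Λ.card : ℝ≥0∞) * (unif Λ * f) x = ∑ y ∈ Λ, f (x - y) := by
  rw [mul_apply]
  simp only [unif_apply, mul_assoc]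
  rw [tsum_ind_mul, ← Finset.mul_sum, ← mul_assoc, ENNReal.mul_inv_cancel, one_mul]
  · exact_mod_cast hΛ
  · exact ENNReal.natCast_ne_top _

theorem mass_unif {Λ : Finset V} (hΛ : Λ.card ≠ 0) : mass (unif Λ) = 1 := by
  rw [mass]
  simp only [unif_apply]
  rw [tsum_ind_mul, Finset.sum_const, nsmul_eq_mul, ENNReal.mul_inv_cancel]
  · exact_mod_cast hΛ
  · exact ENNReal.natCast_ne_top _

end Conv

namespace FinTree

open SimpleGraph Conv

section

variable {V : Type*} {Γ : SimpleGraph V} {c : ℝ≥0∞}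

theorem treeSum_wt_zero (S : Set V) : treeSum (Γ := Γ) (wt c (0 : ℕ)) S = 0 := by
  rw [treeSum, ENNReal.tsum_eq_zero]
  intro T
  have h : ¬ (T.1.verts.ncard : ℕ∞) ≤ (0 : ℕ) := by
    rw [Nat.cast_le, T.ncard_verts]
    omega
  rw [wt, ind_of_false h, zero_mul, mul_zero]

theorem treeSum_wt_le_top (m : ℕ∞) (S : Set V) :
    treeSum (Γ := Γ) (wt c m) S ≤ treeSum (Γ := Γ) (wt c ⊤) S :=
  treeSum_mono (wt_mono c le_top)

theorem mul_le_apartSum_add {ω ω' : FinTree Γ → ℝ≥0∞} {A B : Set V} :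
    treeSum ω A * treeSum ω' B ≤ apartSum ω A ω' B +
      ∑' v, treeSum ω (insert v A) * treeSum ω' (insert v B) := by
  rw [← apartSum_add_meetSum]
  exact add_le_add le_rfl meetSum_le

end

variable {V : Type*} [AddCommGroup V] {Γ : SimpleGraph V} {Λ : Finset V} {c : ℝ≥0∞}

variable (Γ) in
/-- The 2-point function: the sum over the trees with at most `m` vertices that contain `0` and
`x`. -/
def twoPoint (c : ℝ≥0∞) (m : ℕ∞) : Conv V := ⟨fun x => treeSum (Γ := Γ) (wt c m) {0, x}⟩

theorem twoPoint_apply (m : ℕ∞) (x : V) :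
    twoPoint Γ c m x = treeSum (Γ := Γ) (wt c m) {0, x} := rfl

theorem twoPoint_zero (m : ℕ∞) : twoPoint Γ c m 0 = treeSum (Γ := Γ) (wt c m) {0} := by
  rw [twoPoint_apply, Set.pair_eq_singleton]

theorem treeSum_pair' (hΓ : Γ.IsHomogeneous Λ) (m : ℕ∞) (y x : V) :
    treeSum (Γ := Γ) (wt c m) {y, x} = twoPoint Γ c m (x - y) :=
  treeSum_pair hΓ c m y x

theorem twoPoint_neg (hΓ : Γ.IsHomogeneous Λ) (m : ℕ∞) (x : V) :
    twoPoint Γ c m (-x) = twoPoint Γ c m x := by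
  rw [← zero_sub, ← treeSum_pair' hΓ, Set.pair_comm, twoPoint_apply]

theorem unif_neg (hΓ : Γ.IsHomogeneous Λ) (x : V) : unif Λ (-x) = unif Λ x := by
  rw [unif_apply, unif_apply, ind_congr hΓ.neg_mem]

local notation "g" => treeSum (Γ := Γ) (wt c ⊤) {0}

local notation "D" => unif Λ

local notation "S" => green (unif Λ)

local notation "G" => twoPoint Γ c ⊤

variable (hΓ : Γ.IsHomogeneous Λ)
  (hc : c * treeSum (Γ := Γ) (wt c ⊤) {0} * (Λ.card : ℝ≥0∞) = 1)

include hc in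
theorem card_ne_zero : Λ.card ≠ 0 := by
  intro h
  simp [h] at hc

include hc in
/-- Since `c * g * |Λ| = 1` at the base point, averaging over `Λ` with the weight `c * g` is the
convolution with the step distribution. -/
theorem mul_sum_eq (f : Conv V) (x : V) : c * g * ∑ y ∈ Λ, f (x - y) = (D * f) x := by
  rw [← card_mul_unif_mul (card_ne_zero hc), ← mul_assoc, hc, one_mul]

theorem le_green (a : ℝ≥0∞) : a ≤ a * S 0 := by
  conv_lhs => rw [← mul_one a, ← one_apply_zero (V := V)]
  exact mul_le_mul' le_rfl (one_le_green _ 0)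

include hΓ hc in
/-- At the base point the 2-point function is bounded by the Green function of the random walk. -/
theorem twoPoint_le : G ≤ g • S := by
  have key : ∀ m : ℕ, twoPoint Γ c m ≤ g • S := by
    intro m
    induction m with
    | zero =>
      intro x
      rw [twoPoint_apply, treeSum_wt_zero]
      exact zero_le
    | succ m ih =>
      intro x
      by_cases hx : x = 0
      · rw [hx, twoPoint_zero]
        exact (treeSum_wt_le_top _ _).trans (le_green _)
      · rw [twoPoint_apply]
        refine (treeSum_wt_pair_le hΓ c m hx).trans ?_
        calc ∑ y ∈ Λ, c * (treeSum (Γ := Γ) (wt c m) {0} * treeSum (Γ := Γ) (wt c m) {y, x})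
            ≤ ∑ y ∈ Λ, c * (g * (g * S (x - y))) := by
              refine Finset.sum_le_sum fun y _ => mul_le_mul' le_rfl
                (mul_le_mul' (treeSum_wt_le_top _ _) ?_)
              rw [treeSum_pair' hΓ]
              exact ih _
          _ = g * (D * S) x := by
              rw [← mul_sum_eq hc, Finset.mul_sum, Finset.mul_sum]
              refine Finset.sum_congr rfl fun y _ => ?_
              ring
          _ ≤ _ := mul_le_mul' le_rfl (mul_green_le _ x)
  exact fun x => treeSum_top_le fun m => key m x

/-- The tree diagram with three legs, which bounds the 3-point function. -/
def tripod (f : Conv V) (x v : V) : ℝ≥0∞ := ∑' u, f u * (f (x - u) * f (v - u))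

include hc in
/-- One step of the random walk moves the root of the tree diagram. -/
theorem sum_tripod (x v : V) :
    c * g * ∑ y ∈ Λ, tripod S (x - y) (v - y) =
      ∑' u, (D * S) u * (S (x - u) * S (v - u)) := by
  rw [Finset.mul_sum]
  calc ∑ y ∈ Λ, c * g * ∑' u, S u * (S (x - y - u) * S (v - y - u))
      = ∑ y ∈ Λ, ∑' u, c * g * (S (u - y) * (S (x - u) * S (v - u))) := by
        refine Finset.sum_congr rfl fun y _ => ?_
        rw [ENNReal.tsum_mul_left, ← (Equiv.subRight y).tsum_eq]
        refine congrArg _ (tsum_congr fun u => ?_)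
        simp only [Equiv.subRight_apply, sub_sub, add_sub_cancel]
    _ = ∑' u, ∑ y ∈ Λ, c * g * (S (u - y) * (S (x - u) * S (v - u))) :=
        (Summable.tsum_finsetSum fun _ _ => ENNReal.summable).symm
    _ = _ := by
        refine tsum_congr fun u => ?_
        rw [← mul_sum_eq hc, Finset.mul_sum, Finset.sum_mul]
        exact Finset.sum_congr rfl fun y _ => by ring

include hΓ hc in
/-- At the base point the 3-point function is bounded by the tree diagram of the Green function:
cutting the first edge of the path from `0` to `x` either separates `v` from `x`, which gives the
branch point `0`, or moves the root of the diagram by one step of the random walk. -/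
theorem threePoint_le (x v : V) : treeSum (Γ := Γ) (wt c ⊤) {0, x, v} ≤ g * tripod S x v := by
  have key : ∀ m : ℕ, ∀ x v, treeSum (Γ := Γ) (wt c m) {0, x, v} ≤ g * tripod S x v := by
    intro m
    induction m with
    | zero =>
      intro x v
      rw [treeSum_wt_zero]
      exact zero_le
    | succ m ih =>
      intro x v
      by_cases hx : x = 0
      · rw [hx, Set.insert_eq_of_mem (Set.mem_insert 0 _)]
        refine (treeSum_wt_le_top _ _).trans ((twoPoint_le hΓ hc v).trans ?_)
        refine mul_le_mul' le_rfl (le_trans ?_ (ENNReal.le_tsum 0))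
        rw [sub_zero, sub_zero, ← mul_assoc]
        refine (one_mul (S v)).ge.trans (mul_le_mul' ?_ le_rfl)
        rw [← one_apply_zero (V := V)]
        exact (one_le_green D 0).trans (le_green _)
      · refine (treeSum_wt_triple_le hΓ c m hx v).trans ?_
        calc _ ≤ ∑ y ∈ Λ, c * ((g * S v) * (g * S (x - y)) +
              g * (g * tripod S (x - y) (v - y))) := by
              refine Finset.sum_le_sum fun y _ => mul_le_mul' le_rfl ?_
              refine add_le_add (mul_le_mul' ((treeSum_wt_le_top _ _).trans (twoPoint_le hΓ hc v))
                ((treeSum_wt_le_top _ _).trans ?_))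
                (mul_le_mul' (treeSum_wt_le_top _ _) ?_)
              · rw [treeSum_pair' hΓ]
                exact twoPoint_le hΓ hc _
              · rw [treeSum_triple hΓ]
                exact ih _ _
          _ = g * ((D * S) x * S v + ∑' u, (D * S) u * (S (x - u) * S (v - u))) := by
              rw [← sum_tripod hc, ← mul_sum_eq hc, ← Finset.mul_sum, Finset.sum_add_distrib,
                ← Finset.mul_sum, ← Finset.mul_sum, ← Finset.mul_sum, ← Finset.mul_sum]
              ring
          _ ≤ g * tripod S x v := by
              refine mul_le_mul' le_rfl ?_
              have hS : ∀ u, S u = (1 : Conv V) u + (D * S) u := fun u => by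
                conv_lhs => rw [green_eq]
                rfl
              have h1 : tripod S x v = ∑' u, (1 : Conv V) u * (S (x - u) * S (v - u)) +
                  ∑' u, (D * S) u * (S (x - u) * S (v - u)) := by
                rw [← ENNReal.tsum_add, tripod]
                refine tsum_congr fun u => ?_
                conv_lhs => rw [hS u]
                rw [add_mul]
              rw [h1]
              refine add_le_add ?_ le_rfl
              refine le_trans ?_ (ENNReal.le_tsum 0)
              rw [one_apply_zero, one_mul, sub_zero, sub_zero]
              exact mul_le_mul' (mul_green_le _ _) le_rfl
  exact treeSum_top_le fun m => key m x v

/-- The upper bound on the correction to the random walk recursion for the 2-point function, which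
comes from the intersections of the two trees on the sides of an edge. -/
def meetTwo (Γ : SimpleGraph V) (Λ : Finset V) (c : ℝ≥0∞) : Conv V :=
  ⟨fun x => ∑ y ∈ Λ, c * ∑' v, twoPoint Γ c ⊤ v * treeSum (Γ := Γ) (wt c ⊤) {v, y, x}⟩

local notation "E" => meetTwo Γ Λ c

theorem meetTwo_apply (x : V) :
    E x = ∑ y ∈ Λ, c * ∑' v, G v * treeSum (Γ := Γ) (wt c ⊤) {v, y, x} := rfl

/-- The diagram with a loop at the origin: a nontrivial line from `0` to `u`, and two further lines
that return from `u` to `0` through a third point. -/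
def loop (Λ : Finset V) : Conv V :=
  ⟨fun u => (unif Λ * green (unif Λ)) u * (green (unif Λ) * green (unif Λ)) u⟩

include hΓ in
theorem green_unif_neg (x : V) : S (-x) = S x := IsSymm.green (unif_neg hΓ) x

include hΓ hc in
/-- The correction to the random walk recursion: the walk makes a loop at some point `u`, where the
tree on the side of `0` and the tree on the side of `x` intersect. -/
theorem meetTwo_le : E ≤ g • (loop Λ * S) := by
  intro x
  rw [meetTwo_apply, smul_apply]
  calc ∑ y ∈ Λ, c * ∑' v, G v * treeSum (Γ := Γ) (wt c ⊤) {v, y, x}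
      ≤ ∑ y ∈ Λ, c * ∑' v, (g * S v) * (g * tripod S (x - y) (v - y)) := by
        refine Finset.sum_le_sum fun y _ => mul_le_mul' le_rfl
          (ENNReal.tsum_le_tsum fun v => mul_le_mul' (twoPoint_le hΓ hc v) ?_)
        have h : ({v, y, x} : Set V) = {y, x, v} := by
          ext
          simp only [Set.mem_insert_iff, Set.mem_singleton_iff]
          tauto
        rw [h, treeSum_triple hΓ]
        exact threePoint_le hΓ hc _ _
    _ = g * ∑' v, S v * (c * g * ∑ y ∈ Λ, tripod S (x - y) (v - y)) := by
        simp only [Finset.mul_sum, ← ENNReal.tsum_mul_left]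
        rw [Summable.tsum_finsetSum fun _ _ => ENNReal.summable]
        refine Finset.sum_congr rfl fun y _ => tsum_congr fun v => ?_
        ring
    _ = g * ∑' u, ((D * S) u * ∑' v, S v * S (u - v)) * S (x - u) := by
        congr 1
        simp only [sum_tripod hc, ← ENNReal.tsum_mul_left, ← ENNReal.tsum_mul_right]
        rw [ENNReal.tsum_comm]
        refine tsum_congr fun u => tsum_congr fun v => ?_
        rw [← green_unif_neg hΓ (v - u), neg_sub]
        ring
    _ = _ := rfl

/-- The recursion for the 2-point function, as an identity. -/
theorem treeSum_pair_eq (hΓ : Γ.IsHomogeneous Λ) {x : V} (hx : x ≠ 0) :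
    treeSum (Γ := Γ) (wt c ⊤) {0, x} =
      ∑ y ∈ Λ, c * apartSum (Γ := Γ) (wt c ⊤) {0} (wt c ⊤) {y, x} := by
  rw [treeSum, sum_mem_eq hΓ hx _ (fun y T R => c * (wt c ⊤ T * wt c ⊤ R))]
  · refine Finset.sum_congr rfl fun y hy => ?_
    simp only [apartSum, ← ENNReal.tsum_mul_left]
    refine tsum_congr fun T => tsum_congr fun R => ?_
    ring
  · intro y h T R H
    rw [wt_join_top]

include hΓ hc in
/-- The random walk recursion for the 2-point function holds up to the correction `E`, because the
two parts of a tree that is cut at an edge are disjoint. -/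
theorem le_twoPoint_add : g • (1 : Conv V) + D * G ≤ G + E := by
  intro x
  have hterm : ∀ y v, treeSum (Γ := Γ) (wt c ⊤) (insert v {0}) *
      treeSum (Γ := Γ) (wt c ⊤) (insert v {y, x}) =
        G v * treeSum (Γ := Γ) (wt c ⊤) {v, y, x} := by
    intro y v
    rw [Set.pair_comm v 0, twoPoint_apply]
  have hsum : (D * G) x = ∑ y ∈ Λ, c * (g * treeSum (Γ := Γ) (wt c ⊤) {y, x}) := by
    rw [← mul_sum_eq hc, Finset.mul_sum]
    refine Finset.sum_congr rfl fun y _ => ?_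
    rw [treeSum_pair' hΓ, mul_assoc]
  rw [add_apply, add_apply, smul_apply, hsum]
  by_cases hx : x = 0
  · subst hx
    rw [one_apply_zero, mul_one, twoPoint_zero]
    refine add_le_add le_rfl (Finset.sum_le_sum fun y _ => mul_le_mul' le_rfl ?_)
    refine le_trans (le_of_eq ?_) (ENNReal.le_tsum 0)
    rw [twoPoint_zero, Set.pair_comm y 0, Set.insert_eq_of_mem (Set.mem_insert 0 _)]
  · rw [one_apply_of_ne hx, mul_zero, zero_add, twoPoint_apply, treeSum_pair_eq hΓ hx,
      meetTwo_apply, ← Finset.sum_add_distrib]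
    refine Finset.sum_le_sum fun y _ => ?_
    rw [← mul_add]
    refine mul_le_mul' le_rfl (mul_le_apartSum_add.trans (le_of_eq ?_))
    simp only [hterm]

include hΓ hc in
/-- The lower bound that complements `twoPoint_le`. -/
theorem green_le : g • S ≤ G + S * E := by
  have h := green_mul_le (f := D) (u := g • (1 : Conv V)) (h := G + S * E) ?_
  · rwa [mul_smul', mul_one] at h
  · calc g • (1 : Conv V) + D * (G + S * E) = g • (1 : Conv V) + D * G + D * S * E := by ring
      _ ≤ G + E + D * S * E := add_le (le_twoPoint_add hΓ hc) le_rfl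
      _ = G + (1 + D * S) * E := by ring
      _ = _ := by rw [← green_eq]

end FinTree

end


/-! ### Second order inclusion-exclusion over finite sets -/

section Recursion

variable {V : Type*} [DecidableEq V]

/-- A new element `y` adds the ordered pairs `(y, x)` and `(x, y)`. -/
theorem sum_pairs_insert {k : V → V → ℝ} (hk : ∀ x y, k x y = k y x) {Y : Finset V} {y : V}
    (hy : y ∉ Y) :
    ∑ x ∈ insert y Y, ∑ x' ∈ (insert y Y).erase x, k x x' =
      ∑ x ∈ Y, ∑ x' ∈ Y.erase x, k x x' + 2 * ∑ x ∈ Y, k y x := by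
  rw [Finset.sum_insert hy, Finset.erase_insert hy, two_mul, ← add_assoc, add_comm]
  congr 1
  rw [← Finset.sum_add_distrib]
  refine Finset.sum_congr rfl fun x hx => ?_
  have hxy : y ≠ x := fun h => hy (h ▸ hx)
  rw [Finset.erase_insert_of_ne hxy, Finset.sum_insert fun h => hy (Finset.mem_of_mem_erase h),
    add_comm, hk]

/-- An inclusion-exclusion scheme: a function of finite sets that grows by the factor `r` with every
new element, up to a defect which is known to first order, is known to second order. -/
theorem expansion_of_recursion {Λ : Finset V} {r : ℝ} (hr : 1 ≤ r) {a : Finset V → ℝ}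
    {J : Finset V → V → ℝ} {b err : V → ℝ} {k : V → V → ℝ} (hb : ∀ y, 0 ≤ b y)
    (hk0 : ∀ y y', 0 ≤ k y y') (hk : ∀ y y', k y y' = k y' y) (herr : ∀ y, 0 ≤ err y)
    (hJ0 : ∀ Y y, 0 ≤ J Y y) (ha : a ∅ = 1)
    (hrec : ∀ Y ⊆ Λ, ∀ y ∈ Λ, y ∉ Y → a (insert y Y) + J Y y = r * a Y)
    (hJle : ∀ Y ⊆ Λ, ∀ y ∈ Λ, J Y y ≤ a Y * b y + ∑ y' ∈ Y, a (Y.erase y') * k y y')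
    (hleJ : ∀ Y ⊆ Λ, ∀ y ∈ Λ,
      a Y * b y + ∑ y' ∈ Y, a (Y.erase y') * k y y' ≤ J Y y + err y) {A : ℝ}
    (hA : A = (∑ y ∈ Λ, b y) / r + (∑ y ∈ Λ, ∑ y' ∈ Λ.erase y, k y y') / (2 * r ^ 2)) :
    a Λ ≤ r ^ Λ.card ∧ r ^ Λ.card * (1 - A) ≤ a Λ ∧
      a Λ ≤ r ^ Λ.card * (1 - A + A ^ 2 + ∑ y ∈ Λ, err y) := by
  have hr0 : 0 < r := one_pos.trans_le hr
  -- the defect of `a Y` relative to `r ^ |Y|`, to first order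
  set F : Finset V → ℝ := fun Y =>
    (∑ y ∈ Y, b y) / r + (∑ y ∈ Y, ∑ y' ∈ Y.erase y, k y y') / (2 * r ^ 2) with hF
  have hFA : F Λ = A := hA.symm
  have hFins : ∀ Y : Finset V, ∀ y, y ∉ Y →
      r ^ (Y.card + 1) * F (insert y Y) = r ^ (Y.card + 1) * F Y +
        (r ^ Y.card * b y + r ^ (Y.card - 1) * ∑ y' ∈ Y, k y y') := by
    intro Y y hy
    simp only [hF]
    rw [Finset.sum_insert hy (f := b), sum_pairs_insert hk hy]
    rcases Y.eq_empty_or_nonempty with rfl | hne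
    · simp
      field_simp
    · obtain ⟨m, hm⟩ := Nat.exists_eq_succ_of_ne_zero (Finset.card_pos.2 hne).ne'
      rw [hm, Nat.succ_sub_one, Nat.succ_eq_add_one]
      field_simp
      ring
  have hFmono : ∀ Y : Finset V, Y ⊆ Λ → F Y ≤ A := by
    intro Y hY
    rw [← hFA]
    simp only [hF]
    have h1 : ∑ y ∈ Y, b y ≤ ∑ y ∈ Λ, b y :=
      Finset.sum_le_sum_of_subset_of_nonneg hY fun y _ _ => hb y
    have h2 : ∑ y ∈ Y, ∑ y' ∈ Y.erase y, k y y' ≤ ∑ y ∈ Λ, ∑ y' ∈ Λ.erase y, k y y' :=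
      (Finset.sum_le_sum fun y _ => Finset.sum_le_sum_of_subset_of_nonneg
        (Finset.erase_subset_erase y hY) fun y' _ _ => hk0 y y').trans
        (Finset.sum_le_sum_of_subset_of_nonneg hY fun y _ _ =>
          Finset.sum_nonneg fun y' _ => hk0 y y')
    gcongr
  -- the zeroth order upper bound on `a` gives the first order lower bound, which in turn gives the
  -- second order upper bound
  have hup : ∀ Y : Finset V, Y ⊆ Λ → a Y ≤ r ^ Y.card := by
    intro Y
    induction Y using Finset.induction_on with
    | empty => simp [ha]
    | insert y Y hy ih =>
      intro hY
      have hY' := Finset.insert_subset_iff.1 hY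
      have h1 := hrec Y hY'.2 y hY'.1 hy
      have h2 := hJ0 Y y
      have h3 := mul_le_mul_of_nonneg_left (ih hY'.2) hr0.le
      rw [Finset.card_insert_of_notMem hy, pow_succ']
      linarith
  have hlow : ∀ Y : Finset V, Y ⊆ Λ → r ^ Y.card * (1 - F Y) ≤ a Y := by
    intro Y
    induction Y using Finset.induction_on with
    | empty => simp [ha, hF]
    | insert y Y hy ih =>
      intro hY
      have hY' := Finset.insert_subset_iff.1 hY
      have h1 := hrec Y hY'.2 y hY'.1 hy
      have h2 := hJle Y hY'.2 y hY'.1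
      have h3 := mul_le_mul_of_nonneg_left (ih hY'.2) hr0.le
      have h4 : a Y * b y ≤ r ^ Y.card * b y := mul_le_mul_of_nonneg_right (hup Y hY'.2) (hb y)
      have h5 : ∑ y' ∈ Y, a (Y.erase y') * k y y' ≤ r ^ (Y.card - 1) * ∑ y' ∈ Y, k y y' := by
        rw [Finset.mul_sum]
        refine Finset.sum_le_sum fun y' hy' => mul_le_mul_of_nonneg_right ?_ (hk0 _ _)
        rw [← Finset.card_erase_of_mem hy']
        exact hup _ ((Finset.erase_subset _ _).trans hY'.2)
      have h6 := hFins Y y hy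
      rw [Finset.card_insert_of_notMem hy, mul_sub, h6, pow_succ' r Y.card]
      linarith
  have hlow' : ∀ Y : Finset V, Y ⊆ Λ → r ^ Y.card * (1 - A) ≤ a Y := fun Y hY =>
    (mul_le_mul_of_nonneg_left (sub_le_sub_left (hFmono Y hY) 1) (by positivity)).trans (hlow Y hY)
  have hup' : ∀ Y : Finset V, Y ⊆ Λ →
      a Y ≤ r ^ Y.card * (1 - (1 - A) * F Y + ∑ y ∈ Y, err y) := by
    intro Y
    induction Y using Finset.induction_on with
    | empty => simp [ha, hF]
    | insert y Y hy ih =>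
      intro hY
      have hY' := Finset.insert_subset_iff.1 hY
      have h1 := hrec Y hY'.2 y hY'.1 hy
      have h2 := hleJ Y hY'.2 y hY'.1
      have h3 := mul_le_mul_of_nonneg_left (ih hY'.2) hr0.le
      have h4 : r ^ Y.card * (1 - A) * b y ≤ a Y * b y :=
        mul_le_mul_of_nonneg_right (hlow' Y hY'.2) (hb y)
      have h5 : r ^ (Y.card - 1) * (1 - A) * ∑ y' ∈ Y, k y y' ≤
          ∑ y' ∈ Y, a (Y.erase y') * k y y' := by
        rw [Finset.mul_sum]
        refine Finset.sum_le_sum fun y' hy' => mul_le_mul_of_nonneg_right ?_ (hk0 _ _)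
        rw [← Finset.card_erase_of_mem hy']
        exact hlow' _ ((Finset.erase_subset _ _).trans hY'.2)
      have h6 := hFins Y y hy
      have h7 : err y ≤ r ^ (Y.card + 1) * err y :=
        le_mul_of_one_le_left (herr y) (one_le_pow₀ hr)
      have h8 : r ^ (Y.card + 1) * (1 - (1 - A) * F (insert y Y) + (err y + ∑ y ∈ Y, err y)) =
          r * (r ^ Y.card * (1 - (1 - A) * F Y + ∑ y ∈ Y, err y)) -
            (r ^ Y.card * (1 - A) * b y + r ^ (Y.card - 1) * (1 - A) * ∑ y' ∈ Y, k y y') +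
            r ^ (Y.card + 1) * err y := by
        linear_combination (-(1 - A)) * h6
      rw [Finset.card_insert_of_notMem hy, Finset.sum_insert hy, h8]
      linarith
  refine ⟨hup Λ subset_rfl, hlow' Λ subset_rfl, (hup' Λ subset_rfl).trans (le_of_eq ?_)⟩
  rw [hFA]
  ring

end Recursion


/-! ### Recursion in the set of neighbours of the origin -/

noncomputable section

open scoped ENNReal

namespace FinTree

open SimpleGraph Conv

variable {V : Type*} [AddCommGroup V] {Γ : SimpleGraph V} {Λ : Finset V} {c : ℝ≥0∞}

local notation "g" => treeSum (Γ := Γ) (wt c ⊤) {0}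

local notation "D" => unif Λ

local notation "S" => green (unif Λ)

local notation "G" => twoPoint Γ c ⊤

local notation "E" => meetTwo Γ Λ c

/-- The 2-point function of the trees in which all neighbours of `0` belong to `Y`. -/
def rootTwo (Γ : SimpleGraph V) (c : ℝ≥0∞) (Y : Finset V) : Conv V :=
  ⟨fun x => treeSum (Γ := Γ) (rootWt (wt c ⊤) Y) {0, x}⟩

theorem rootTwo_apply (Y : Finset V) (x : V) :
    rootTwo Γ c Y x = treeSum (Γ := Γ) (rootWt (wt c ⊤) Y) {0, x} := rfl

theorem rootTwo_zero (Y : Finset V) :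
    rootTwo Γ c Y 0 = treeSum (Γ := Γ) (rootWt (wt c ⊤) Y) {0} := by
  rw [rootTwo_apply, Set.pair_eq_singleton]

theorem rootTwo_le_twoPoint (Y : Finset V) : rootTwo Γ c Y ≤ G :=
  fun _ => treeSum_mono (rootWt_le _ _)

theorem rootTwo_zero_le (Y : Finset V) : rootTwo Γ c Y 0 ≤ g := by
  rw [← twoPoint_zero]
  exact rootTwo_le_twoPoint Y 0

/-- The pairs of a tree at `0` with neighbours in `Y` and a tree at `y` that intersect. -/
def rootMeet (Γ : SimpleGraph V) (c : ℝ≥0∞) (Y : Finset V) (y : V) : ℝ≥0∞ :=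
  meetSum (Γ := Γ) (rootWt (wt c ⊤) Y) {0} (wt c ⊤) {y}

/-- The sum over two trees at `0` and `y` that share two distinct points. -/
def meetTwice (Γ : SimpleGraph V) (c : ℝ≥0∞) (y : V) : ℝ≥0∞ :=
  ∑' v, ∑' v', ind (v ≠ v') *
    (treeSum (Γ := Γ) (wt c ⊤) ({v, v'} ∪ {0}) * treeSum (Γ := Γ) (wt c ⊤) ({v, v'} ∪ {y}))

variable (hΓ : Γ.IsHomogeneous Λ)
  (hc : c * treeSum (Γ := Γ) (wt c ⊤) {0} * (Λ.card : ℝ≥0∞) = 1)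

include hΓ in
/-- The first order form of `rootTwo`, with the unknown coefficients `A` and `B y'`, convolved with
the 2-point function. -/
theorem sum_rootTwo_mul (A : ℝ≥0∞) (B : V → ℝ≥0∞) (Y : Finset V) (y : V) :
    ∑' v, ((1 : Conv V) v * A + ∑ y' ∈ Y, c * (B y' * G (v - y'))) * G (v - y) =
      A * G y + ∑ y' ∈ Y, c * (B y' * (G * G) (y - y')) := by
  simp only [add_mul, ENNReal.tsum_add]
  congr 1
  · rw [tsum_eq_single 0]
    · rw [one_apply_zero, one_mul, zero_sub, twoPoint_neg hΓ]
    · intro v hv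
      rw [one_apply_of_ne hv, zero_mul, zero_mul]
  · simp only [Finset.sum_mul]
    rw [Summable.tsum_finsetSum fun _ _ => ENNReal.summable]
    refine Finset.sum_congr rfl fun y' _ => ?_
    rw [mul_apply, ← (Equiv.addRight y').tsum_eq, ← ENNReal.tsum_mul_left, ← ENNReal.tsum_mul_left]
    refine tsum_congr fun w => ?_
    rw [Equiv.coe_addRight, add_sub_cancel_right, ← twoPoint_neg hΓ ⊤ (w + y' - y), neg_sub,
      sub_add_eq_sub_sub_swap]
    ring

variable [DecidableEq V]

include hΓ in
/-- Allowing one more neighbour `y` of `0` means to attach a tree at `y`. If the two trees were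
independent, this would be the multiplication by `1 + c * g`. -/
theorem rootTwo_insert {Y : Finset V} {y : V} (hyΛ : y ∈ Λ) (hy : y ∉ Y) :
    rootTwo Γ c (insert y Y) 0 + c * rootMeet Γ c Y y = (1 + c * g) * rootTwo Γ c Y 0 := by
  rw [rootTwo_zero, rootTwo_zero, treeSum_rootWt_insert hΓ c hyΛ hy, add_assoc, ← mul_add, rootMeet,
    apartSum_add_meetSum, treeSum_single hΓ]
  ring

include hΓ in
/-- The first order upper bound on the 2-point function with restricted neighbours: the path from
`0` to `x` leaves `0` through some `y ∈ Y`. -/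
theorem rootTwo_le {Y : Finset V} (hY : Y ⊆ Λ) (x : V) :
    rootTwo Γ c Y x ≤ (1 : Conv V) x * rootTwo Γ c Y 0 +
      ∑ y ∈ Y, c * (rootTwo Γ c (Y.erase y) 0 * G (x - y)) := by
  by_cases hx : x = 0
  · rw [hx, one_apply_zero, one_mul]
    exact le_self_add
  · rw [rootTwo_apply, treeSum_rootWt_pair hΓ c hY hx]
    refine le_trans (Finset.sum_le_sum fun y _ => mul_le_mul' le_rfl ?_) le_add_self
    rw [rootTwo_zero, ← treeSum_pair' hΓ]
    exact apartSum_le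

include hΓ in
/-- The lower bound that complements `rootTwo_le`. -/
theorem le_rootTwo {Y : Finset V} (hY : Y ⊆ Λ) (x : V) :
    (1 : Conv V) x * rootTwo Γ c Y 0 + ∑ y ∈ Y, c * (rootTwo Γ c (Y.erase y) 0 * G (x - y)) ≤
      rootTwo Γ c Y x + E x := by
  have hE : ∑ y ∈ Y, c * ∑' v, rootTwo Γ c (Y.erase y) v *
      treeSum (Γ := Γ) (wt c ⊤) {v, y, x} ≤ E x := by
    rw [meetTwo_apply]
    refine (Finset.sum_le_sum fun y _ => mul_le_mul' le_rfl (ENNReal.tsum_le_tsum fun v =>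
      mul_le_mul' (rootTwo_le_twoPoint _ v) le_rfl)).trans ?_
    exact Finset.sum_le_sum_of_subset hY
  by_cases hx : x = 0
  · subst hx
    rw [one_apply_zero, one_mul]
    refine add_le_add le_rfl (le_trans ?_ hE)
    refine Finset.sum_le_sum fun y _ => mul_le_mul' le_rfl ?_
    refine le_trans (le_of_eq ?_) (ENNReal.le_tsum 0)
    rw [← treeSum_pair' hΓ, Set.pair_comm y 0, Set.insert_eq_of_mem (Set.mem_insert 0 _)]
  · rw [one_apply_of_ne hx, zero_mul, zero_add, rootTwo_apply, treeSum_rootWt_pair hΓ c hY hx]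
    refine le_trans ?_ (add_le_add le_rfl hE)
    rw [← Finset.sum_add_distrib]
    refine Finset.sum_le_sum fun y _ => ?_
    rw [← mul_add, rootTwo_zero, ← treeSum_pair' hΓ]
    refine mul_le_mul' le_rfl (mul_le_apartSum_add.trans (le_of_eq ?_))
    congr 1
    refine tsum_congr fun v => ?_
    rw [Set.pair_comm v 0, rootTwo_apply]

include hΓ in
/-- An intersection of the tree at `0` with the tree at `y` consists, to first order, of the point
`0` itself, or of a point on a branch through a neighbour `y'` of `0`. -/
theorem rootMeet_le {Y : Finset V} (hY : Y ⊆ Λ) (y : V) :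
    c * rootMeet Γ c Y y ≤ rootTwo Γ c Y 0 * (c * G y) +
      ∑ y' ∈ Y, rootTwo Γ c (Y.erase y') 0 * (c ^ 2 * (G * G) (y - y')) := by
  have h1 : rootMeet Γ c Y y ≤ ∑' v, rootTwo Γ c Y v * G (v - y) := by
    refine meetSum_le.trans (le_of_eq (tsum_congr fun v => ?_))
    rw [Set.pair_comm v 0, Set.pair_comm v y, treeSum_pair' hΓ, rootTwo_apply]
  refine (mul_le_mul' le_rfl (h1.trans (ENNReal.tsum_le_tsum fun v =>
    mul_le_mul' (rootTwo_le hΓ hY v) le_rfl))).trans (le_of_eq ?_)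
  rw [sum_rootTwo_mul hΓ, mul_add, Finset.mul_sum]
  congr 1
  · ring
  · refine Finset.sum_congr rfl fun y' _ => ?_
    ring

include hΓ in
/-- The lower bound that complements `rootMeet_le`: the error terms account for trees that share
several points and for branches that are not disjoint. -/
theorem le_rootMeet {Y : Finset V} (hY : Y ⊆ Λ) (y : V) :
    rootTwo Γ c Y 0 * (c * G y) +
      ∑ y' ∈ Y, rootTwo Γ c (Y.erase y') 0 * (c ^ 2 * (G * G) (y - y')) ≤
      c * rootMeet Γ c Y y + c * (meetTwice Γ c y + (E * G) y) := by
  have h1 : ∑' v, rootTwo Γ c Y v * G (v - y) ≤ rootMeet Γ c Y y + meetTwice Γ c y := by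
    have h2 := @le_meetSum_add _ Γ (rootWt (wt c ⊤) Y) (wt c ⊤) {0} {y}
    refine le_trans (le_of_eq (tsum_congr fun v => ?_)) (h2.trans (add_le_add le_rfl ?_))
    · rw [Set.pair_comm v 0, Set.pair_comm v y, treeSum_pair' hΓ, rootTwo_apply]
    · exact ENNReal.tsum_le_tsum fun v => ENNReal.tsum_le_tsum fun v' => mul_le_mul' le_rfl
        (mul_le_mul' (treeSum_mono (rootWt_le _ _)) le_rfl)
  calc _ = c * ∑' v, ((1 : Conv V) v * rootTwo Γ c Y 0 +
        ∑ y' ∈ Y, c * (rootTwo Γ c (Y.erase y') 0 * G (v - y'))) * G (v - y) := by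
        rw [sum_rootTwo_mul hΓ, mul_add, Finset.mul_sum]
        congr 1
        · ring
        · refine Finset.sum_congr rfl fun y' _ => ?_
          ring
    _ ≤ c * ∑' v, (rootTwo Γ c Y v + E v) * G (v - y) :=
        mul_le_mul' le_rfl (ENNReal.tsum_le_tsum fun v => mul_le_mul' (le_rootTwo hΓ hY v) le_rfl)
    _ = c * (∑' v, rootTwo Γ c Y v * G (v - y) + (E * G) y) := by
        simp only [add_mul, ENNReal.tsum_add, mul_apply]
        congr 2
        exact tsum_congr fun v => by rw [← twoPoint_neg hΓ, neg_sub]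
    _ ≤ c * (rootMeet Γ c Y y + meetTwice Γ c y + (E * G) y) := by gcongr
    _ = _ := by ring

omit [DecidableEq V]

/-! ### Diagrams -/

include hΓ in
theorem isSymm_unif : IsSymm D := unif_neg hΓ

include hΓ in
theorem isSymm_green : IsSymm S := (isSymm_unif hΓ).green

include hΓ hc in
/-- The case of `mul_sum_eq` at the origin. -/
theorem mul_sum_eq_zero (f : Conv V) : c * g * ∑ y ∈ Λ, f y = (D * f) 0 := by
  rw [← mul_sum_eq hc]
  congr 1
  refine Finset.sum_bij' (fun y _ => -y) (fun y _ => -y) ?_ ?_ ?_ ?_ ?_ <;>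
    simp [hΓ.neg_mem]

theorem le_mul_green (f : Conv V) : f ≤ f * S := by
  conv_lhs => rw [← mul_one f]
  exact mul_le le_rfl (one_le_green _)

variable {ε : ℝ≥0∞} (hε : ∀ x, (unif Λ * green (unif Λ) ^ 4) x ≤ ε)

include hε in
theorem diagram_le {f : Conv V} (hf : f ≤ D * S ^ 4) (x : V) : f x ≤ ε := (hf x).trans (hε x)

theorem pow_green_le {i j : ℕ} (h : i ≤ j) : S ^ i ≤ S ^ j := by
  induction h with
  | refl => exact le_rfl
  | step _ ih =>
    refine ih.trans ?_
    rw [pow_succ]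
    exact le_mul_green _

theorem mul_pow_green_le {i : ℕ} (h : i ≤ 4) : D * S ^ i ≤ D * S ^ 4 :=
  mul_le le_rfl (pow_green_le h)

theorem mul_mul_pow_green_le {i : ℕ} (h : i ≤ 3) : D * D * S ^ i * S ≤ D * S ^ 4 := by
  calc D * D * S ^ i * S = D * (S ^ i * (D * S)) := by ring
    _ ≤ D * (S ^ i * S) := mul_le le_rfl (mul_le le_rfl (mul_green_le _))
    _ = D * S ^ (i + 1) := by ring
    _ ≤ _ := mul_pow_green_le (by omega)

include hΓ hε in
theorem mass_loop_le : mass (loop Λ) ≤ ε := by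
  have h : mass (loop Λ) = (D * S * (S * S)) 0 :=
    (((isSymm_green hΓ).mul (isSymm_green hΓ)).mul_apply_zero _).symm
  rw [h]
  refine diagram_le hε ?_ 0
  calc D * S * (S * S) = D * S ^ 3 := by ring
    _ ≤ _ := mul_pow_green_le (by omega)

include hΓ hε in
/-- A diagram attached to a loop has two small factors. -/
theorem loop_mul_le {f : Conv V} (hf : f ≤ D * S ^ 4) (x : V) : (loop Λ * f) x ≤ ε * ε :=
  (mul_apply_le_mass_mul (diagram_le hε hf) x).trans (mul_le_mul' (mass_loop_le hΓ hε) le_rfl)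

include hΓ hc hε in
/-- The contribution of the correction `E` is of second order. -/
theorem sum_meetTwo_mul_le : c * ∑ y ∈ Λ, (E * G) y ≤ g * (ε * ε) := by
  have hEG : E * G ≤ g • (E * S) := by
    rw [← mul_smul']
    exact mul_le le_rfl (twoPoint_le hΓ hc)
  calc c * ∑ y ∈ Λ, (E * G) y ≤ c * ∑ y ∈ Λ, g * (E * S) y := by
        gcongr with y
        exact hEG y
    _ = (D * (E * S)) 0 := by rw [← mul_sum_eq_zero hΓ hc, ← Finset.mul_sum, mul_assoc]
    _ ≤ (D * ((g • (loop Λ * S)) * S)) 0 := mul_le le_rfl (mul_le (meetTwo_le hΓ hc) le_rfl) 0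
    _ = g * (loop Λ * (D * S ^ 2)) 0 := by
        rw [smul_mul, mul_smul', smul_apply]
        congr 2
        ring
    _ ≤ _ := mul_le_mul' le_rfl (loop_mul_le hΓ hε (mul_pow_green_le (by omega)) 0)

theorem ind_mul_green_le (z : V) : ind (z ≠ 0) * S z ≤ (D * S) z := by
  by_cases hz : z = 0
  · rw [ind_of_false (not_not.2 hz), zero_mul]
    exact zero_le
  · rw [ind_of_true hz, one_mul]
    conv_lhs => rw [green_eq, add_apply, one_apply_of_ne hz, zero_add]

include hΓ hε in
/-- The diagram in which two pairs of lines connect the points `u` and `w`, through distinct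
midpoints. -/
theorem bubble_le (u w : V) :
    ∑' v, ∑' v', ind (v ≠ v') * ((S (v - u) * S (v' - u)) * (S (v - w) * S (v' - w))) ≤
      2 * (ε * (S * S) (w - u)) := by
  have hconv : ∀ f : Conv V, ∑' v, f (v - u) * S (v - w) = (f * S) (w - u) := by
    intro f
    rw [mul_apply, ← (Equiv.addRight u).tsum_eq]
    refine tsum_congr fun v => ?_
    rw [Equiv.coe_addRight, add_sub_cancel_right, ← isSymm_green hΓ (v + u - w), neg_sub,
      sub_add_eq_sub_sub_swap]
  have h1 : ∑' v, ind (v ≠ u) * (S (v - u) * S (v - w)) ≤ ε := by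
    calc _ ≤ ∑' v, (D * S) (v - u) * S (v - w) := by
          refine ENNReal.tsum_le_tsum fun v => ?_
          rw [← mul_assoc]
          refine mul_le_mul' ?_ le_rfl
          rw [ind_congr (sub_ne_zero (a := v) (b := u)).symm]
          exact ind_mul_green_le _
      _ = (D * S ^ 2) (w - u) := by rw [hconv, mul_assoc, pow_two]
      _ ≤ ε := diagram_le hε (mul_pow_green_le (by omega)) _
  calc _ ≤ ∑' v, ∑' v', ((ind (v ≠ u) * (S (v - u) * S (v - w))) * (S (v' - u) * S (v' - w)) +
        (S (v - u) * S (v - w)) * (ind (v' ≠ u) * (S (v' - u) * S (v' - w)))) := by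
        refine ENNReal.tsum_le_tsum fun v => ENNReal.tsum_le_tsum fun v' => ?_
        have h2 : ind (v ≠ v') ≤ ind (v ≠ u) + ind (v' ≠ u) := by
          refine le_trans (ind_mono fun h => ?_) ind_or_le
          by_contra hcon
          push Not at hcon
          exact h (hcon.1.trans hcon.2.symm)
        refine (mul_le_mul' h2 le_rfl).trans (le_of_eq ?_)
        ring
    _ = 2 * ((∑' v, ind (v ≠ u) * (S (v - u) * S (v - w))) * ∑' v, S (v - u) * S (v - w)) := by
        simp only [ENNReal.tsum_add]
        rw [← ENNReal.tsum_mul_tsum, ← ENNReal.tsum_mul_tsum]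
        ring
    _ ≤ _ := by
        rw [hconv]
        gcongr

include hΓ hc hε in
/-- The contribution of trees at `0` and at a neighbour `y` that share two points is of second
order. -/
theorem sum_meetTwice_le : c * ∑ y ∈ Λ, meetTwice Γ c y ≤ g * (2 * (ε * ε)) := by
  have hset : ∀ y v v' : V, ({v, v'} ∪ {y} : Set V) = {y, v, v'} := by
    intro y v v'
    rw [Set.union_comm]
    rfl
  calc c * ∑ y ∈ Λ, meetTwice Γ c y
      ≤ c * ∑ y ∈ Λ, ∑' v, ∑' v', ind (v ≠ v') * ((g * tripod S v v') *
          (g * tripod S (v - y) (v' - y))) := by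
        unfold meetTwice
        gcongr with y _ v v'
        · rw [hset]
          exact threePoint_le hΓ hc _ _
        · rw [hset, treeSum_triple hΓ]
          exact threePoint_le hΓ hc _ _
    _ = g * ∑' v, ∑' v', ind (v ≠ v') * (tripod S v v' *
          (c * g * ∑ y ∈ Λ, tripod S (v - y) (v' - y))) := by
        simp only [Finset.mul_sum, ← ENNReal.tsum_mul_left]
        rw [← Summable.tsum_finsetSum fun _ _ => ENNReal.summable]
        refine tsum_congr fun v => ?_
        rw [← Summable.tsum_finsetSum fun _ _ => ENNReal.summable]
        refine tsum_congr fun v' => Finset.sum_congr rfl fun y _ => ?_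
        ring
    _ = g * ∑' u, ∑' w, (S u * (D * S) w) * ∑' v, ∑' v', ind (v ≠ v') *
          ((S (v - u) * S (v' - u)) * (S (v - w) * S (v' - w))) := by
        congr 1
        simp only [sum_tripod hc]
        simp only [tripod, ENNReal.tsum_mul_tsum]
        simp only [← ENNReal.tsum_mul_left]
        calc _ = ∑' v, ∑' u, ∑' v', ∑' w, ind (v ≠ v') * (S u * (S (v - u) * S (v' - u)) *
              ((D * S) w * (S (v - w) * S (v' - w)))) := tsum_congr fun v => ENNReal.tsum_comm
          _ = ∑' u, ∑' v, ∑' v', ∑' w, ind (v ≠ v') * (S u * (S (v - u) * S (v' - u)) *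
              ((D * S) w * (S (v - w) * S (v' - w)))) := ENNReal.tsum_comm
          _ = ∑' u, ∑' v, ∑' w, ∑' v', ind (v ≠ v') * (S u * (S (v - u) * S (v' - u)) *
              ((D * S) w * (S (v - w) * S (v' - w)))) :=
              tsum_congr fun u => tsum_congr fun v => ENNReal.tsum_comm
          _ = ∑' u, ∑' w, ∑' v, ∑' v', ind (v ≠ v') * (S u * (S (v - u) * S (v' - u)) *
              ((D * S) w * (S (v - w) * S (v' - w)))) := tsum_congr fun u => ENNReal.tsum_comm
          _ = _ := by
              refine tsum_congr fun u => tsum_congr fun w => tsum_congr fun v =>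
                tsum_congr fun v' => ?_
              ring
    _ ≤ g * ∑' u, ∑' w, (S u * (D * S) w) * (2 * (ε * (S * S) (w - u))) := by
        gcongr with u w
        exact bubble_le hΓ hε u w
    _ = g * (2 * (ε * (D * S * S ^ 3) 0)) := by
        have h3 : IsSymm (S ^ 3) := (isSymm_green hΓ).pow 3
        rw [h3.mul_apply_zero, pow_succ' (green (unif Λ)) 2, pow_two]
        simp only [mul_apply (green (unif Λ)) (green (unif Λ) * green (unif Λ)),
          ← ENNReal.tsum_mul_left]
        rw [ENNReal.tsum_comm]
        refine tsum_congr fun w => tsum_congr fun u => ?_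
        ring
    _ ≤ g * (2 * (ε * ε)) := by
        gcongr
        refine diagram_le hε (le_of_eq ?_) 0
        ring

end FinTree

end


/-! ### Numerical expansions -/

noncomputable section

open scoped ENNReal

/-- `(1 + 1 / n) ^ n = e (1 - 1 / (2 n)) + O(1 / n ^ 2)`. -/
theorem one_add_inv_pow_bounds {n : ℕ} (hn : n ≠ 0) {δ : ℝ} (hδ : δ * n = 1) :
    Real.exp 1 * (1 - δ / 2) ≤ (1 + δ) ^ n ∧ (1 + δ) ^ n ≤ Real.exp 1 * (1 - δ / 2 + δ ^ 2) ∧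
      (1 + δ) ^ n ≤ Real.exp 1 := by
  have hn1 : (1 : ℝ) ≤ n := by exact_mod_cast Nat.one_le_iff_ne_zero.2 hn
  have hδ0 : 0 < δ := by
    by_contra h
    nlinarith
  have hδ1 : δ ≤ 1 := by nlinarith
  have hpow : (1 + δ) ^ n = Real.exp (n * Real.log (1 + δ)) := by
    rw [mul_comm, Real.exp_mul, Real.exp_log (by positivity), Real.rpow_natCast]
  have hlow : δ - δ ^ 2 / 2 ≤ Real.log (1 + δ) := by
    have := Real.le_log_one_add_of_nonneg hδ0.le
    refine le_trans ?_ this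
    rw [le_div_iff₀ (by positivity)]
    nlinarith [pow_pos hδ0 3]
  have hup : Real.log (1 + δ) ≤ δ - δ ^ 2 / 2 + δ ^ 3 / 2 := by
    rw [Real.log_le_iff_le_exp (by positivity)]
    have h0 : 0 ≤ δ - δ ^ 2 / 2 := by nlinarith
    have h3 : 0 < δ ^ 3 := by positivity
    have hu : (δ - δ ^ 2 / 2) ^ 2 ≤ (δ - δ ^ 2 / 2 + δ ^ 3 / 2) ^ 2 := by
      gcongr
      linarith
    have := Real.quadratic_le_exp_of_nonneg (x := δ - δ ^ 2 / 2 + δ ^ 3 / 2) (by linarith)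
    have h4 : 0 ≤ δ ^ 4 := by positivity
    linarith
  have hup' : Real.log (1 + δ) ≤ δ := by
    have := Real.log_le_sub_one_of_pos (x := 1 + δ) (by positivity)
    linarith
  have h1 : 1 - δ / 2 ≤ n * Real.log (1 + δ) := by nlinarith
  have h2 : n * Real.log (1 + δ) ≤ 1 - δ / 2 + δ ^ 2 / 2 := by
    have : (n : ℝ) * Real.log (1 + δ) ≤ n * (δ - δ ^ 2 / 2 + δ ^ 3 / 2) := by gcongr
    have h3 : (n : ℝ) * (δ - δ ^ 2 / 2 + δ ^ 3 / 2) = (δ * n) * (1 - δ / 2 + δ ^ 2 / 2) := by ring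
    rw [h3, hδ, one_mul] at this
    exact this
  have h3 : n * Real.log (1 + δ) ≤ 1 := by nlinarith
  have hsplit : (1 + δ) ^ n = Real.exp 1 * Real.exp (n * Real.log (1 + δ) - 1) := by
    rw [hpow, ← Real.exp_add]
    congr 1
    ring
  have hpos := Real.exp_pos 1
  set x := n * Real.log (1 + δ) - 1 with hx
  have hxabs : |x| ≤ 1 := by
    rw [abs_le]
    constructor <;> linarith
  refine ⟨?_, ?_, ?_⟩
  · rw [hsplit]
    gcongr
    have := Real.add_one_le_exp x
    linarith
  · rw [hsplit]
    gcongr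
    have h4 := Real.abs_exp_sub_one_sub_id_le hxabs
    have h5 := (abs_le.1 h4).2
    have h6 : x ^ 2 ≤ (δ / 2) ^ 2 := by
      rw [sq_le_sq, abs_of_pos (by positivity : 0 < δ / 2), abs_le]
      constructor <;> linarith
    nlinarith
  · rw [hpow]
    exact Real.exp_le_exp.2 h3

/-- Numerical conclusion of the expansion: all terms of second order in `ε` are collected. -/
theorem expansion_numeric {n : ℕ} (hn : n ≠ 0) {δ ε γ A Err s₁ s₂ a₁ f d : ℝ} (hδ : δ * n = 1)
    (hδε : δ ≤ ε) (hε1 : ε ≤ 1) (hup : γ ≤ (1 + δ) ^ n) (hlow : (1 + δ) ^ n * (1 - A) ≤ γ)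
    (hup' : γ ≤ (1 + δ) ^ n * (1 - A + A ^ 2 + Err)) (hErr : Err ≤ γ * (3 * ε ^ 2))
    (hA : A = a₁ / (1 + δ) + (f - d) / (2 * (1 + δ) ^ 2)) (ha0 : 0 ≤ a₁) (ha1 : a₁ ≤ s₁)
    (ha1' : s₁ ≤ a₁ + ε ^ 2) (hs₁ : s₁ ≤ ε) (hfd : 0 ≤ f - d) (hf : f ≤ s₂)
    (hf' : s₂ ≤ f + 2 * ε ^ 2) (hs₂ : s₂ ≤ ε) (hd : δ ≤ d) (hd' : d ≤ δ * (1 + 2 * ε)) :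
    |γ - Real.exp 1 * (1 - (s₁ + s₂ / 2))| ≤ 100 * ε ^ 2 := by
  obtain ⟨hr1, hr2, hr3⟩ := one_add_inv_pow_bounds hn hδ
  have hn1 : (1 : ℝ) ≤ n := by exact_mod_cast Nat.one_le_iff_ne_zero.2 hn
  have hδ0 : 0 < δ := by
    by_contra h
    nlinarith
  have hε0 : 0 < ε := hδ0.trans_le hδε
  have he : Real.exp 1 ≤ 3 := Real.exp_one_lt_three.le
  have hepos := Real.exp_pos 1
  set R := (1 + δ) ^ n with hR
  have hR0 : 0 < R := by positivity
  set B := s₁ + s₂ / 2 - δ / 2 with hB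
  have hAB : A ≤ B := by
    have h1 : a₁ / (1 + δ) ≤ a₁ := div_le_self ha0 (by linarith)
    have h2 : (f - d) / (2 * (1 + δ) ^ 2) ≤ (f - d) / 2 := by
      gcongr
      linarith [one_le_pow₀ (n := 2) (show 1 ≤ 1 + δ by linarith)]
    rw [hA, hB]
    linarith
  have hA0 : 0 ≤ A := by
    rw [hA]
    positivity
  have hδδ : δ ^ 2 ≤ ε ^ 2 := pow_le_pow_left₀ hδ0.le hδε 2
  have hBA : B - 5 * ε ^ 2 ≤ A := by
    have h1 : a₁ * (1 - δ) ≤ a₁ / (1 + δ) := by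
      rw [le_div_iff₀ (by positivity)]
      nlinarith [mul_nonneg ha0 (sq_nonneg δ)]
    have h2 : (f - d) / 2 * (1 - 2 * δ) ≤ (f - d) / (2 * (1 + δ) ^ 2) := by
      rw [le_div_iff₀ (by positivity)]
      have h3 : (1 - 2 * δ) * (1 + δ) ^ 2 ≤ 1 := by
        have : 0 ≤ 3 * δ ^ 2 + 2 * δ ^ 3 := by positivity
        linarith
      calc _ = (f - d) * ((1 - 2 * δ) * (1 + δ) ^ 2) := by ring
        _ ≤ f - d := mul_le_of_le_one_right hfd h3
    have h3 : a₁ * δ ≤ ε * ε := mul_le_mul (ha1.trans hs₁) hδε hδ0.le hε0.le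
    have h4 : (f - d) * δ ≤ ε * ε := mul_le_mul (by linarith) hδε hδ0.le hε0.le
    have h5 : δ * ε ≤ ε * ε := mul_le_mul_of_nonneg_right hδε hε0.le
    rw [hA, hB]
    linarith
  have hBle : B ≤ 3 / 2 * ε := by
    rw [hB]
    linarith
  have hA2 : A ^ 2 ≤ 9 / 4 * ε ^ 2 := by
    calc A ^ 2 ≤ (3 / 2 * ε) ^ 2 := pow_le_pow_left₀ hA0 (hAB.trans hBle) 2
      _ = _ := by ring
  have hγ3 : γ ≤ 3 := by linarith
  have hErr' : Err ≤ 9 * ε ^ 2 := by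
    calc Err ≤ γ * (3 * ε ^ 2) := hErr
      _ ≤ 3 * (3 * ε ^ 2) := by gcongr
      _ = _ := by ring
  have hB0 : -(1 / 2) * δ ≤ B := by
    rw [hB]
    have : 0 ≤ s₁ := ha0.trans ha1
    have : 0 ≤ s₂ := by linarith
    linarith
  have hRB : |R * (1 - B) - Real.exp 1 * (1 - (s₁ + s₂ / 2))| ≤ 9 * ε ^ 2 := by
    obtain ⟨τ, hτ⟩ : ∃ τ, R = Real.exp 1 * (1 - δ / 2 + τ) := ⟨R / Real.exp 1 - (1 - δ / 2), by
      field_simp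
      ring⟩
    have hτ0 : 0 ≤ τ := by
      rw [hτ] at hr1
      have := le_of_mul_le_mul_left hr1 hepos
      linarith
    have hτ1 : τ ≤ ε ^ 2 := by
      rw [hτ] at hr2
      have := le_of_mul_le_mul_left hr2 hepos
      linarith
    have h1 : R * (1 - B) - Real.exp 1 * (1 - (s₁ + s₂ / 2)) =
        Real.exp 1 * (δ / 2 * B + τ * (1 - B)) := by
      rw [hτ, hB]
      ring
    have h2 : |δ / 2 * B + τ * (1 - B)| ≤ 3 * ε ^ 2 := by
      have h3 : |B| ≤ 3 / 2 * ε := abs_le.2 ⟨by linarith, hBle⟩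
      have h4 : |1 - B| ≤ 3 / 2 := abs_le.2 ⟨by linarith, by linarith⟩
      calc |δ / 2 * B + τ * (1 - B)| ≤ |δ / 2 * B| + |τ * (1 - B)| := abs_add_le _ _
        _ = δ / 2 * |B| + τ * |1 - B| := by
            rw [abs_mul, abs_mul, abs_of_nonneg hτ0, abs_of_pos (by positivity : 0 < δ / 2)]
        _ ≤ ε / 2 * (3 / 2 * ε) + ε ^ 2 * (3 / 2) := by gcongr
        _ ≤ 3 * ε ^ 2 := by linarith [sq_nonneg ε]
    rw [h1, abs_mul, abs_of_pos hepos]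
    calc _ ≤ 3 * (3 * ε ^ 2) := by gcongr
      _ = _ := by ring
  have hRle : R ≤ 3 := hr3.trans he
  have hγ1 : R * (1 - B) ≤ γ := by
    refine le_trans ?_ hlow
    gcongr
  have hγ2 : γ ≤ R * (1 - B) + 60 * ε ^ 2 := by
    refine hup'.trans ?_
    have h1 : 1 - A + A ^ 2 + Err ≤ 1 - B + 20 * ε ^ 2 := by linarith [sq_nonneg ε]
    have h2 : R * (1 - A + A ^ 2 + Err) ≤ R * (1 - B + 20 * ε ^ 2) := by gcongr
    have h3 : R * (20 * ε ^ 2) ≤ 3 * (20 * ε ^ 2) := by gcongr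
    linarith
  rw [abs_le] at hRB ⊢
  have := sq_nonneg ε
  constructor <;> linarith [hRB.1, hRB.2]

end


/-! ### The 1-point function at the base point -/

noncomputable section

open scoped ENNReal

namespace FinTree

open SimpleGraph Conv

variable {V : Type*} [AddCommGroup V] {Γ : SimpleGraph V} {Λ : Finset V} {c : ℝ≥0∞}

local notation "g" => treeSum (Γ := Γ) (wt c ⊤) {0}

local notation "D" => unif Λ

local notation "S" => green (unif Λ)

local notation "G" => twoPoint Γ c ⊤

local notation "E" => meetTwo Γ Λ c

variable (hΓ : Γ.IsHomogeneous Λ)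
  (hc : c * treeSum (Γ := Γ) (wt c ⊤) {0} * (Λ.card : ℝ≥0∞) = 1)
  {ε : ℝ≥0∞} (hε : ∀ x, (unif Λ * green (unif Λ) ^ 4) x ≤ ε)

include hΓ hc in
/-- To first order, the tree attached at a neighbour `y` returns to `0` with the return probability
of the random walk. -/
theorem sum_twoPoint_le : c * ∑ y ∈ Λ, G y ≤ (D * S) 0 := by
  rw [← mul_sum_eq_zero hΓ hc, mul_assoc, Finset.mul_sum (a := g)]
  gcongr with y
  exact twoPoint_le hΓ hc y

include hΓ hc hε in
/-- The lower bound that complements `sum_twoPoint_le`. -/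
theorem le_sum_twoPoint : (D * S) 0 ≤ c * ∑ y ∈ Λ, G y + ε * ε := by
  calc (D * S) 0 = c * ∑ y ∈ Λ, (g • S) y := by
        rw [← mul_sum_eq_zero hΓ hc, mul_assoc, Finset.mul_sum (a := g)]
        rfl
    _ ≤ c * ∑ y ∈ Λ, (G y + (S * (g • (loop Λ * S))) y) := by
        gcongr with y
        refine (green_le hΓ hc y).trans ?_
        exact add_le le_rfl (mul_le le_rfl (meetTwo_le hΓ hc)) y
    _ = c * ∑ y ∈ Λ, G y + (loop Λ * (D * S ^ 2)) 0 := by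
        rw [Finset.sum_add_distrib, mul_add]
        congr 1
        rw [mul_smul']
        simp only [Conv.smul_apply]
        rw [← Finset.mul_sum, ← mul_assoc, mul_sum_eq_zero hΓ hc]
        congr 1
        ring
    _ ≤ _ := add_le_add le_rfl (loop_mul_le hΓ hε (mul_pow_green_le (by omega)) 0)

include hΓ hc in
theorem double_sum_eq (f : Conv V) :
    (c * g) ^ 2 * ∑ y ∈ Λ, ∑ y' ∈ Λ, f (y - y') = (D * D * f) 0 := by
  rw [mul_assoc D D f, ← mul_sum_eq_zero hΓ hc, pow_two, mul_assoc]
  congr 1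
  rw [Finset.mul_sum]
  exact Finset.sum_congr rfl fun y _ => mul_sum_eq hc f y

include hΓ hc in
/-- To first order, the trees attached at two neighbours `y` and `y'` intersect as often as two
random walk paths. -/
theorem double_sum_le :
    c ^ 2 * ∑ y ∈ Λ, ∑ y' ∈ Λ, (G * G) (y - y') ≤ (D * D * S ^ 2) 0 := by
  rw [← double_sum_eq hΓ hc, mul_pow, mul_assoc]
  gcongr
  simp only [Finset.mul_sum]
  gcongr with y _ y'
  refine (mul_le (twoPoint_le hΓ hc) (twoPoint_le hΓ hc) (y - y')).trans (le_of_eq ?_)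
  rw [smul_mul, mul_smul', Conv.smul_apply, Conv.smul_apply, pow_two, pow_two, mul_assoc]

include hΓ hc hε in
/-- The lower bound that complements `double_sum_le`. -/
theorem le_double_sum :
    (D * D * S ^ 2) 0 ≤ c ^ 2 * ∑ y ∈ Λ, ∑ y' ∈ Λ, (G * G) (y - y') + 2 * (ε * ε) := by
  have hgS : (g • S) * (g • S) ≤ G * G + (2 * g ^ 2) • (loop Λ * S ^ 3) := by
    have h1 : g • S ≤ G + S * (g • (loop Λ * S)) :=
      (green_le hΓ hc).trans (add_le le_rfl (mul_le le_rfl (meetTwo_le hΓ hc)))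
    have h2 : S * (g • (loop Λ * S)) * (g • S) = g ^ 2 • (loop Λ * S ^ 3) := by
      rw [mul_smul', mul_smul', smul_mul]
      ext x
      simp only [Conv.smul_apply]
      rw [← mul_assoc, ← pow_two]
      congr 2
      ring
    calc (g • S) * (g • S) ≤ (g • S) * (G + S * (g • (loop Λ * S))) := mul_le le_rfl h1
      _ = (g • S) * G + S * (g • (loop Λ * S)) * (g • S) := by ring
      _ ≤ (G + S * (g • (loop Λ * S))) * G + S * (g • (loop Λ * S)) * (g • S) :=
          add_le (mul_le h1 le_rfl) le_rfl
      _ = G * G + (S * (g • (loop Λ * S)) * G + S * (g • (loop Λ * S)) * (g • S)) := by ring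
      _ ≤ G * G + (S * (g • (loop Λ * S)) * (g • S) + S * (g • (loop Λ * S)) * (g • S)) :=
          add_le le_rfl (add_le (mul_le le_rfl (twoPoint_le hΓ hc)) le_rfl)
      _ = _ := by
          rw [h2]
          ext x
          simp only [Conv.add_apply, Conv.smul_apply]
          ring
  have h3 : (D * D * (loop Λ * S ^ 3)) 0 ≤ ε * ε := by
    calc (D * D * (loop Λ * S ^ 3)) 0 = (loop Λ * (D * D * S ^ 2 * S)) 0 := by
          congr 1
          ring
      _ ≤ _ := loop_mul_le hΓ hε (mul_mul_pow_green_le (by omega)) 0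
  calc (D * D * S ^ 2) 0 = c ^ 2 * ∑ y ∈ Λ, ∑ y' ∈ Λ, ((g • S) * (g • S)) (y - y') := by
        rw [← double_sum_eq hΓ hc, mul_pow, mul_assoc]
        congr 1
        simp only [Finset.mul_sum]
        refine Finset.sum_congr rfl fun y _ => Finset.sum_congr rfl fun y' _ => ?_
        rw [smul_mul, mul_smul', Conv.smul_apply, Conv.smul_apply, pow_two, pow_two, mul_assoc]
    _ ≤ c ^ 2 * ∑ y ∈ Λ, ∑ y' ∈ Λ, ((G * G) (y - y') +
          2 * g ^ 2 * (loop Λ * S ^ 3) (y - y')) := by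
        gcongr with y _ y'
        exact hgS (y - y')
    _ = c ^ 2 * ∑ y ∈ Λ, ∑ y' ∈ Λ, (G * G) (y - y') + 2 * (D * D * (loop Λ * S ^ 3)) 0 := by
        rw [← double_sum_eq hΓ hc]
        simp only [Finset.sum_add_distrib, ← Finset.mul_sum]
        ring
    _ ≤ _ := by gcongr

include hc in
/-- The diagonal terms `y = y'` of the double sum add up to `c * g = 1 / |Λ|`, to first order. -/
theorem le_diagonal : c * g ≤ (Λ.card : ℝ≥0∞) * (c ^ 2 * (G * G) 0) := by
  calc c * g = c * g * (c * g * Λ.card) := by rw [hc, mul_one]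
    _ = Λ.card * (c ^ 2 * (g * g)) := by ring
    _ ≤ _ := by
        gcongr
        rw [mul_apply]
        refine le_trans (le_of_eq ?_) (ENNReal.le_tsum 0)
        rw [sub_zero, twoPoint_zero]

theorem green_mul_green : S * S = 1 + (D * S ^ 1 + D * S ^ 2) := by
  calc S * S = (1 + D * S) * S := by rw [← green_eq]
    _ = S + D * S ^ 2 := by ring
    _ = 1 + D * S + D * S ^ 2 := by rw [← green_eq]
    _ = _ := by ring

include hΓ hc hε in
/-- The upper bound that complements `le_diagonal`. -/
theorem diagonal_le : (Λ.card : ℝ≥0∞) * (c ^ 2 * (G * G) 0) ≤ c * g * (1 + 2 * ε) := by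
  calc Λ.card * (c ^ 2 * (G * G) 0) ≤ Λ.card * (c ^ 2 * ((g • S) * (g • S)) 0) := by
        gcongr
        exact mul_le (twoPoint_le hΓ hc) (twoPoint_le hΓ hc) 0
    _ = c * g * Λ.card * (c * g * (S * S) 0) := by
        rw [smul_mul, mul_smul', Conv.smul_apply, Conv.smul_apply]
        ring
    _ = c * g * (1 + ((D * S ^ 1) 0 + (D * S ^ 2) 0)) := by
        rw [hc, one_mul]
        congr 1
        rw [green_mul_green, Conv.add_apply, Conv.add_apply, one_apply_zero]
    _ ≤ _ := by
        rw [two_mul]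
        gcongr
        · exact diagram_le hε (mul_pow_green_le (by omega)) 0
        · exact diagram_le hε (mul_pow_green_le (by omega)) 0

include hc hε in
/-- The value `c * g = 1 / |Λ|` of the step distribution is itself small. -/
theorem mul_le_of_diagram : c * g ≤ ε := by
  obtain ⟨y, hy⟩ : Λ.Nonempty := Finset.card_pos.1 (Nat.pos_of_ne_zero (card_ne_zero hc))
  have h1 : D y ≤ ε := by
    refine diagram_le hε ?_ y
    conv_lhs => rw [← mul_one (unif Λ), ← pow_zero (green (unif Λ))]
    exact mul_pow_green_le (by omega)
  rw [unif_apply, ind_of_true hy, one_mul] at h1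
  refine le_trans (le_of_eq ?_) h1
  exact ENNReal.eq_inv_of_mul_eq_one_left hc

/-- The expansion of the 1-point function at the base point, on an arbitrary homogeneous graph whose
random walk has a uniformly small four-fold bubble. -/
theorem onePoint_expansion {e : ℝ} (he0 : 0 ≤ e) (he1 : e ≤ 1)
    (he : ∀ x, (unif Λ * green (unif Λ) ^ 4) x ≤ ENNReal.ofReal e) (hΓ : Γ.IsHomogeneous Λ)
    (hc : c * treeSum (Γ := Γ) (wt c ⊤) {0} * (Λ.card : ℝ≥0∞) = 1) :
    |(treeSum (Γ := Γ) (wt c ⊤) {0}).toReal - Real.exp 1 * (1 - (((D * S) 0).toReal +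
      ((D * D * S ^ 2) 0).toReal / 2))| ≤ 100 * e ^ 2 := by
  classical
  have hΛ := card_ne_zero hc
  have hcg : c * g ≠ ⊤ := by
    intro h
    rw [h, ENNReal.top_mul (by exact_mod_cast hΛ)] at hc
    exact ENNReal.top_ne_one hc
  have hcg0 : c * g ≠ 0 := by
    intro h
    rw [h, zero_mul] at hc
    exact zero_ne_one hc
  have hc0 : c ≠ 0 := left_ne_zero_of_mul hcg0
  have hg0 : g ≠ 0 := right_ne_zero_of_mul hcg0
  have hgt : g ≠ ⊤ := fun h => hcg (ENNReal.mul_eq_top.2 (.inl ⟨hc0, h⟩))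
  have hct : c ≠ ⊤ := fun h => hcg (ENNReal.mul_eq_top.2 (.inr ⟨h, hg0⟩))
  have hεt : ENNReal.ofReal e ≠ ⊤ := ENNReal.ofReal_ne_top
  have hGt : ∀ x, G x ≠ ⊤ := fun x => ne_top_of_le_ne_top hgt
    (treeSum_anti (Set.singleton_subset_iff.2 (Set.mem_insert _ _)))
  have hs₁ : (D * S) 0 ≤ ENNReal.ofReal e := by
    conv_lhs => rw [← pow_one (green (unif Λ))]
    exact diagram_le he (mul_pow_green_le (by omega)) 0
  have hs₂ : (D * D * S ^ 2) 0 ≤ ENNReal.ofReal e :=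
    diagram_le he ((le_mul_green _).trans (mul_mul_pow_green_le (by omega))) 0
  have hs₁t := ne_top_of_le_ne_top hεt hs₁
  have hs₂t := ne_top_of_le_ne_top hεt hs₂
  have hGG : ∀ x, c ^ 2 * (G * G) x ≠ ⊤ := by
    intro x
    refine ENNReal.mul_ne_top (ENNReal.pow_ne_top hct) (ne_top_of_le_ne_top ?_
      (mul_le (twoPoint_le hΓ hc) (twoPoint_le hΓ hc) x))
    rw [smul_mul, mul_smul', Conv.smul_apply, Conv.smul_apply, green_mul_green]
    refine ENNReal.mul_ne_top hgt (ENNReal.mul_ne_top hgt (ENNReal.add_ne_top.2 ⟨?_,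
      ENNReal.add_ne_top.2 ⟨ne_top_of_le_ne_top hεt (diagram_le he (mul_pow_green_le (by omega)) x),
        ne_top_of_le_ne_top hεt (diagram_le he (mul_pow_green_le (by omega)) x)⟩⟩))
    rw [one_def, single_apply]
    split_ifs <;> simp
  have hfull : c ^ 2 * ∑ y ∈ Λ, ∑ y' ∈ Λ, (G * G) (y - y') ≠ ⊤ :=
    ne_top_of_le_ne_top hs₂t (double_sum_le hΓ hc)
  have hat : ∀ Y, rootTwo Γ c Y 0 ≠ ⊤ := fun Y => ne_top_of_le_ne_top hgt (rootTwo_zero_le Y)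
  have herr : ∑ y ∈ Λ, c * (meetTwice Γ c y + (E * G) y) ≤
      g * (3 * (ENNReal.ofReal e * ENNReal.ofReal e)) := by
    rw [← Finset.mul_sum, Finset.sum_add_distrib, mul_add]
    refine (add_le_add (sum_meetTwice_le hΓ hc he) (sum_meetTwo_mul_le hΓ hc he)).trans
      (le_of_eq ?_)
    ring
  have herrt : g * (3 * (ENNReal.ofReal e * ENNReal.ofReal e)) ≠ ⊤ :=
    ENNReal.mul_ne_top hgt (ENNReal.mul_ne_top (by simp) (ENNReal.mul_ne_top hεt hεt))
  have herry : ∀ y ∈ Λ, c * (meetTwice Γ c y + (E * G) y) ≠ ⊤ := fun y hy =>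
    ne_top_of_le_ne_top herrt ((Finset.single_le_sum
      (f := fun y => c * (meetTwice Γ c y + (E * G) y)) (fun _ _ => zero_le) hy).trans herr)
  have hGc : ∀ y, c * G y ≠ ⊤ := fun y => ENNReal.mul_ne_top hct (hGt y)
  have hmt : ∀ Y ⊆ Λ, ∀ y, c * rootMeet Γ c Y y ≠ ⊤ := fun Y hY y =>
    ne_top_of_le_ne_top (ENNReal.add_ne_top.2 ⟨ENNReal.mul_ne_top (hat _) (hGc y),
      ENNReal.sum_ne_top.2 fun y' _ => ENNReal.mul_ne_top (hat _) (hGG _)⟩) (rootMeet_le hΓ hY y)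
  have hsumReal : ∀ Y y, (rootTwo Γ c Y 0 * (c * G y) +
      ∑ y' ∈ Y, rootTwo Γ c (Y.erase y') 0 * (c ^ 2 * (G * G) (y - y'))).toReal =
      (rootTwo Γ c Y 0).toReal * (c * G y).toReal + ∑ y' ∈ Y, (rootTwo Γ c (Y.erase y') 0).toReal *
        (c ^ 2 * (G * G) (y - y')).toReal := by
    intro Y y
    rw [ENNReal.toReal_add (ENNReal.mul_ne_top (hat _) (hGc y)) (ENNReal.sum_ne_top.2 fun y' _ =>
      ENNReal.mul_ne_top (hat _) (hGG _)), ENNReal.toReal_mul, ENNReal.toReal_sum fun y' _ =>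
      ENNReal.mul_ne_top (hat _) (hGG _)]
    simp only [ENNReal.toReal_mul]
  have hsumt : ∀ Y y, (rootTwo Γ c Y 0 * (c * G y) +
      ∑ y' ∈ Y, rootTwo Γ c (Y.erase y') 0 * (c ^ 2 * (G * G) (y - y'))) ≠ ⊤ := fun Y y =>
    ENNReal.add_ne_top.2 ⟨ENNReal.mul_ne_top (hat _) (hGc y), ENNReal.sum_ne_top.2 fun y' _ =>
      ENNReal.mul_ne_top (hat _) (hGG _)⟩
  set δ := (c * g).toReal with hδ
  have hδn : δ * (Λ.card : ℝ) = 1 := by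
    have := congrArg ENNReal.toReal hc
    rwa [ENNReal.toReal_mul, ENNReal.toReal_natCast, ENNReal.toReal_one] at this
  have hδ0 : 0 ≤ δ := ENNReal.toReal_nonneg
  have hone : ENNReal.toReal (1 + c * g) = 1 + δ := by
    rw [ENNReal.toReal_add ENNReal.one_ne_top hcg, ENNReal.toReal_one]
  have hGGsymm : IsSymm (G * G) :=
    IsSymm.mul (fun x => twoPoint_neg hΓ ⊤ x) (fun x => twoPoint_neg hΓ ⊤ x)
  -- all quantities are finite, so the recursion in the set of neighbours can be read in `ℝ`
  obtain ⟨h1, h2, h3⟩ := expansion_of_recursion (Λ := Λ) (r := 1 + δ) (by linarith)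
    (a := fun Y => (rootTwo Γ c Y 0).toReal) (J := fun Y y => (c * rootMeet Γ c Y y).toReal)
    (b := fun y => (c * G y).toReal) (k := fun y y' => (c ^ 2 * (G * G) (y - y')).toReal)
    (err := fun y => (c * (meetTwice Γ c y + (E * G) y)).toReal)
    (fun _ => ENNReal.toReal_nonneg) (fun _ _ => ENNReal.toReal_nonneg)
    (fun y y' => by rw [← neg_sub, hGGsymm]) (fun _ => ENNReal.toReal_nonneg)
    (fun _ _ => ENNReal.toReal_nonneg) (by rw [rootTwo_zero, treeSum_rootWt_empty]; rfl)
    (fun Y hY y hy hyY => by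
      rw [← ENNReal.toReal_add (hat _) (hmt Y hY y), rootTwo_insert hΓ hy hyY, ENNReal.toReal_mul,
        hone])
    (fun Y hY y _ => by
      rw [← hsumReal]
      exact ENNReal.toReal_mono (hsumt Y y) (rootMeet_le hΓ hY y))
    (fun Y hY y hy => by
      rw [← hsumReal, ← ENNReal.toReal_add (hmt Y hY y) (herry y hy)]
      exact ENNReal.toReal_mono (ENNReal.add_ne_top.2 ⟨hmt Y hY y, herry y hy⟩)
        (le_rootMeet hΓ hY y)) rfl
  have haΛ : rootTwo Γ c Λ 0 = g := by
    rw [rootTwo_zero, rootWt_univ hΓ]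
  rw [haΛ] at h1 h2 h3
  have hpairs : ∑ y ∈ Λ, ∑ y' ∈ Λ.erase y, (c ^ 2 * (G * G) (y - y')).toReal =
      (c ^ 2 * ∑ y ∈ Λ, ∑ y' ∈ Λ, (G * G) (y - y')).toReal -
        ((Λ.card : ℝ≥0∞) * (c ^ 2 * (G * G) 0)).toReal := by
    rw [eq_sub_iff_add_eq, ENNReal.toReal_mul (a := (Λ.card : ℝ≥0∞)), ENNReal.toReal_natCast]
    simp only [Finset.mul_sum]
    rw [ENNReal.toReal_sum fun y _ => ENNReal.sum_ne_top.2 fun y' _ => hGG _, ← nsmul_eq_mul,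
      ← Finset.sum_const, ← Finset.sum_add_distrib]
    refine Finset.sum_congr rfl fun y hy => ?_
    rw [ENNReal.toReal_sum fun y' _ => hGG _, ← Finset.sum_erase_add _ _ hy, sub_self]
  have hlin : ∑ y ∈ Λ, (c * G y).toReal = (c * ∑ y ∈ Λ, G y).toReal := by
    rw [Finset.mul_sum, ENNReal.toReal_sum fun y _ => hGc y]
  have hsumG : c * ∑ y ∈ Λ, G y ≠ ⊤ := ne_top_of_le_ne_top hs₁t (sum_twoPoint_le hΓ hc)
  have hee : ENNReal.ofReal e * ENNReal.ofReal e = ENNReal.ofReal (e ^ 2) := by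
    rw [← ENNReal.ofReal_mul he0, pow_two]
  have hdt : (Λ.card : ℝ≥0∞) * (c ^ 2 * (G * G) 0) ≠ ⊤ :=
    ENNReal.mul_ne_top (ENNReal.natCast_ne_top _) (hGG 0)
  refine expansion_numeric hΛ hδn ?_ he1 h1 h2 h3 ?_ (by rw [hpairs, hlin]) ENNReal.toReal_nonneg
    (ENNReal.toReal_mono hs₁t (sum_twoPoint_le hΓ hc)) ?_ ?_ ?_
    (ENNReal.toReal_mono hs₂t (double_sum_le hΓ hc)) ?_ ?_
    (ENNReal.toReal_mono hdt (le_diagonal hc)) ?_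
  · exact ENNReal.toReal_le_of_le_ofReal he0 (mul_le_of_diagram hc he)
  · rw [← ENNReal.toReal_sum herry]
    refine (ENNReal.toReal_mono herrt herr).trans (le_of_eq ?_)
    rw [ENNReal.toReal_mul, hee, ENNReal.toReal_mul, ENNReal.toReal_ofReal (by positivity)]
    simp
  · have := le_sum_twoPoint hΓ hc he
    rw [hee] at this
    refine (ENNReal.toReal_mono (ENNReal.add_ne_top.2 ⟨hsumG, ENNReal.ofReal_ne_top⟩) this).trans
      (le_of_eq ?_)
    rw [ENNReal.toReal_add hsumG ENNReal.ofReal_ne_top, ENNReal.toReal_ofReal (by positivity)]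
  · exact ENNReal.toReal_le_of_le_ofReal he0 hs₁
  · rw [← hpairs]
    exact Finset.sum_nonneg fun _ _ => Finset.sum_nonneg fun _ _ => ENNReal.toReal_nonneg
  · have := le_double_sum hΓ hc he
    rw [hee] at this
    have h2t : (2 : ℝ≥0∞) * ENNReal.ofReal (e ^ 2) ≠ ⊤ :=
      ENNReal.mul_ne_top (by simp) ENNReal.ofReal_ne_top
    refine (ENNReal.toReal_mono (ENNReal.add_ne_top.2 ⟨hfull, h2t⟩) this).trans (le_of_eq ?_)
    rw [ENNReal.toReal_add hfull h2t, ENNReal.toReal_mul (a := (2 : ℝ≥0∞)),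
      ENNReal.toReal_ofReal (by positivity)]
    simp
  · exact ENNReal.toReal_le_of_le_ofReal he0 hs₂
  · have h2t : (1 : ℝ≥0∞) + 2 * ENNReal.ofReal e ≠ ⊤ :=
      ENNReal.add_ne_top.2 ⟨ENNReal.one_ne_top, ENNReal.mul_ne_top (by simp) hεt⟩
    refine (ENNReal.toReal_mono (ENNReal.mul_ne_top hcg h2t) (diagonal_le hΓ hc he)).trans
      (le_of_eq ?_)
    rw [ENNReal.toReal_mul, ENNReal.toReal_add ENNReal.one_ne_top
      (ENNReal.mul_ne_top (by simp) hεt), ENNReal.toReal_mul (a := (2 : ℝ≥0∞)),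
      ENNReal.toReal_ofReal he0]
    simp [hδ]

end FinTree

end


/-! ### Existence and uniqueness of the base point -/

noncomputable section

open scoped ENNReal

namespace FinTree

open SimpleGraph Conv

variable {V : Type*} [AddCommGroup V] {Γ : SimpleGraph V} {Λ : Finset V} {c : ℝ≥0∞}

theorem one_le_treeSum (c : ℝ≥0∞) : 1 ≤ treeSum (Γ := Γ) (wt c ⊤) {0} := by
  rw [← treeSum_rootWt_empty (Γ := Γ) c]
  exact treeSum_mono (rootWt_le _ _)

omit [AddCommGroup V] in
theorem treeSum_wt_mono {c c' : ℝ≥0∞} (h : c ≤ c') (m : ℕ∞) (A : Set V) :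
    treeSum (Γ := Γ) (wt c m) A ≤ treeSum (Γ := Γ) (wt c' m) A :=
  treeSum_mono fun _ => mul_le_mul' le_rfl (pow_le_pow_left' h _)

/-- The neighbours of the origin carry essentially independent subtrees. -/
theorem treeSum_wt_succ_le (hΓ : Γ.IsHomogeneous Λ) (c : ℝ≥0∞) (m : ℕ) :
    treeSum (Γ := Γ) (wt c (m + 1 : ℕ)) {0} ≤
      (1 + c * treeSum (Γ := Γ) (wt c m) {0}) ^ Λ.card := by
  classical
  have key : ∀ Y ⊆ Λ, treeSum (Γ := Γ) (rootWt (wt c (m + 1 : ℕ)) Y) {0} ≤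
      (1 + c * treeSum (Γ := Γ) (wt c m) {0}) ^ Y.card := by
    intro Y
    induction Y using Finset.induction_on with
    | empty =>
      intro _
      rw [Finset.card_empty, pow_zero, ← treeSum_rootWt_empty (Γ := Γ) c]
      exact treeSum_mono fun T => mul_le_mul' le_rfl (wt_mono c le_top T)
    | insert y Y hy ih =>
      intro hY
      rw [Finset.card_insert_of_notMem hy, pow_succ]
      refine (treeSum_rootWt_insert_le hΓ c m (hY (Finset.mem_insert_self y Y)) hy).trans ?_
      rw [treeSum_single hΓ]
      exact mul_le_mul' (ih ((Finset.subset_insert y Y).trans hY)) le_rfl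
  rw [← rootWt_univ hΓ (wt c (m + 1 : ℕ))]
  exact key Λ subset_rfl

/-- The mass of the 2-point function counts every tree with the number of its vertices. -/
theorem mass_twoPoint (c : ℝ≥0∞) (m : ℕ∞) : mass (twoPoint Γ c m) =
    ∑' T : FinTree Γ, (T.1.edgeSet.ncard + 1 : ℕ) *
      (ind (({0} : Set V) ⊆ T.1.verts) * wt c m T) := by
  simp only [mass, twoPoint_apply, treeSum]
  rw [ENNReal.tsum_comm]
  refine tsum_congr fun T => ?_
  have hcard : ∑' x, ind (x ∈ T.1.verts) = T.1.verts.ncard := by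
    have h := tsum_ind_mul T.2.1.toFinset fun _ => 1
    simp only [Set.Finite.mem_toFinset, mul_one, Finset.sum_const, nsmul_eq_mul] at h
    rw [h, Set.ncard_eq_toFinset_card _ T.2.1]
  rw [← ncard_verts, ← hcard, ← ENNReal.tsum_mul_right]
  refine tsum_congr fun x => ?_
  rw [Set.insert_eq, Set.union_comm, ← Set.insert_eq, Set.insert_subset_iff, ind_and, mul_assoc]

/-- The susceptibility of the truncated trees satisfies a recursion with the factor `c * g * |Λ|`.
-/
theorem mass_twoPoint_succ_le (hΓ : Γ.IsHomogeneous Λ) (c : ℝ≥0∞) (m : ℕ) :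
    mass (twoPoint Γ c (m + 1 : ℕ)) ≤ treeSum (Γ := Γ) (wt c (m + 1 : ℕ)) {0} +
      c * treeSum (Γ := Γ) (wt c m) {0} * Λ.card * mass (twoPoint Γ c m) := by
  have h : ∀ x, twoPoint Γ c (m + 1 : ℕ) x ≤
      (1 : Conv V) x * treeSum (Γ := Γ) (wt c (m + 1 : ℕ)) {0} +
        ∑ y ∈ Λ, c * treeSum (Γ := Γ) (wt c m) {0} * twoPoint Γ c m (x - y) := by
    intro x
    by_cases hx : x = 0
    · rw [hx, one_apply_zero, one_mul, twoPoint_zero]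
      exact le_self_add
    · refine (treeSum_wt_pair_le hΓ c m hx).trans (le_trans (le_of_eq ?_) le_add_self)
      refine Finset.sum_congr rfl fun y _ => ?_
      rw [treeSum_pair' hΓ, mul_assoc]
  refine (ENNReal.tsum_le_tsum h).trans (le_of_eq ?_)
  rw [ENNReal.tsum_add, ENNReal.tsum_mul_right, ← mass, mass_one, one_mul,
    Summable.tsum_finsetSum fun _ _ => ENNReal.summable]
  congr 1
  have h2 : ∀ y : V, ∑' x, c * treeSum (Γ := Γ) (wt c m) {0} * twoPoint Γ c m (x - y) =
      c * treeSum (Γ := Γ) (wt c m) {0} * mass (twoPoint Γ c m) := fun y => by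
    rw [ENNReal.tsum_mul_left]
    exact congrArg _ ((Equiv.subRight y).tsum_eq fun x => twoPoint Γ c m x)
  simp only [h2, Finset.sum_const, nsmul_eq_mul]
  ring

/-- The mean value bound for the powers. -/
theorem add_pow_succ_le (p δ : ℝ≥0∞) (k : ℕ) :
    (p + δ) ^ (k + 1) ≤ p ^ (k + 1) + δ * ((k + 1 : ℕ) * (p + δ) ^ k) := by
  induction k with
  | zero => simp
  | succ k ih =>
    calc (p + δ) ^ (k + 1 + 1) = p * (p + δ) ^ (k + 1) + δ * (p + δ) ^ (k + 1) := by ring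
      _ ≤ p * (p ^ (k + 1) + δ * ((k + 1 : ℕ) * (p + δ) ^ k)) + δ * (p + δ) ^ (k + 1) := by gcongr
      _ = p ^ (k + 1 + 1) + (δ * ((k + 1 : ℕ) * (p * (p + δ) ^ k)) + δ * (p + δ) ^ (k + 1)) := by
        ring
      _ ≤ p ^ (k + 1 + 1) + (δ * ((k + 1 : ℕ) * ((p + δ) * (p + δ) ^ k)) +
            δ * (p + δ) ^ (k + 1)) := by
        gcongr
        exact le_self_add
      _ = _ := by
        push_cast
        ring

/-- The derivative of `c * g_c` is the mass of the 2-point function, which bounds its increments. -/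
theorem add_mul_treeSum_le (p δ : ℝ≥0∞) (m : ℕ∞) :
    (p + δ) * treeSum (Γ := Γ) (wt (p + δ) m) {0} ≤
      p * treeSum (Γ := Γ) (wt p m) {0} + δ * mass (twoPoint Γ (p + δ) m) := by
  rw [mass_twoPoint, treeSum, treeSum, ← ENNReal.tsum_mul_left, ← ENNReal.tsum_mul_left,
    ← ENNReal.tsum_mul_left, ← ENNReal.tsum_add]
  refine ENNReal.tsum_le_tsum fun T => ?_
  simp only [wt]
  calc _ = (ind (({0} : Set V) ⊆ T.1.verts) * ind ((T.1.verts.ncard : ℕ∞) ≤ m)) *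
        (p + δ) ^ (T.1.edgeSet.ncard + 1) := by ring
    _ ≤ _ := mul_le_mul' le_rfl (add_pow_succ_le p δ _)
    _ = _ := by ring

/-- As long as `c * g_c * |Λ| < 1`, the parameter `c` can be increased. -/
theorem exists_gt_of_lt (hΓ : Γ.IsHomogeneous Λ) (hΛ : Λ.card ≠ 0) {p : ℝ≥0∞} (hp : p ≠ ⊤)
    (h : p * treeSum (Γ := Γ) (wt p ⊤) {0} * (Λ.card : ℝ≥0∞) < 1) :
    ∃ q, p < q ∧ q * treeSum (Γ := Γ) (wt q ⊤) {0} * (Λ.card : ℝ≥0∞) ≤ 1 := by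
  obtain ⟨β, hβ, hβ1⟩ := exists_between h
  set n : ℝ≥0∞ := (Λ.card : ℝ≥0∞) with hn
  have hn1 : 1 ≤ n := by
    rw [hn]
    exact_mod_cast Nat.one_le_iff_ne_zero.2 hΛ
  have hnt : n ≠ ⊤ := ENNReal.natCast_ne_top _
  have hβt : β ≠ ⊤ := (hβ1.trans ENNReal.one_lt_top).ne
  set M : ℝ≥0∞ := 2 ^ Λ.card with hM
  have hMt : M ≠ ⊤ := ENNReal.pow_ne_top (by simp)
  have hM0 : M ≠ 0 := pow_ne_zero _ (by simp)
  have hβ0 : 1 - β ≠ 0 := (tsub_pos_of_lt hβ1).ne'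
  have hβ't : 1 - β ≠ ⊤ := ENNReal.sub_ne_top ENNReal.one_ne_top
  -- `M` bounds the 1-point function and `X` the susceptibility, as long as `c * g * |Λ| ≤ β`
  set X : ℝ≥0∞ := M / (1 - β) with hX
  have hXt : X ≠ ⊤ := ENNReal.div_ne_top hMt hβ0
  have hX0 : X ≠ 0 := ENNReal.div_ne_zero.2 ⟨hM0, hβ't⟩
  have hMX : M + β * X = X := by
    have h1 : (1 - β) * X = M := ENNReal.mul_div_cancel hβ0 hβ't
    calc M + β * X = (1 - β + β) * X := by rw [add_mul, h1]
      _ = X := by rw [tsub_add_cancel_of_le hβ1.le, one_mul]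
  have hnX0 : n * X ≠ 0 := mul_ne_zero (by positivity) hX0
  have hnXt : n * X ≠ ⊤ := ENNReal.mul_ne_top hnt hXt
  set δ := (β - p * treeSum (Γ := Γ) (wt p ⊤) {0} * n) / (n * X) with hδ
  have hδ0 : δ ≠ 0 := ENNReal.div_ne_zero.2 ⟨(tsub_pos_of_lt hβ).ne', hnXt⟩
  have hδX : p * treeSum (Γ := Γ) (wt p ⊤) {0} * n + δ * (n * X) = β := by
    rw [hδ, ENNReal.div_mul_cancel hnX0 hnXt, add_tsub_cancel_of_le hβ.le]
  refine ⟨p + δ, ENNReal.lt_add_right hp hδ0, ?_⟩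
  have key : ∀ m : ℕ, (p + δ) * treeSum (Γ := Γ) (wt (p + δ) m) {0} * n ≤ β ∧
      mass (twoPoint Γ (p + δ) m) ≤ X := by
    intro m
    induction m with
    | zero =>
      rw [treeSum_wt_zero]
      refine ⟨by simp, ?_⟩
      refine le_trans (le_of_eq ?_) zero_le
      rw [mass, ENNReal.tsum_eq_zero]
      exact fun x => treeSum_wt_zero _
    | succ m ih =>
      have hle : (p + δ) * treeSum (Γ := Γ) (wt (p + δ) m) {0} ≤ 1 :=
        (le_mul_of_one_le_right zero_le hn1).trans (ih.1.trans hβ1.le)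
      have h2 : mass (twoPoint Γ (p + δ) (m + 1 : ℕ)) ≤ X := by
        rw [← hMX]
        refine (mass_twoPoint_succ_le hΓ _ m).trans (add_le_add ?_ (mul_le_mul' ih.1 ih.2))
        refine (treeSum_wt_succ_le hΓ _ m).trans (pow_le_pow_left' ?_ _)
        exact (add_le_add le_rfl hle).trans (by norm_num)
      refine ⟨?_, h2⟩
      calc _ ≤ (p * treeSum (Γ := Γ) (wt p (m + 1 : ℕ)) {0} + δ * X) * n := by
            gcongr
            exact (add_mul_treeSum_le p δ _).trans (by gcongr)
        _ ≤ (p * treeSum (Γ := Γ) (wt p ⊤) {0} + δ * X) * n := by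
            gcongr
            exact treeSum_wt_le_top _ _
        _ = β := by
            rw [← hδX]
            ring
  have hq0 : (p + δ) * n ≠ 0 := mul_ne_zero (by simp [hδ0]) (by positivity)
  have hδt : δ ≠ ⊤ := ENNReal.div_ne_top (ENNReal.sub_ne_top hβt) hnX0
  have hqt : (p + δ) * n ≠ ⊤ := ENNReal.mul_ne_top (ENNReal.add_ne_top.2 ⟨hp, hδt⟩) hnt
  rw [mul_right_comm, mul_comm, ← ENNReal.le_div_iff_mul_le (.inl hq0) (.inl hqt)]
  refine treeSum_top_le fun m => ?_
  rw [ENNReal.le_div_iff_mul_le (.inl hq0) (.inl hqt), mul_comm, mul_right_comm]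
  exact (key m).1.trans hβ1.le

/-- The base point is the largest `c` with `c * g_c * |Λ| ≤ 1`. -/
theorem exists_basePoint (hΓ : Γ.IsHomogeneous Λ) (hΛ : Λ.card ≠ 0) :
    ∃ c : ℝ≥0∞, c * treeSum (Γ := Γ) (wt c ⊤) {0} * (Λ.card : ℝ≥0∞) = 1 := by
  set φ : ℝ≥0∞ → ℝ≥0∞ := fun c => c * treeSum (Γ := Γ) (wt c ⊤) {0} * (Λ.card : ℝ≥0∞) with hφ
  have hn1 : (1 : ℝ≥0∞) ≤ Λ.card := by exact_mod_cast Nat.one_le_iff_ne_zero.2 hΛ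
  -- as a sum of polynomials with non-negative coefficients, `φ` is lower semicontinuous
  have hlsc : LowerSemicontinuous φ := by
    have : φ = fun c => ∑' T : FinTree Γ, (Λ.card : ℝ≥0∞) *
        (ind (({0} : Set V) ⊆ T.1.verts) * c ^ (T.1.edgeSet.ncard + 1)) := by
      funext c
      rw [ENNReal.tsum_mul_left, hφ]
      simp only [treeSum, wt_top]
      rw [mul_comm, ← ENNReal.tsum_mul_left]
      congr 1
      refine tsum_congr fun T => ?_
      ring
    rw [this]
    refine lowerSemicontinuous_tsum fun T => Continuous.lowerSemicontinuous ?_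
    refine (ENNReal.continuous_const_mul (ENNReal.natCast_ne_top _)).comp
      ((ENNReal.continuous_const_mul ?_).comp (ENNReal.continuous_pow _))
    exact ne_top_of_le_ne_top ENNReal.one_ne_top ind_le_one
  have hmem : φ (sSup {c | φ c ≤ 1}) ≤ 1 :=
    (hlsc.isClosed_preimage 1).sSup_mem ⟨0, by simp [hφ]⟩
  have hle : sSup {c | φ c ≤ 1} ≤ 1 := by
    refine sSup_le fun c hc => le_trans ?_ hc
    calc c = c * 1 * 1 := by ring
      _ ≤ _ := by
        simp only [hφ]
        gcongr
        exact one_le_treeSum c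
  refine ⟨_, le_antisymm hmem (not_lt.1 fun hlt => ?_)⟩
  obtain ⟨q, hq, hq1⟩ := exists_gt_of_lt hΓ hΛ (ne_top_of_le_ne_top ENNReal.one_ne_top hle) hlt
  exact absurd (le_sSup (show q ∈ {c | φ c ≤ 1} from hq1)) (not_le.2 hq)

theorem basePoint_unique {c c' : ℝ≥0∞}
    (h : c * treeSum (Γ := Γ) (wt c ⊤) {0} * (Λ.card : ℝ≥0∞) = 1)
    (h' : c' * treeSum (Γ := Γ) (wt c' ⊤) {0} * (Λ.card : ℝ≥0∞) = 1) : c = c' := by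
  wlog hlt : c < c' generalizing c c'
  · rcases (not_lt.1 hlt).eq_or_lt with h1 | h1
    · exact h1.symm
    · exact (this h' h h1).symm
  exfalso
  rw [mul_assoc] at h
  have h0 : treeSum (Γ := Γ) (wt c ⊤) {0} * (Λ.card : ℝ≥0∞) ≠ 0 :=
    right_ne_zero_of_mul (h.trans_ne one_ne_zero)
  have ht : treeSum (Γ := Γ) (wt c ⊤) {0} * (Λ.card : ℝ≥0∞) ≠ ⊤ := by
    intro ht
    have hc0 : c ≠ 0 := left_ne_zero_of_mul (h.trans_ne one_ne_zero)
    rw [ht, ENNReal.mul_top hc0] at h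
    exact ENNReal.top_ne_one h
  have h1 : c * (treeSum (Γ := Γ) (wt c ⊤) {0} * (Λ.card : ℝ≥0∞)) <
      c' * (treeSum (Γ := Γ) (wt c ⊤) {0} * (Λ.card : ℝ≥0∞)) :=
    (ENNReal.mul_lt_mul_iff_left h0 ht).2 hlt
  rw [h] at h1
  refine absurd h' (ne_of_gt (h1.trans_le ?_))
  rw [mul_assoc]
  gcongr
  exact treeSum_wt_mono hlt.le _ _

end FinTree

end


/-! ### Splitting the step distribution -/

noncomputable section

open scoped ENNReal

namespace Conv

variable {V : Type*} [AddCommGroup V]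

theorem single_mul_single (a b : V) : single a * single b = single (a + b) := by
  ext x
  rw [single_mul_apply, single_apply, single_apply]
  by_cases h : x = a + b
  · rw [if_pos h, if_pos (by rw [h, add_sub_cancel_left])]
  · rw [if_neg h, if_neg fun h' => h (by rw [← h', add_sub_cancel])]

theorem single_pow (a : V) (k : ℕ) : single a ^ k = single (k • a) := by
  induction k with
  | zero => rw [pow_zero, zero_smul, one_def]
  | succ k ih => rw [pow_succ, ih, single_mul_single, succ_nsmul]

theorem nsmul_apply (k : ℕ) (f : Conv V) (x : V) : (k • f) x = k * f x := by
  induction k with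
  | zero => simp
  | succ k ih => rw [succ_nsmul, Conv.add_apply, ih, Nat.cast_succ, add_mul, one_mul]

theorem smul_pow' (a : ℝ≥0∞) (f : Conv V) (k : ℕ) : (a • f) ^ k = a ^ k • f ^ k := by
  induction k with
  | zero =>
    ext x
    simp
  | succ k ih =>
    rw [pow_succ, ih, smul_mul, mul_smul', pow_succ f]
    ext x
    simp only [Conv.smul_apply]
    ring

theorem mass_green (f : Conv V) : mass (green f) = (1 - mass f)⁻¹ := by
  rw [green, mass_sum]
  simp only [mass_pow]
  exact ENNReal.tsum_geometric _

theorem pow_le_pow {f g : Conv V} (h : f ≤ g) (k : ℕ) : f ^ k ≤ g ^ k := by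
  induction k with
  | zero => exact le_rfl
  | succ k ih =>
    rw [pow_succ, pow_succ]
    exact mul_le ih h

/-- A part `U` of the step distribution can be split off: the remaining steps are summed first. -/
theorem green_add_le (U R : Conv V) : green (U + R) ≤ green R * green (U * green R) := by
  rw [← mul_one (green (U + R))]
  refine green_mul_le (le_of_eq ?_)
  calc 1 + (U + R) * (green R * green (U * green R))
      = (1 + U * green R * green (U * green R)) + R * green R * green (U * green R) := by ring
    _ = (1 + R * green R) * green (U * green R) := by
        rw [← green_eq]
        ring
    _ = _ := by rw [← green_eq]

/-- The fourth power of a Green function as a sum over four walks. -/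
theorem mul_green_pow_four_apply (f W : Conv V) (x : V) :
    (f * green W ^ 4) x = ∑' k₁, ∑' k₂, ∑' k₃, ∑' k₄, (f * W ^ (k₁ + k₂ + k₃ + k₄)) x := by
  have h : f * green W ^ 4 = sum fun k₁ => sum fun k₂ => sum fun k₃ => sum fun k₄ =>
      f * W ^ (k₁ + k₂ + k₃ + k₄) := by
    calc f * green W ^ 4 = f * green W * green W * green W * green W := by ring
      _ = _ := by
        conv_lhs =>
          rw [green]
          simp only [mul_sum, sum_mul]
        refine congrArg sum (funext fun k₁ => congrArg sum (funext fun k₂ => congrArg sum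
          (funext fun k₃ => congrArg sum (funext fun k₄ => ?_))))
        ring
  rw [h]
  rfl

/-- If the step distribution `f` dominates `κ • U`, then the decay of the powers of `U` controls the
diagrams of `f`. -/
theorem mul_green_pow_four_le {f U : Conv V} {κ A : ℝ≥0∞} {w : ℕ → ℝ≥0∞} (hf : mass f = 1)
    (hU : mass U = 1) (hκ : κ ≠ 0) (hfU : κ • U ≤ f) (hfA : ∀ x, f x ≤ A) (hw : Antitone w)
    (hw0 : w 0 = 1) (hUA : ∀ k ≠ 0, ∀ x, (U ^ k) x ≤ A * w k ^ 4) (x : V) :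
    (f * green f ^ 4) x ≤ κ⁻¹ ^ 4 * A * (∑' k, w k) ^ 4 := by
  -- the remaining steps `R` have mass `1 - κ`, so their Green function has mass `κ⁻¹`
  let R : Conv V := ⟨fun x => f x - (κ • U) x⟩
  have hfR : f = κ • U + R := by
    ext x
    exact (add_tsub_cancel_of_le (hfU x)).symm
  have hmass : κ + mass R = 1 := by
    rw [← hf]
    conv_rhs => rw [hfR]
    rw [mass_add, mass_smul, hU, mul_one]
  have hκ1 : κ ≤ 1 := hmass ▸ le_self_add
  have hκt : κ ≠ ⊤ := ne_top_of_le_ne_top ENNReal.one_ne_top hκ1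
  have hR : mass (green R) = κ⁻¹ := by
    rw [mass_green, ← hmass, ENNReal.add_sub_cancel_right]
    exact ne_top_of_le_ne_top ENNReal.one_ne_top (hmass ▸ le_add_self)
  have hstep : ∀ k x, (f * green R ^ 4 * ((κ • U) * green R) ^ k) x ≤ κ⁻¹ ^ 4 * (A * w k ^ 4) := by
    intro k x
    by_cases hk : k = 0
    · rw [hk, pow_zero, mul_one, hw0, one_pow, mul_one, ← hR, ← mass_pow, mul_comm f]
      exact mul_apply_le_mass_mul hfA x
    · have h1 : f * green R ^ 4 * ((κ • U) * green R) ^ k =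
          κ ^ k • (f * green R ^ (k + 4) * U ^ k) := by
        rw [mul_pow, smul_pow', smul_mul, mul_smul']
        congr 1
        ring
      have h2 : mass (f * green R ^ (k + 4)) = κ⁻¹ ^ k * κ⁻¹ ^ 4 := by
        rw [mass_mul, mass_pow, hf, hR, one_mul, pow_add]
      rw [h1, Conv.smul_apply]
      refine (mul_le_mul' le_rfl (mul_apply_le_mass_mul (hUA k hk) x)).trans (le_of_eq ?_)
      calc κ ^ k * (mass (f * green R ^ (k + 4)) * (A * w k ^ 4))
          = (κ * κ⁻¹) ^ k * (κ⁻¹ ^ 4 * (A * w k ^ 4)) := by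
            rw [h2]
            ring
        _ = _ := by rw [ENNReal.mul_inv_cancel hκ hκt, one_pow, one_mul]
  calc (f * green f ^ 4) x
      ≤ (f * (green R * green ((κ • U) * green R)) ^ 4) x := by
        refine mul_le le_rfl (pow_le_pow ?_ 4) x
        conv_lhs => rw [hfR]
        exact green_add_le _ _
    _ = ∑' k₁, ∑' k₂, ∑' k₃, ∑' k₄,
          (f * green R ^ 4 * ((κ • U) * green R) ^ (k₁ + k₂ + k₃ + k₄)) x := by
        rw [← mul_green_pow_four_apply, mul_pow, mul_assoc]
    _ ≤ ∑' k₁, ∑' k₂, ∑' k₃, ∑' k₄, κ⁻¹ ^ 4 * A * (w k₁ * (w k₂ * (w k₃ * w k₄))) := by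
        refine ENNReal.tsum_le_tsum fun k₁ => ENNReal.tsum_le_tsum fun k₂ =>
          ENNReal.tsum_le_tsum fun k₃ => ENNReal.tsum_le_tsum fun k₄ => (hstep _ x).trans ?_
        rw [mul_assoc]
        refine mul_le_mul' le_rfl (mul_le_mul' le_rfl ?_)
        -- the decay in the total number of steps is shared by the four walks
        calc w (k₁ + k₂ + k₃ + k₄) ^ 4 = w (k₁ + k₂ + k₃ + k₄) * (w (k₁ + k₂ + k₃ + k₄) *
              (w (k₁ + k₂ + k₃ + k₄) * w (k₁ + k₂ + k₃ + k₄))) := by ring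
          _ ≤ _ := mul_le_mul' (hw (by omega)) (mul_le_mul' (hw (by omega))
            (mul_le_mul' (hw (by omega)) (hw (by omega))))
    _ = _ := by
        simp only [ENNReal.tsum_mul_left, ENNReal.tsum_mul_right]
        ring

end Conv

end


/-! ### Random walk on the integers with steps in an interval -/

noncomputable section

open scoped ENNReal

theorem Nat.mul_centralBinom_sq_le (n : ℕ) : (2 * n + 1) * n.centralBinom ^ 2 ≤ 16 ^ n := by
  induction n with
  | zero => simp
  | succ n ih =>
    have h := Nat.succ_mul_centralBinom_succ n
    refine Nat.le_of_mul_le_mul_left (c := (n + 1) ^ 2) ?_ (by positivity)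
    calc (n + 1) ^ 2 * ((2 * (n + 1) + 1) * (n + 1).centralBinom ^ 2)
        = (2 * n + 3) * ((n + 1) * (n + 1).centralBinom) ^ 2 := by ring
      _ = 4 * ((2 * n + 3) * (2 * n + 1)) * ((2 * n + 1) * n.centralBinom ^ 2) := by
        rw [h]
        ring
      _ ≤ 4 * (4 * (n + 1) ^ 2) * 16 ^ n := by
        have h1 : (2 * n + 3) * (2 * n + 1) ≤ 4 * (n + 1) ^ 2 := by nlinarith
        exact Nat.mul_le_mul (Nat.mul_le_mul le_rfl h1) ih
      _ = _ := by ring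

theorem Nat.mul_choose_half_sq_le (k : ℕ) : (k + 1) * k.choose (k / 2) ^ 2 ≤ 4 ^ k := by
  rcases Nat.even_or_odd' k with ⟨n, rfl | rfl⟩
  · rw [Nat.mul_div_cancel_left n two_pos, ← Nat.centralBinom_eq_two_mul_choose, pow_mul]
    exact Nat.mul_centralBinom_sq_le n
  · have h1 : (2 * n + 1) / 2 = n := by omega
    have h2 : (n + 1).centralBinom = 2 * (2 * n + 1).choose n := by
      rw [Nat.centralBinom_eq_two_mul_choose, show 2 * (n + 1) = 2 * n + 1 + 1 by ring,
        Nat.choose_succ_succ, Nat.choose_symm_half]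
      ring
    have h3 := Nat.mul_centralBinom_sq_le (n + 1)
    rw [h2] at h3
    rw [h1]
    have h4 : (16 : ℕ) ^ (n + 1) = 4 * 4 ^ (2 * n + 1) := by
      rw [pow_succ 4, pow_mul]
      ring
    rw [h4] at h3
    nlinarith [Nat.zero_le ((2 * n + 1).choose n ^ 2)]

/-- The decay rate `(k + 1) ^ (-9 / 8)`; its fourth power is that of the return probabilities of a
random walk in nine dimensions. It is summable, which is where the condition `8 < d` is needed. -/
def decay (k : ℕ) : ℝ≥0∞ := ((k + 1 : ℕ) : ℝ≥0∞) ^ (-(9 / 8) : ℝ)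

theorem decay_zero : decay 0 = 1 := by simp [decay]

theorem decay_antitone : Antitone decay := by
  intro k l h
  unfold decay
  rw [ENNReal.rpow_neg, ENNReal.rpow_neg, ENNReal.inv_le_inv]
  refine ENNReal.rpow_le_rpow ?_ (by norm_num)
  exact_mod_cast Nat.succ_le_succ h

theorem tsum_decay_ne_top : ∑' k, decay k ≠ ⊤ := by
  have h : ∀ k, decay k = (((k + 1 : ℕ) : NNReal) ^ (-(9 / 8) : ℝ) : NNReal) := by
    intro k
    rw [decay, ← ENNReal.coe_natCast, ENNReal.coe_rpow_of_ne_zero]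
    positivity
  simp only [h]
  rw [ENNReal.tsum_coe_ne_top_iff_summable,
    NNReal.summable_nat_add_iff (f := fun k : ℕ => (k : NNReal) ^ (-(9 / 8) : ℝ)) 1]
  simp only [NNReal.rpow_neg]
  exact NNReal.summable_rpow_inv.2 (by norm_num)

theorem pow_nine_le_decay {q : ℝ≥0∞} {k : ℕ} (h : (k + 1 : ℕ) * q ^ 2 ≤ 1) :
    q ^ 9 ≤ decay k ^ 4 := by
  have h1 : q ^ 2 ≤ ((k + 1 : ℕ) : ℝ≥0∞)⁻¹ := by
    rw [ENNReal.le_inv_iff_mul_le, mul_comm]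
    exact h
  calc q ^ 9 = (q ^ 2) ^ (9 / 2 : ℝ) := by
        rw [← ENNReal.rpow_natCast, ← ENNReal.rpow_natCast, ← ENNReal.rpow_mul]
        norm_num
    _ ≤ (((k + 1 : ℕ) : ℝ≥0∞)⁻¹) ^ (9 / 2 : ℝ) := ENNReal.rpow_le_rpow h1 (by norm_num)
    _ = decay k ^ 4 := by
        rw [decay, ← ENNReal.rpow_neg_one, ← ENNReal.rpow_natCast, ← ENNReal.rpow_mul,
          ← ENNReal.rpow_mul]
        norm_num

namespace Conv

/-- The uniform distribution on the `h` integers of the interval `[h, 2h)`. -/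
def interval (h : ℕ) : Conv ℤ := unif (Finset.Ico (h : ℤ) (2 * h))

theorem interval_apply (h : ℕ) (x : ℤ) :
    interval h x = ind ((h : ℤ) ≤ x ∧ x < 2 * h) * (h : ℝ≥0∞)⁻¹ := by
  rw [interval, unif_apply]
  congr 2
  · rw [Finset.mem_Ico]
  · rw [Int.card_Ico]
    congr 2
    omega

theorem mass_interval {h : ℕ} (hh : h ≠ 0) : mass (interval h) = 1 := by
  refine mass_unif ?_
  rw [Int.card_Ico]
  omega

/-- The uniform distribution on the integers of the interval `[h, 3h)`, as the convolution of that
on `[h, 2h)` with a Bernoulli distribution. -/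
def wideInterval (h : ℕ) : Conv ℤ := interval h * ((2 : ℝ≥0∞)⁻¹ • (1 + single (h : ℤ)))

theorem mass_wideInterval {h : ℕ} (hh : h ≠ 0) : mass (wideInterval h) = 1 := by
  rw [wideInterval, mass_mul, mass_interval hh, mass_smul, mass_add, mass_one, mass_single, one_mul,
    one_add_one_eq_two]
  exact ENNReal.inv_mul_cancel (by simp) (by simp)

theorem wideInterval_le (h : ℕ) (x : ℤ) :
    wideInterval h x ≤ ind ((h : ℤ) ≤ x ∧ x < 3 * h) * (2 * h : ℝ≥0∞)⁻¹ := by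
  have h1 : wideInterval h x = (2 : ℝ≥0∞)⁻¹ * (interval h x + interval h (x - h)) := by
    rw [wideInterval, mul_smul', mul_add, mul_one, mul_comm, Conv.smul_apply, Conv.add_apply,
      single_mul_apply]
  rw [h1, ENNReal.mul_inv (by simp) (by simp), interval_apply, interval_apply, ← add_mul,
    mul_left_comm]
  refine mul_le_mul' ?_ le_rfl
  by_cases h2 : (h : ℤ) ≤ x ∧ x < 2 * h
  · rw [ind_of_true h2, ind_of_false (by omega), ind_of_true (by omega), add_zero]
  · rw [ind_of_false h2, zero_add]
    exact ind_mono (by omega)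

/-- The local limit bound for the random walk with uniform steps on an interval. -/
theorem wideInterval_pow_le {h k : ℕ} (hh : h ≠ 0) (hk : k ≠ 0) (x : ℤ) :
    (wideInterval h ^ k) x ≤ (h : ℝ≥0∞)⁻¹ * (k.choose (k / 2) / 2 ^ k) := by
  have h1 : ∀ x, (interval h * ((2 : ℝ≥0∞)⁻¹ • (1 + single (h : ℤ))) ^ k) x ≤
      (h : ℝ≥0∞)⁻¹ * (k.choose (k / 2) / 2 ^ k) := by
    intro x
    have h2 : interval h * ((2 : ℝ≥0∞)⁻¹ • (1 + single (h : ℤ))) ^ k =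
        (2 : ℝ≥0∞)⁻¹ ^ k • ∑ m ∈ Finset.range (k + 1),
          k.choose m • (single (m * h : ℤ) * interval h) := by
      rw [smul_pow', mul_smul', add_comm, add_pow, Finset.mul_sum]
      congr 1
      refine Finset.sum_congr rfl fun m _ => ?_
      rw [one_pow, mul_one, single_pow, nsmul_eq_mul, nsmul_eq_mul]
      ring
    have h3 : ∀ F : ℕ → Conv ℤ, (∑ m ∈ Finset.range (k + 1), F m) x =
        ∑ m ∈ Finset.range (k + 1), F m x := by
      intro F
      induction k + 1 with
      | zero => simp
      | succ n ih => rw [Finset.sum_range_succ, Finset.sum_range_succ, Conv.add_apply, ih]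
    -- the translates of `[h, 2h)` by the multiples of `h` are disjoint
    have h4 : ∑ m ∈ Finset.range (k + 1), ind ((h : ℤ) ≤ x - m * h ∧ x - m * h < 2 * h) ≤ 1 := by
      by_cases hex : ∃ m ∈ Finset.range (k + 1), (h : ℤ) ≤ x - m * h ∧ x - m * h < 2 * h
      · obtain ⟨m, hm, a1, a2⟩ := hex
        rw [Finset.sum_eq_single_of_mem m hm]
        · exact ind_le_one
        · intro m' _ hne
          refine ind_of_false ?_
          rintro ⟨b1, b2⟩
          rcases lt_or_gt_of_ne hne with hlt | hlt
          · have : ((m' : ℤ) + 1) * h ≤ m * h := by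
              gcongr
              exact_mod_cast hlt
            linarith
          · have : ((m : ℤ) + 1) * h ≤ m' * h := by
              gcongr
              exact_mod_cast hlt
            linarith
      · push Not at hex
        rw [Finset.sum_eq_zero fun m hm => ind_of_false fun h' => (hex m hm h'.1).not_gt h'.2]
        exact zero_le
    rw [h2, Conv.smul_apply, h3]
    calc (2 : ℝ≥0∞)⁻¹ ^ k * ∑ m ∈ Finset.range (k + 1),
          (k.choose m • (single (m * h : ℤ) * interval h)) x
        ≤ (2 : ℝ≥0∞)⁻¹ ^ k * ∑ m ∈ Finset.range (k + 1), k.choose (k / 2) *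
            (ind ((h : ℤ) ≤ x - m * h ∧ x - m * h < 2 * h) * (h : ℝ≥0∞)⁻¹) := by
          gcongr with m _
          rw [nsmul_apply, single_mul_apply, interval_apply]
          gcongr
          exact Nat.choose_le_middle m k
      _ = (2 : ℝ≥0∞)⁻¹ ^ k * (k.choose (k / 2) * ((∑ m ∈ Finset.range (k + 1),
            ind ((h : ℤ) ≤ x - m * h ∧ x - m * h < 2 * h)) * (h : ℝ≥0∞)⁻¹)) := by
          rw [← Finset.mul_sum, ← Finset.sum_mul]
      _ ≤ (2 : ℝ≥0∞)⁻¹ ^ k * (k.choose (k / 2) * (1 * (h : ℝ≥0∞)⁻¹)) := by gcongr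
      _ = _ := by
          rw [ENNReal.div_eq_inv_mul, ENNReal.inv_pow]
          ring
  -- one factor `interval h` smooths the binomial distribution, the others have mass one
  obtain ⟨j, rfl⟩ := Nat.exists_eq_succ_of_ne_zero hk
  rw [wideInterval, mul_pow, pow_succ (interval h), mul_assoc]
  refine (mul_apply_le_mass_mul h1 x).trans (le_of_eq ?_)
  rw [mass_pow, mass_interval hh, one_pow, one_mul]

theorem choose_half_pow_le {d : ℕ} (hd : 8 < d) (a : ℝ≥0∞) (k : ℕ) :
    (a * (k.choose (k / 2) / 2 ^ k)) ^ d ≤ a ^ d * decay k ^ 4 := by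
  have hq : ((k + 1 : ℕ) : ℝ≥0∞) * (k.choose (k / 2) / 2 ^ k : ℝ≥0∞) ^ 2 ≤ 1 := by
    rw [div_eq_mul_inv, mul_pow, ← ENNReal.inv_pow, ← mul_assoc, ← div_eq_mul_inv]
    refine ENNReal.div_le_of_le_mul ?_
    rw [one_mul, ← pow_mul, mul_comm k, pow_mul]
    norm_num1
    exact_mod_cast Nat.mul_choose_half_sq_le k
  have hq1 : (k.choose (k / 2) / 2 ^ k : ℝ≥0∞) ≤ 1 := by
    by_contra hcon
    push Not at hcon
    refine absurd hq (not_le.2 ?_)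
    calc (1 : ℝ≥0∞) < k.choose (k / 2) / 2 ^ k := hcon
      _ ≤ (k.choose (k / 2) / 2 ^ k : ℝ≥0∞) ^ 2 := by
        rw [pow_two]
        exact le_mul_of_one_le_left zero_le hcon.le
      _ ≤ _ := le_mul_of_one_le_left zero_le (by exact_mod_cast Nat.le_add_left 1 k)
  rw [mul_pow]
  refine mul_le_mul' le_rfl ?_
  exact (pow_le_pow_right_of_le_one' hq1 hd).trans (pow_nine_le_decay hq)

end Conv

end


/-! ### Random walk with steps in a box -/

noncomputable section

open scoped ENNReal

theorem ENNReal.tsum_pi_prod {α : Type*} {d : ℕ} (F : Fin d → α → ℝ≥0∞) :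
    ∑' y : Fin d → α, ∏ i, F i (y i) = ∏ i, ∑' t, F i t := by
  induction d with
  | zero => simp [tsum_fintype]
  | succ d ih =>
    rw [Fin.prod_univ_succ, ← ih, ENNReal.tsum_mul_tsum, ← (Fin.consEquiv fun _ => α).tsum_eq,
      ← ENNReal.tsum_prod (f := fun (a : α) (y : Fin d → α) => F 0 a * ∏ i : Fin d, F i.succ (y i))]
    refine tsum_congr fun y => ?_
    rw [Fin.prod_univ_succ]
    simp [Fin.consEquiv]

namespace Conv

variable {d : ℕ}

/-- The product measure with `d` equal marginals. -/
def tensor (d : ℕ) (f : Conv ℤ) : Conv (Fin d → ℤ) := ⟨fun x => ∏ i, f (x i)⟩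

theorem tensor_apply (f : Conv ℤ) (x : Fin d → ℤ) : tensor d f x = ∏ i, f (x i) := rfl

theorem mass_tensor (f : Conv ℤ) : mass (tensor d f) = mass f ^ d := by
  simp only [mass, tensor_apply]
  rw [ENNReal.tsum_pi_prod, Finset.prod_const, Finset.card_univ, Fintype.card_fin]

theorem tensor_mul (f g : Conv ℤ) : tensor d f * tensor d g = tensor d (f * g) := by
  ext x
  simp only [mul_apply, tensor_apply, ← Finset.prod_mul_distrib]
  exact ENNReal.tsum_pi_prod fun i t => f t * g (x i - t)

theorem tensor_one : tensor d 1 = 1 := by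
  ext x
  rw [tensor_apply]
  by_cases hx : x = 0
  · simp [hx, one_apply_zero]
  · rw [one_apply_of_ne hx]
    obtain ⟨i, hi⟩ := Function.ne_iff.1 hx
    exact Finset.prod_eq_zero (Finset.mem_univ i) (one_apply_of_ne hi)

theorem tensor_pow (f : Conv ℤ) (k : ℕ) : tensor d f ^ k = tensor d (f ^ k) := by
  induction k with
  | zero => rw [pow_zero, pow_zero, tensor_one]
  | succ k ih => rw [pow_succ, ih, tensor_mul, pow_succ]

/-- The four-fold bubble of a random walk whose steps are uniform on a set `Λ` is of the order of
`h ^ (-d)` if `Λ` contains a box of side `2 * h` that fills a fraction `κ` of `Λ` at least. -/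
theorem unif_mul_green_pow_four_le (hd : 8 < d) {Λ : Finset (Fin d → ℤ)} {h : ℕ} (hh : h ≠ 0)
    {κ : ℝ≥0∞} (hκ : κ ≠ 0) (hbox : ∀ x : Fin d → ℤ, (∀ i, (h : ℤ) ≤ x i ∧ x i < 3 * h) → x ∈ Λ)
    (hcard : κ * Λ.card ≤ (2 * h) ^ d) (x : Fin d → ℤ) :
    (unif Λ * green (unif Λ) ^ 4) x ≤
      κ⁻¹ ^ 4 * (h : ℝ≥0∞)⁻¹ ^ d * (∑' k, decay k) ^ 4 := by
  have hle : h ^ d ≤ Λ.card := by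
    have h1 : (Fintype.piFinset fun _ : Fin d => Finset.Ico (h : ℤ) (3 * h)).card ≤ Λ.card := by
      refine Finset.card_le_card fun x hx => hbox x fun i => ?_
      exact Finset.mem_Ico.1 (Fintype.mem_piFinset.1 hx i)
    rw [Fintype.card_piFinset, Finset.prod_const, Int.card_Ico, Finset.card_univ,
      Fintype.card_fin] at h1
    refine le_trans (Nat.pow_le_pow_left ?_ d) h1
    omega
  have hΛ : Λ.card ≠ 0 := by
    have : 0 < h ^ d := by positivity
    omega
  refine mul_green_pow_four_le (U := tensor d (wideInterval h)) (mass_unif hΛ) ?_ hκ ?_ ?_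
    decay_antitone decay_zero ?_ x
  · rw [mass_tensor, mass_wideInterval hh, one_pow]
  · intro x
    rw [Conv.smul_apply, tensor_apply, unif_apply]
    by_cases hx : ∀ i, (h : ℤ) ≤ x i ∧ x i < 3 * h
    · rw [ind_of_true (hbox x hx), one_mul]
      calc κ * ∏ i, wideInterval h (x i) ≤ κ * ∏ _i : Fin d, (2 * h : ℝ≥0∞)⁻¹ := by
            refine mul_le_mul' le_rfl (Finset.prod_le_prod' fun i _ => ?_)
            refine (wideInterval_le h (x i)).trans ?_
            rw [ind_of_true (hx i), one_mul]
        _ = κ * ((2 * h : ℝ≥0∞) ^ d)⁻¹ := by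
            rw [Finset.prod_const, Finset.card_univ, Fintype.card_fin, ENNReal.inv_pow]
        _ ≤ (Λ.card : ℝ≥0∞)⁻¹ := by
            rw [ENNReal.le_inv_iff_mul_le, mul_right_comm]
            refine (mul_le_mul' hcard le_rfl).trans (ENNReal.mul_inv_le_one _)
    · push Not at hx
      obtain ⟨i, hi⟩ := hx
      have h0 : wideInterval h (x i) = 0 := by
        refine le_antisymm ((wideInterval_le h (x i)).trans (le_of_eq ?_)) zero_le
        rw [ind_of_false fun h' => (hi h'.1).not_gt h'.2, zero_mul]
      rw [Finset.prod_eq_zero (Finset.mem_univ i) h0, mul_zero]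
      exact zero_le
  · intro x
    rw [unif_apply, ← ENNReal.inv_pow]
    refine (mul_le_mul' ind_le_one le_rfl).trans ?_
    rw [one_mul, ENNReal.inv_le_inv]
    exact_mod_cast hle
  · intro k hk x
    rw [tensor_pow, tensor_apply]
    have h1 : ∀ i, (wideInterval h ^ k) (x i) ≤ (h : ℝ≥0∞)⁻¹ * (k.choose (k / 2) / 2 ^ k) :=
      fun i => wideInterval_pow_le hh hk (x i)
    refine (Finset.prod_le_prod' fun i _ => h1 i).trans ?_
    rw [Finset.prod_const, Finset.card_univ, Fintype.card_fin]
    exact choose_half_pow_le hd _ k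

end Conv

end


/-! ### The steps of the spread-out lattice -/

noncomputable section

open scoped ENNReal

namespace LatticeTree

variable {d : ℕ} {N : Seminorm ℝ (Fin d → ℝ)}

/-- The equivalence of norms on `ℝ ^ d`, in the direction that uses the definiteness of `N`. -/
theorem exists_pos_mul_norm_le [Nonempty (Fin d)] (hN : ∀ x, N x = 0 → x = 0) :
    ∃ c : ℝ, 0 < c ∧ ∀ x : Fin d → ℝ, c * ‖x‖ ≤ N x := by
  have hcont : Continuous N := continuousOn_univ.1 (N.convexOn.continuousOn isOpen_univ)
  obtain ⟨z, hz, hmin⟩ := (isCompact_sphere (0 : Fin d → ℝ) 1).exists_isMinOn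
    (NormedSpace.sphere_nonempty.2 zero_le_one) hcont.continuousOn
  have hz0 : z ≠ 0 := by
    rintro rfl
    simp at hz
  refine ⟨N z, lt_of_le_of_ne (apply_nonneg N z) fun h => hz0 (hN z h.symm), fun x => ?_⟩
  by_cases hx : x = 0
  · simp [hx]
  · have hm : N z ≤ N (‖x‖⁻¹ • x) := hmin (by simp [norm_smul, hx])
    rw [map_smul_eq_mul, norm_inv, norm_norm, inv_mul_eq_div,
      le_div_iff₀ (norm_pos_iff.mpr hx)] at hm
    exact hm

theorem latticeNorm_le (N : Seminorm ℝ (Fin d → ℝ)) (x : Fin d → ℤ) {b : ℝ}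
    (hb : ∀ i, |(x i : ℝ)| ≤ b) : latticeNorm N x ≤ b * ∑ i, N (Pi.single i 1) := by
  calc latticeNorm N x = N (∑ i, (x i : ℝ) • (Pi.single i (1 : ℝ) : Fin d → ℝ)) := by
        rw [latticeNorm]
        congr 1
        exact pi_eq_sum_univ' _
    _ ≤ ∑ i, N ((x i : ℝ) • (Pi.single i (1 : ℝ) : Fin d → ℝ)) :=
        Finset.le_sum_of_subadditive N (map_zero N).le (map_add_le_add N) _ _
    _ ≤ ∑ i, b * N (Pi.single i 1) := by
        refine Finset.sum_le_sum fun i _ => ?_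
        rw [map_smul_eq_mul]
        exact mul_le_mul_of_nonneg_right (hb i) (apply_nonneg N _)
    _ = _ := by rw [Finset.mul_sum]

/-- The set of steps as a finite set. -/
def stepSet (hN : ∀ x, N x = 0 → x = 0) (L : ℕ) : Finset (Fin d → ℤ) :=
  (steps_finite N hN L).toFinset

theorem mem_stepSet {hN : ∀ x, N x = 0 → x = 0} {L : ℕ} {x : Fin d → ℤ} :
    x ∈ stepSet hN L ↔ 0 < latticeNorm N x ∧ latticeNorm N x ≤ L :=
  Set.Finite.mem_toFinset _

theorem latticeNorm_pos (hN : ∀ x, N x = 0 → x = 0) {x : Fin d → ℤ} (hx : x ≠ 0) :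
    0 < latticeNorm N x := by
  refine lt_of_le_of_ne (apply_nonneg N _) fun h => hx ?_
  funext i
  have : (x i : ℝ) = 0 := congrFun (hN _ h.symm) i
  simpa using this

theorem card_stepSet_le {hN : ∀ x, N x = 0 → x = 0} {L M : ℕ}
    (hM : ∀ x : Fin d → ℝ, ‖x‖ ≤ M * N x) : (stepSet hN L).card ≤ (2 * (M * L) + 1) ^ d := by
  have h1 : stepSet hN L ⊆
      Fintype.piFinset fun _ : Fin d => Finset.Icc (-((M * L : ℕ) : ℤ)) ((M * L : ℕ) : ℤ) := by
    intro x hx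
    refine Fintype.mem_piFinset.2 fun i => ?_
    have h2 : |(x i : ℝ)| ≤ M * L := by
      refine (norm_le_pi_norm (fun i => (x i : ℝ)) i).trans ((hM _).trans ?_)
      gcongr
      exact (mem_stepSet.1 hx).2
    rw [Finset.mem_Icc, ← abs_le]
    exact_mod_cast h2
  refine (Finset.card_le_card h1).trans (le_of_eq ?_)
  rw [Fintype.card_piFinset, Finset.prod_const, Int.card_Icc, Finset.card_univ, Fintype.card_fin]
  congr 1
  omega

theorem mem_stepSet_of_box {hN : ∀ x, N x = 0 → x = 0} [Nonempty (Fin d)] {L K h : ℕ} (hh : h ≠ 0)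
    (hK : ∑ i, N (Pi.single i 1) ≤ K) (hL : 3 * K * h ≤ L) {x : Fin d → ℤ}
    (hx : ∀ i, (h : ℤ) ≤ x i ∧ x i < 3 * h) : x ∈ stepSet hN L := by
  obtain ⟨i₀⟩ := ‹Nonempty (Fin d)›
  rw [mem_stepSet]
  constructor
  · refine latticeNorm_pos hN fun h0 => ?_
    have := (hx i₀).1
    rw [h0, Pi.zero_apply] at this
    omega
  · refine (latticeNorm_le N x (b := 3 * h) fun i => ?_).trans ?_
    · have := hx i
      rw [abs_le]
      constructor
      · have : -(3 * h : ℤ) ≤ x i := by omega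
        exact_mod_cast this
      · exact_mod_cast (hx i).2.le
    · calc (3 * h : ℝ) * ∑ i, N (Pi.single i 1) ≤ 3 * h * K := by gcongr
        _ = ((3 * K * h : ℕ) : ℝ) := by
          push_cast
          ring
        _ ≤ L := by exact_mod_cast hL

open Conv in
/-- The four-fold bubble of the spread-out random walk is of order `L ^ (-d)`. -/
theorem exists_diagram_bound (hd : 8 < d) (hN : ∀ x, N x = 0 → x = 0) :
    ∃ (C : ℝ) (L₀ : ℕ), 0 ≤ C ∧ 0 < L₀ ∧ ∀ L : ℕ, L₀ ≤ L → (stepSet hN L).card ≠ 0 ∧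
      ∀ x, (unif (stepSet hN L) * green (unif (stepSet hN L)) ^ 4) x ≤
        ENNReal.ofReal (C / (L : ℝ) ^ d) := by
  have : Nonempty (Fin d) := ⟨⟨0, by omega⟩⟩
  obtain ⟨c, hc, hcN⟩ := exists_pos_mul_norm_le hN
  set M := ⌈c⁻¹⌉₊ with hM
  have hMN : ∀ x : Fin d → ℝ, ‖x‖ ≤ M * N x := fun x => by
    calc ‖x‖ = c⁻¹ * (c * ‖x‖) := by rw [inv_mul_cancel_left₀ hc.ne']
      _ ≤ M * N x := mul_le_mul (Nat.le_ceil _) (hcN x) (by positivity) (by positivity)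
  set K := ⌈∑ i, N (Pi.single i (1 : ℝ))⌉₊ + 1 with hK
  have hKN : ∑ i, N (Pi.single i (1 : ℝ)) ≤ K := (Nat.le_ceil _).trans (by rw [hK]; simp)
  set B := 12 * M * K + 1 with hB
  set T : ℝ≥0∞ := ∑' k, decay k with hT
  have hTt : T ≠ ⊤ := tsum_decay_ne_top
  refine ⟨(((B : ℝ) ^ d) ^ 4 * T.toReal ^ 4) * (6 * K) ^ d, 3 * K, by positivity, by omega,
    fun L hL => ?_⟩
  -- the box `[h, 3h) ^ d` lies in `Λ` because `∑ i, N (e i) ≤ K`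
  set h := L / (3 * K) with hh
  have hh0 : 0 < h := Nat.div_pos hL (by omega)
  have hh1 : 3 * K * h ≤ L := Nat.mul_div_le L (3 * K)
  have hh2 : L ≤ 6 * K * h := by
    have h1 : L < 3 * K * (h + 1) := Nat.lt_mul_div_succ L (by omega)
    nlinarith
  have hbox : ∀ x : Fin d → ℤ, (∀ i, (h : ℤ) ≤ x i ∧ x i < 3 * h) → x ∈ stepSet hN L :=
    fun x hx => mem_stepSet_of_box hh0.ne' hKN hh1 hx
  have hcard : (stepSet hN L).card ≤ B ^ d * h ^ d := by
    rw [← mul_pow]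
    refine (card_stepSet_le hMN).trans (Nat.pow_le_pow_left ?_ d)
    calc 2 * (M * L) + 1 ≤ 2 * (M * (6 * K * h)) + h := by gcongr; omega
      _ = B * h := by
        rw [hB]
        ring
  have hBd0 : ((B : ℝ≥0∞) ^ d) ≠ 0 := pow_ne_zero _ (by simp [hB])
  have hBdt : ((B : ℝ≥0∞) ^ d) ≠ ⊤ := ENNReal.pow_ne_top (by simp)
  refine ⟨(Finset.card_pos.2 ⟨fun _ => (h : ℤ), hbox _ fun i => ⟨le_rfl, by
    have : (0 : ℤ) < h := by exact_mod_cast hh0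
    linarith⟩⟩).ne', fun x => ?_⟩
  refine (unif_mul_green_pow_four_le hd hh0.ne' (κ := ((B : ℝ≥0∞) ^ d)⁻¹)
    (ENNReal.inv_ne_zero.2 hBdt) hbox ?_ x).trans ?_
  · calc ((B : ℝ≥0∞) ^ d)⁻¹ * (stepSet hN L).card ≤ ((B : ℝ≥0∞) ^ d)⁻¹ * (B ^ d * h ^ d) := by
          gcongr
          exact_mod_cast hcard
      _ = (h : ℝ≥0∞) ^ d := by rw [← mul_assoc, ENNReal.inv_mul_cancel hBd0 hBdt, one_mul]
      _ ≤ _ := by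
        gcongr
        exact le_mul_of_one_le_left zero_le (by norm_num)
  · have hL0 : (0 : ℝ) < L := by
      have : 0 < L := by omega
      exact_mod_cast this
    have h3 : ((h : ℝ) ^ d)⁻¹ ≤ (6 * K) ^ d / (L : ℝ) ^ d := by
      rw [inv_eq_one_div, div_le_div_iff₀ (by positivity) (by positivity), one_mul, ← mul_pow]
      gcongr
      exact_mod_cast hh2
    have h4 : (h : ℝ≥0∞)⁻¹ ^ d = ENNReal.ofReal (((h : ℝ) ^ d)⁻¹) := by
      rw [ENNReal.ofReal_inv_of_pos (by positivity), ENNReal.ofReal_pow (by positivity),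
        ENNReal.ofReal_natCast, ENNReal.inv_pow]
    have h5 : (B : ℝ≥0∞) ^ d = ENNReal.ofReal ((B : ℝ) ^ d) := by
      rw [ENNReal.ofReal_pow (by positivity), ENNReal.ofReal_natCast]
    have h6 : ∑' k, decay k = ENNReal.ofReal T.toReal := (ENNReal.ofReal_toReal hTt).symm
    rw [inv_inv, h4, h5, h6, ← ENNReal.ofReal_pow (by positivity),
      ← ENNReal.ofReal_pow (by positivity), ← ENNReal.ofReal_mul (by positivity),
      ← ENNReal.ofReal_mul (by positivity)]
    refine ENNReal.ofReal_le_ofReal ?_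
    calc ((B : ℝ) ^ d) ^ 4 * ((h : ℝ) ^ d)⁻¹ * T.toReal ^ 4
        ≤ ((B : ℝ) ^ d) ^ 4 * ((6 * K) ^ d / (L : ℝ) ^ d) * T.toReal ^ 4 := by gcongr
      _ = _ := by ring

end LatticeTree

end


/-! ### The spread-out lattice -/

noncomputable section

open scoped ENNReal

namespace Conv

variable {V : Type*} [AddCommGroup V]

/-- There are `n + 1` ways to divide `n` steps between two walks. -/
theorem green_sq_apply (f : Conv V) (x : V) :
    (green f ^ 2) x = ∑' n : ℕ, (n + 1 : ℕ) * (f ^ n) x := by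
  have h1 : (green f ^ 2) x = ∑' p : ℕ × ℕ, (f ^ (p.1 + p.2)) x := by
    rw [pow_two, green, sum_mul, ENNReal.tsum_prod (f := fun i j => (f ^ (i + j)) x)]
    refine tsum_congr fun i => ?_
    change (f ^ i * sum fun n => f ^ n).toFun x = _
    rw [mul_sum, sum_apply]
    exact tsum_congr fun j => by rw [pow_add]
  rw [h1, ← Finset.HasAntidiagonal.sigmaAntidiagonalEquivProd.tsum_eq, ENNReal.tsum_sigma']
  refine tsum_congr fun n => ?_
  have h2 : ∀ b : Finset.HasAntidiagonal.antidiagonal n, (f ^ (b.1.1 + b.1.2)) x = (f ^ n) x :=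
    fun b => by rw [Finset.HasAntidiagonal.mem_antidiagonal.1 b.2]
  refine (tsum_congr h2).trans ?_
  rw [tsum_fintype, Finset.sum_const, Finset.card_univ, Fintype.card_coe,
    Finset.Nat.card_antidiagonal, nsmul_eq_mul]

theorem mul_green_apply_zero {f : Conv V} (hf : f 0 = 0) :
    (f * green f) 0 = ∑' n : ℕ, (f ^ (n + 2)) 0 := by
  rw [green, mul_sum, sum_apply, tsum_eq_zero_add' ENNReal.summable, pow_zero, mul_one, hf,
    zero_add]
  exact tsum_congr fun n => by rw [← pow_succ']

theorem mul_mul_green_sq_apply_zero (f : Conv V) :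
    (f * f * green f ^ 2) 0 = ∑' n : ℕ, (n + 1 : ℕ) * (f ^ (n + 2)) 0 := by
  have h : f * f * green f ^ 2 = sum fun n : ℕ => ((n + 1 : ℕ) : ℝ≥0∞) • f ^ (n + 2) := by
    have h1 : green f ^ 2 = sum fun n : ℕ => ((n + 1 : ℕ) : ℝ≥0∞) • f ^ n :=
      ext fun x => green_sq_apply f x
    rw [h1, mul_sum]
    refine congrArg sum (funext fun n => ?_)
    rw [mul_smul', ← pow_two, ← pow_add, add_comm 2]
  rw [h]
  rfl

end Conv

namespace LatticeTree

open FinTree Conv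

variable {d : ℕ} {N : Seminorm ℝ (Fin d → ℝ)} {hN : ∀ x, N x = 0 → x = 0} {L : ℕ}

theorem isHomogeneous_spreadOutGraph : (spreadOutGraph N L).IsHomogeneous (stepSet hN L) := by
  refine ⟨fun x y => ?_⟩
  rw [mem_stepSet, latticeNorm_sub_comm]
  rfl

theorem card_stepSet : (stepSet hN L).card = numSteps N L := by
  rw [numSteps, Set.ncard_eq_toFinset_card _ (steps_finite N hN L)]
  rfl

theorem stepDist_eq (x : Fin d → ℤ) : stepDist N L x = (unif (stepSet hN L) x).toReal := by
  rw [stepDist, unif_apply, ← card_stepSet (hN := hN)]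
  by_cases hx : x ∈ steps N L
  · rw [Set.indicator_of_mem hx, ind_of_true (mem_stepSet.2 hx), one_mul, ENNReal.toReal_inv,
      ENNReal.toReal_natCast, one_div]
  · rw [Set.indicator_of_notMem hx, ind_of_false fun h => hx (mem_stepSet.1 h), zero_mul,
      ENNReal.toReal_zero]

theorem unif_stepSet_zero : unif (stepSet hN L) 0 = 0 := by
  have h : (0 : Fin d → ℤ) ∉ stepSet hN L := fun h => by
    have h1 : latticeNorm N (0 : Fin d → ℤ) = 0 :=
      (congrArg N (funext fun i => by simp)).trans (map_zero N)
    exact (h1 ▸ (mem_stepSet.1 h).1).false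
  rw [unif_apply, ind_of_false h, zero_mul]

theorem convPow_eq (h : (stepSet hN L).card ≠ 0) (n : ℕ) (x : Fin d → ℤ) :
    convPow (stepDist N L) n x = ((unif (stepSet hN L) ^ n) x).toReal := by
  have ht : ∀ n x, (unif (stepSet hN L) ^ n) x ≠ ⊤ := by
    intro n x
    have h1 : mass (unif (stepSet hN L) ^ n) = 1 := by rw [mass_pow, mass_unif h, one_pow]
    exact ne_top_of_le_ne_top (h1.trans_ne ENNReal.one_ne_top) (ENNReal.le_tsum x)
  induction n generalizing x with
  | zero =>
    rw [pow_zero, convPow, one_def, single_apply, Pi.single_apply]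
    split_ifs <;> simp
  | succ n ih =>
    have h1 := ht 1
    rw [pow_one] at h1
    rw [convPow, pow_succ, mul_apply,
      ENNReal.tsum_toReal_eq fun y => ENNReal.mul_ne_top (ht n y) (h1 _)]
    refine tsum_congr fun y => ?_
    rw [ENNReal.toReal_mul, ih, stepDist_eq (hN := hN)]

/-- The lattice trees containing the origin, as a subtype of all finite trees. -/
def rootedTreesEquiv (N : Seminorm ℝ (Fin d → ℝ)) (L : ℕ) :
    rootedTrees N L ≃ {T : FinTree (spreadOutGraph N L) // 0 ∈ T.1.verts} where
  toFun T := ⟨⟨T.1, T.2.1, T.2.2.1⟩, T.2.2.2⟩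
  invFun T := ⟨T.1.1, T.1.2.1, T.1.2.2, T.2⟩
  left_inv _ := rfl
  right_inv _ := rfl

theorem weight_nonneg {p : ℝ} (hp : 0 ≤ p) (T : (spreadOutGraph N L).Subgraph) :
    0 ≤ weight N L p T := by
  unfold weight
  positivity

theorem tsum_ofReal_weight {p : ℝ} (hp : 0 ≤ p) :
    ∑' T : rootedTrees N L, ENNReal.ofReal (weight N L p T) =
      treeSum (Γ := spreadOutGraph N L) (wt (ENNReal.ofReal (p / numSteps N L)) ⊤) {0} := by
  rw [← (rootedTreesEquiv N L).symm.tsum_eq, treeSum]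
  have h1 : ∀ T : {T : FinTree (spreadOutGraph N L) // 0 ∈ T.1.verts},
      ENNReal.ofReal (weight N L p ((rootedTreesEquiv N L).symm T)) =
        wt (ENNReal.ofReal (p / numSteps N L)) ⊤ T.1 := by
    intro T
    rw [wt_top, ← ENNReal.ofReal_pow (by positivity)]
    rfl
  simp only [h1]
  refine (tsum_subtype {T : FinTree (spreadOutGraph N L) | 0 ∈ T.1.verts}
    (wt (ENNReal.ofReal (p / numSteps N L)) ⊤)).trans ?_
  refine tsum_congr fun T => ?_
  by_cases hT : 0 ∈ T.1.verts
  · rw [Set.indicator_of_mem (show T ∈ {T : FinTree _ | 0 ∈ T.1.verts} from hT),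
      ind_of_true (Set.singleton_subset_iff.2 hT), one_mul]
  · rw [Set.indicator_of_notMem (show T ∉ {T : FinTree _ | 0 ∈ T.1.verts} from hT),
      ind_of_false fun h => hT (Set.singleton_subset_iff.1 h), zero_mul]

theorem onePoint_nonneg {p : ℝ} (hp : 0 ≤ p) : 0 ≤ onePoint N L p :=
  tsum_nonneg fun T : rootedTrees N L => weight_nonneg hp T.1

theorem ofReal_onePoint {p : ℝ} (hp : 0 ≤ p)
    (hs : Summable fun T : rootedTrees N L => weight N L p T) : ENNReal.ofReal (onePoint N L p) =
      treeSum (Γ := spreadOutGraph N L) (wt (ENNReal.ofReal (p / numSteps N L)) ⊤) {0} := by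
  rw [← tsum_ofReal_weight hp]
  exact ENNReal.ofReal_tsum_of_nonneg (f := fun T : rootedTrees N L => weight N L p T)
    (fun T => weight_nonneg hp T.1) hs

/-- In terms of the weight `c = p / |Λ|` of an edge, the base point is characterized by `c * g * |Λ|
= 1`; the convergence of the series is contained in this equation between extended real numbers. -/
theorem isBasePoint_iff (h : (stepSet hN L).card ≠ 0) {p : ℝ} : IsBasePoint N L p ↔ 0 < p ∧
    ENNReal.ofReal (p / numSteps N L) *
      treeSum (Γ := spreadOutGraph N L) (wt (ENNReal.ofReal (p / numSteps N L)) ⊤) {0} *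
        ((stepSet hN L).card : ℝ≥0∞) = 1 := by
  rw [IsBasePoint]
  refine and_congr_right fun hp => ?_
  have hn : (0 : ℝ) < numSteps N L := by
    rw [← card_stepSet (hN := hN)]
    exact_mod_cast Nat.pos_of_ne_zero h
  have hpn : ENNReal.ofReal (p / numSteps N L) * ((stepSet hN L).card : ℝ≥0∞) =
      ENNReal.ofReal p := by
    rw [card_stepSet, ← ENNReal.ofReal_natCast, ← ENNReal.ofReal_mul (by positivity),
      div_mul_cancel₀ _ hn.ne']
  rw [mul_right_comm, hpn]
  constructor
  · rintro ⟨h1, h2⟩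
    rw [← ofReal_onePoint hp.le h1, ← ENNReal.ofReal_mul hp.le, h2, ENNReal.ofReal_one]
  · intro h1
    have ht : ∑' T : rootedTrees N L, ENNReal.ofReal (weight N L p T) ≠ ⊤ := by
      intro ht
      rw [← tsum_ofReal_weight hp.le, ht, ENNReal.mul_top (by simpa using hp)] at h1
      exact ENNReal.top_ne_one h1
    have hs : Summable fun T : rootedTrees N L => weight N L p T :=
      (ENNReal.summable_toReal ht).congr fun T => ENNReal.toReal_ofReal (weight_nonneg hp.le T.1)
    refine ⟨hs, ?_⟩
    rwa [← ofReal_onePoint hp.le hs, ← ENNReal.ofReal_mul hp.le, ENNReal.ofReal_eq_one] at h1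

theorem onePoint_eq {p : ℝ} (hp : IsBasePoint N L p) : onePoint N L p =
    (treeSum (Γ := spreadOutGraph N L) (wt (ENNReal.ofReal (p / numSteps N L)) ⊤) {0}).toReal := by
  rw [← ofReal_onePoint hp.1.le hp.2.1, ENNReal.toReal_ofReal (onePoint_nonneg hp.1.le)]

theorem existsUnique_isBasePoint (h : (stepSet hN L).card ≠ 0) :
    ∃ p, IsBasePoint N L p ∧ ∀ q, IsBasePoint N L q → q = p := by
  have hn : (0 : ℝ) < numSteps N L := by
    rw [← card_stepSet (hN := hN)]
    exact_mod_cast Nat.pos_of_ne_zero h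
  obtain ⟨c, hc⟩ := exists_basePoint (isHomogeneous_spreadOutGraph (hN := hN)) h
  have hc0 : c ≠ 0 := by
    rintro rfl
    simp at hc
  have hct : c ≠ ⊤ := by
    rintro rfl
    have h1 : treeSum (Γ := spreadOutGraph N L) (wt ⊤ ⊤) {0} ≠ 0 :=
      (one_pos.trans_le (one_le_treeSum ⊤)).ne'
    rw [ENNReal.top_mul h1, ENNReal.top_mul (by exact_mod_cast h)] at hc
    exact ENNReal.top_ne_one hc
  have hp : ENNReal.ofReal (c.toReal * numSteps N L / numSteps N L) = c := by
    rw [mul_div_cancel_right₀ _ hn.ne', ENNReal.ofReal_toReal hct]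
  refine ⟨c.toReal * numSteps N L, (isBasePoint_iff (hN := hN) h).2
    ⟨mul_pos (ENNReal.toReal_pos hc0 hct) hn, by rwa [hp]⟩, fun q hq => ?_⟩
  have h1 := basePoint_unique ((isBasePoint_iff (hN := hN) h).1 hq).2 hc
  rw [← h1, ENNReal.toReal_ofReal (div_pos hq.1 hn).le, div_mul_cancel₀ _ hn.ne']

/-- The coefficient `(n + 1) / 2` of the `n`-step return probability is `1 + (n - 1) / 2`: the
closed walk itself contributes to `D * S`, and `n - 1` is the number of ways to divide it into two nonempty
parts, which contribute to `D * D * S ^ 2`. -/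
theorem hasSum_convPow (h : (stepSet hN L).card ≠ 0)
    (h1 : (unif (stepSet hN L) * green (unif (stepSet hN L))) 0 ≠ ⊤)
    (h2 : (unif (stepSet hN L) * unif (stepSet hN L) * green (unif (stepSet hN L)) ^ 2) 0 ≠ ⊤) :
    HasSum (fun n : ℕ => (((n + 2 : ℕ) : ℝ) + 1) / 2 * convPow (stepDist N L) (n + 2) 0)
      (((unif (stepSet hN L) * green (unif (stepSet hN L))) 0).toReal +
        ((unif (stepSet hN L) * unif (stepSet hN L) *
          green (unif (stepSet hN L)) ^ 2) 0).toReal / 2) := by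
  rw [mul_green_apply_zero unif_stepSet_zero] at h1 ⊢
  rw [mul_mul_green_sq_apply_zero] at h2 ⊢
  have h3 := (ENNReal.hasSum_toReal h1).add ((ENNReal.hasSum_toReal h2).div_const 2)
  rw [← ENNReal.tsum_toReal_eq fun n => ENNReal.ne_top_of_tsum_ne_top h1 n,
    ← ENNReal.tsum_toReal_eq fun n => ENNReal.ne_top_of_tsum_ne_top h2 n] at h3
  convert h3 using 2 with n
  rw [convPow_eq (hN := hN) h, ENNReal.toReal_mul, ENNReal.toReal_natCast]
  push_cast
  ring

/-- The expansion of the base point follows from that of the 1-point function. -/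
theorem basePoint_bound {p g A e : ℝ} (hpg : p * g = 1) (hg : 1 ≤ g) (he0 : 0 ≤ e) (he1 : e ≤ 1)
    (hA0 : 0 ≤ A) (hA : A ≤ 3 / 2 * e) (h : |g - Real.exp 1 * (1 - A)| ≤ 100 * e ^ 2) :
    |p - (1 / Real.exp 1 + A / Real.exp 1)| ≤ 200 * e ^ 2 := by
  have hE : 2 ≤ Real.exp 1 := by
    have := Real.add_one_le_exp (1 : ℝ)
    linarith
  have hE0 : 0 < Real.exp 1 := by positivity
  have hg0 : 0 < g := by linarith
  have hp : p = 1 / g := eq_div_of_mul_eq hg0.ne' hpg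
  have h1 : p - (1 / Real.exp 1 + A / Real.exp 1) =
      (Real.exp 1 * A ^ 2 - (g - Real.exp 1 * (1 - A)) * (1 + A)) / (g * Real.exp 1) := by
    rw [hp]
    field_simp
    ring
  have h2 : |Real.exp 1 * A ^ 2 - (g - Real.exp 1 * (1 - A)) * (1 + A)| ≤
      Real.exp 1 * A ^ 2 + 100 * e ^ 2 * (1 + A) := by
    refine (abs_sub _ _).trans ?_
    rw [abs_of_nonneg (by positivity), abs_mul, abs_of_nonneg (by linarith : 0 ≤ 1 + A)]
    gcongr
  have h3 : A ^ 2 ≤ 9 / 4 * e ^ 2 := by nlinarith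
  have h4 : e ^ 2 * (1 + A) ≤ e ^ 2 * (5 / 2) := by
    gcongr
    linarith
  rw [h1, abs_div, abs_of_pos (by positivity : 0 < g * Real.exp 1), div_le_iff₀ (by positivity)]
  have h5 : 200 * e ^ 2 * Real.exp 1 ≤ 200 * e ^ 2 * (g * Real.exp 1) := by
    gcongr
    exact le_mul_of_one_le_left hE0.le hg
  have h6 : Real.exp 1 * A ^ 2 ≤ Real.exp 1 * (9 / 4 * e ^ 2) := by gcongr
  have h7 : e ^ 2 * 2 ≤ e ^ 2 * Real.exp 1 := by gcongr
  nlinarith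

end LatticeTree

open LatticeTree FinTree Conv in
theorem mainTheorem3 (d : ℕ) (hd : 8 < d)
    (N : Seminorm ℝ (Fin d → ℝ)) (hN : ∀ x, N x = 0 → x = 0) :
    ∃ (C : ℝ) (L₀ : ℕ), 0 < L₀ ∧ ∀ L : ℕ, L₀ ≤ L →
      Summable (fun n : ℕ => (((n + 2 : ℕ) : ℝ) + 1) / 2 *
        LatticeTree.convPow (LatticeTree.stepDist N L) (n + 2) 0) ∧
      ∃ p₁ : ℝ, LatticeTree.IsBasePoint N L p₁ ∧
        (∀ q : ℝ, LatticeTree.IsBasePoint N L q → q = p₁) ∧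
        |LatticeTree.onePoint N L p₁ - Real.exp 1 *
            (1 - ∑' n : ℕ, (((n + 2 : ℕ) : ℝ) + 1) / 2 *
              LatticeTree.convPow (LatticeTree.stepDist N L) (n + 2) 0)|
          ≤ C / (L : ℝ) ^ (2 * d) ∧
        |p₁ - (1 / Real.exp 1 + ∑' n : ℕ, (((n + 2 : ℕ) : ℝ) + 1) / (2 * Real.exp 1) *
              LatticeTree.convPow (LatticeTree.stepDist N L) (n + 2) 0)|
          ≤ C / (L : ℝ) ^ (2 * d) := by
  obtain ⟨C, L₀, hC, hL₀, hbound⟩ := exists_diagram_bound hd hN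
  refine ⟨200 * C ^ 2, max L₀ ⌈C⌉₊, lt_max_of_lt_left hL₀, fun L hL => ?_⟩
  obtain ⟨hΛ, hD⟩ := hbound L ((le_max_left _ _).trans hL)
  have hL1 : (1 : ℝ) ≤ L := by exact_mod_cast hL₀.trans_le ((le_max_left _ _).trans hL)
  set e : ℝ := C / (L : ℝ) ^ d with he
  have he0 : 0 ≤ e := by positivity
  have he1 : e ≤ 1 := by
    rw [he, div_le_one (by positivity)]
    calc C ≤ ⌈C⌉₊ := Nat.le_ceil C
      _ ≤ L := by exact_mod_cast (le_max_right _ _).trans hL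
      _ ≤ (L : ℝ) ^ d := le_self_pow₀ hL1 (by omega)
  have hee : 200 * C ^ 2 / (L : ℝ) ^ (2 * d) = 200 * e ^ 2 := by
    rw [he, div_pow, ← pow_mul, mul_comm d, mul_div_assoc]
  have hs₁ := diagram_le hD (f := unif (stepSet hN L) * green (unif (stepSet hN L)))
    (by simpa only [pow_one] using mul_pow_green_le (Λ := stepSet hN L) (i := 1) (by omega)) 0
  have hs₂ := diagram_le hD ((le_mul_green (Λ := stepSet hN L) _).trans
    (mul_mul_pow_green_le (i := 2) (by omega))) 0
  have hsum := hasSum_convPow hΛ (ne_top_of_le_ne_top ENNReal.ofReal_ne_top hs₁)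
    (ne_top_of_le_ne_top ENNReal.ofReal_ne_top hs₂)
  have hs₁' := ENNReal.toReal_le_of_le_ofReal he0 hs₁
  have hs₂' := ENNReal.toReal_le_of_le_ofReal he0 hs₂
  obtain ⟨p, hp, huniq⟩ := existsUnique_isBasePoint (hN := hN) hΛ
  have hc := ((isBasePoint_iff (hN := hN) hΛ).1 hp).2
  have hexp := onePoint_expansion he0 he1 hD (isHomogeneous_spreadOutGraph (hN := hN)) hc
  rw [← onePoint_eq hp] at hexp
  have hg1 : 1 ≤ onePoint N L p := by
    rw [onePoint_eq hp, ← ENNReal.toReal_one]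
    refine ENNReal.toReal_mono (fun ht => ?_) (one_le_treeSum _)
    have := onePoint_eq hp
    rw [ht, ENNReal.toReal_top] at this
    have h1 := hp.2.2
    rw [this, mul_zero] at h1
    exact zero_ne_one h1
  refine ⟨hsum.summable, p, hp, huniq, ?_, ?_⟩
  · rw [hsum.tsum_eq, hee]
    exact hexp.trans (by nlinarith [sq_nonneg e])
  · have h1 := (hsum.div_const (Real.exp 1)).tsum_eq
    have h2 : ∀ n : ℕ, (((n + 2 : ℕ) : ℝ) + 1) / (2 * Real.exp 1) *
        convPow (stepDist N L) (n + 2) 0 =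
          (((n + 2 : ℕ) : ℝ) + 1) / 2 * convPow (stepDist N L) (n + 2) 0 / Real.exp 1 := fun n => by
      rw [← div_div]
      ring
    rw [tsum_congr h2, h1, hee]
    refine basePoint_bound hp.2.2 hg1 he0 he1 ?_ ?_ hexp
    · positivity
    · linarith

end
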